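/- **Theorem.** For all integers $n,k\ge 0$, each of the nine polynomials $\mathcal P(x;w)=\sum_{\lambda\in\mathcal P}x^{w(\lambda)}$ attached to the pairs $(\mathcal P,w)$ below is equal to the symmetrized poly-Bernoulli polynomial $$\widehat{\mathscr B}_n^k(x)=\sum_{j=0}^{\min(n,k)} j!\,(x+1)^{\overline j}\,{n+1\brace j+1}{k+1\brace j+1}\in\mathbb Z[x],$$ where $(x+1)^{\overline j}=(x+1)(x+2)\cdots(x+j)$ and ${\cdot\brace\cdot}$ is the Stirling number of the second kind. *Double Callan permutations* of size $n\times k$: pairs $(S_1,S_2)$ of (possibly empty) strings which together contain each of the red elements $1,\dots,n$ and the blue elements $1,\dots,k$ exactly once, such that $S_1$ is empty or starts with a blue element, $S_2$ is empty or starts with a red element, and any two consecutive elements of the same color in one string are in decreasing order. Blocks of a string are its maximal substrings of one color. The weights are: 1. $w^{\mathrm{lr}}$: write $S_1=B_1R_1\cdots B_\ell R_\ell B_{\ell+1}$ with blue blocks $B_i$ and red blocks $R_i$, where only $B_{\ell+1}$ may be empty; $w^{\mathrm{lr}}$ is the number of $1\le i\le\ell$ such that $\min B_i<\min B_j$ for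 all $j<i$. 2. $w^{\mathrm{br}}$: inspect the red elements $n,n-1,\dots,1$ in this order, and stop when the first element of $S_2$ is reached. If the inspected element stands immediately after a blue element, and this blue element is smaller than the last marked one or nothing has been marked yet, mark this blue element. $w^{\mathrm{br}}$ is the number of marked elements. 3. $w^{\mathrm{RL}}$: let $S$ be the concatenation of $S_1$, a blue $0$, $S_2$ and a red $0$, and let $\pi_1,\dots,\pi_m$ be the maxima of the blue blocks of $S$, in order from left to right; $w^{\mathrm{RL}}$ is the number of $i$ such that $\pi_j<\pi_i$ for all $j>i$, minus one. *Alternative tableaux* of size $n\times k$: partial fillings of the cells of a rectangle with $n$ rows and $k$ columns with arrows $\leftarrow$ and $\downarrow$ such that all cells pointed to by an arrow (all cells to the left of a $\leftarrow$ in its row, and all cells below a $\downarrow$ in its column) are empty. If $n=0$ or $k=0$, there is exactly one, the empty one. The weights are: 4. $w^{\mathrm{st}}$: the number of arrows $\leftarrow$ such that their row and every row above it contain a $\leftarrow$, and every $\leftarrow$ in a higher row is located further to the right. 5. $w^{\leftarrow}$: the number of columns that contain a $\leftarrow$ but no $\downarrow$. *Packed alternative tableaux* of size $n\times k$: partial fillings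 of a rectangle with $n+1$ rows and $k+1$ columns with arrows $\leftarrow$ and $\downarrow$ such that all cells pointed to by an arrow are empty, each row except the bottom row contains exactly one $\leftarrow$, each column except the leftmost one contains exactly one $\downarrow$, the bottom row contains no $\leftarrow$, and the leftmost column contains no $\downarrow$. The weights are: 6. $w^{\leftarrow}$: the number of columns that contain a $\leftarrow$ and have $\downarrow$ in the bottom row. 7. $w^{\downarrow}$: the number of rows that contain a $\downarrow$ and have $\leftarrow$ in the leftmost column. *Double alternative trees* of size $n\times k$: pairs $(T_1,T_2)$ of labeled rooted trees whose vertex sets form a partition of the set of the red elements $0,\dots,n$ and the blue elements $0,\dots,k$, such that the root of $T_1$ is the red $0$, the root of $T_2$ is the blue $0$, all children of a red (resp. blue) vertex are blue (resp. red), and each descendant of a vertex either has a different color or is larger than the vertex. The weight is: 8. $w^{\mathrm{ch}}$: the number of children of the red $0$ that are not leaves. *Permutations with excedance set $[n]$*: permutations $\lambda$ of $\{1,\dots,n+k+1\}$ such that $\{i\mid\lambda(i)>i\}=\{1,\dots,n\}$. The weight is: 9. $w^{\mathrm{lr}}$: the number of $n<i\le n+k+1$ such that $\lambda(i)<\lambda(j)$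 for all $n<j<i$, minus one. -/

import Mathlib

namespace SymPolyBernoulli

open Polynomial

/-- The polynomial `∑_{p ∈ P} x ^ w(p)` attached to a finite set `P` of combinatorial objects with
a weight function `w : P → ℕ`. -/
noncomputable def genPoly (P : Type) [Fintype P] (w : P → ℕ) : ℤ[X] :=
  ∑ p : P, X ^ w p

/-- The (normalized) symmetrized poly-Bernoulli polynomial
`∑_{j=0}^{min(n,k)} j! (x+1)(x+2)⋯(x+j) S(n+1,j+1) S(k+1,j+1)`. -/
noncomputable def symPolyBernoulli (n k : ℕ) : ℤ[X] :=
  ∑ j ∈ Finset.range (min n k + 1),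
    C ((j.factorial * Nat.stirlingSecond (n + 1) (j + 1) *
      Nat.stirlingSecond (k + 1) (j + 1) : ℕ) : ℤ) * (ascPochhammer ℤ j).comp (X + 1)

/-! ### Colored elements -/

/-- The red elements `0, …, n` (left summand) and the blue elements `0, …, k` (right summand). -/
abbrev Elt (n k : ℕ) : Type := Fin (n + 1) ⊕ Fin (k + 1)

/-- The number written on a colored element. -/
def Elt.label {n k : ℕ} : Elt n k → ℕ
  | Sum.inl i => i
  | Sum.inr j => j

/-- The element is red. -/
def Elt.isRed {n k : ℕ} (v : Elt n k) : Bool := Sum.isLeft v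

/-- The element is blue. -/
def Elt.isBlue {n k : ℕ} (v : Elt n k) : Bool := Sum.isRight v

/-- The red element `0`. -/
def redZero (n k : ℕ) : Elt n k := Sum.inl 0

/-- The blue element `0`. -/
def blueZero (n k : ℕ) : Elt n k := Sum.inr 0

/-! ### Double Callan permutations -/

/-- A double Callan permutation of size `n × k`: a pair of (possibly empty) strings which together
contain each of the red elements `1, …, n` and the blue elements `1, …, k` exactly once, such that
`S₁` starts with a blue element (if nonempty), `S₂` starts with a red element (if nonempty), and
every block of consecutive elements of the same color is decreasing. -/
@[ext]
structure DoubleCallan (n k : ℕ) where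
  S₁ : List (Elt n k)
  S₂ : List (Elt n k)
  nodup : (S₁ ++ S₂).Nodup
  mem_iff : ∀ v : Elt n k, v ∈ S₁ ++ S₂ ↔ v.label ≠ 0
  head₁ : ∀ v ∈ S₁.head?, v.isBlue = true
  head₂ : ∀ v ∈ S₂.head?, v.isRed = true
  decr₁ : S₁.IsChain (fun u v => u.isRed = v.isRed → v.label < u.label)
  decr₂ : S₂.IsChain (fun u v => u.isRed = v.isRed → v.label < u.label)

noncomputable instance (n k : ℕ) : Fintype (DoubleCallan n k) :=
  Fintype.ofInjective
    (fun c : DoubleCallan n k =>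
      ((⟨c.S₁, (List.nodup_append.1 c.nodup).1⟩, ⟨c.S₂, (List.nodup_append.1 c.nodup).2.1⟩) :
        {l : List (Elt n k) // l.Nodup} × {l : List (Elt n k) // l.Nodup}))
    (by
      intro c d h
      simp only [Prod.mk.injEq, Subtype.mk.injEq] at h
      exact DoubleCallan.ext h.1 h.2)

/-- The decomposition of a string into its maximal substrings of constant color. All these
substrings are nonempty. -/
def blocks {n k : ℕ} (S : List (Elt n k)) : List (List (Elt n k)) :=
  S.splitBy (fun u v => u.isRed == v.isRed)

/-- The blue ones among a list of blocks. -/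
def blueOnes {n k : ℕ} (L : List (List (Elt n k))) : List (List (Elt n k)) :=
  L.filter (fun B => B.all Elt.isBlue)

/-- The smallest number on the elements of a nonempty block. -/
def blockMin {n k : ℕ} (B : List (Elt n k)) : ℕ := (B.map Elt.label).min?.getD 0

/-- The largest number on the elements of a nonempty block. -/
def blockMax {n k : ℕ} (B : List (Elt n k)) : ℕ := (B.map Elt.label).max?.getD 0

/-- The number of left-to-right minima of a sequence. -/
def lrMinCount (π : List ℕ) : ℕ :=
  (Finset.univ.filter (fun i : Fin π.length => ∀ j, j < i → π.get i < π.get j)).card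

/-- The number of right-to-left maxima of a sequence. -/
def rlMaxCount (π : List ℕ) : ℕ :=
  (Finset.univ.filter (fun i : Fin π.length => ∀ j, i < j → π.get j < π.get i)).card

/-- The sequence of the minima of the ordinary blue blocks `B₁, …, B_ℓ` of
`S₁ = B₁ R₁ ⋯ B_ℓ R_ℓ B_{ℓ+1}`. The last block of `S₁` is omitted before the blue blocks are
selected: it is either the extra block `B_{ℓ+1}`, or the red block `R_ℓ` if `B_{ℓ+1}` is empty. -/
def ordinaryMins {n k : ℕ} (S₁ : List (Elt n k)) : List ℕ :=
  (blueOnes (blocks S₁).dropLast).map blockMin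

/-- The weight `lr`: the number of left-to-right minima of the sequence of the minima of the
ordinary blue blocks of `S₁`. -/
def DoubleCallan.lr {n k : ℕ} (c : DoubleCallan n k) : ℕ := lrMinCount (ordinaryMins c.S₁)

/-- The weight `RL`: the number of right-to-left maxima of the sequence of the maxima of the blue
blocks of `S₁ 0 S₂ 0` (first a blue `0`, then a red `0`), minus one. The number of these maxima is
positive, because there is at least one blue block. -/
def DoubleCallan.RL {n k : ℕ} (c : DoubleCallan n k) : ℕ :=
  rlMaxCount ((blueOnes (blocks (c.S₁ ++ [blueZero n k] ++ c.S₂ ++ [redZero n k]))).map blockMax) - 1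

/-- The element standing immediately before (the first occurrence, as a non-initial element, of)
`r` in a string, if there is one. -/
def before? {n k : ℕ} (r : Elt n k) : List (Elt n k) → Option (Elt n k)
  | u :: v :: S => if v = r then some u else before? r (v :: S)
  | _ => none

/-- The number of blue elements marked while the red elements in the given list are inspected one
after the other. The process stops at the leading element of `S₂`. If the inspected element stands
immediately after a blue element which is smaller than the last marked element `m`, then this blue
element is marked; otherwise nothing is done. (`m = ⊤` if nothing has been marked yet.) -/
def markCount {n k : ℕ} (S₁ S₂ : List (Elt n k)) : List (Elt n k) → WithTop ℕ → ℕ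
  | [], _ => 0
  | r :: rs, m =>
    if S₂.head? = some r then 0
    else
      match (before? r S₁).or (before? r S₂) with
      | some b =>
        if b.isBlue = true ∧ (b.label : WithTop ℕ) < m then 1 + markCount S₁ S₂ rs b.label
        else markCount S₁ S₂ rs m
      | none => markCount S₁ S₂ rs m

/-- The red elements `n, n - 1, …, 1`, in this order. -/
def redsDescending (n k : ℕ) : List (Elt n k) :=
  (List.finRange n).reverse.map (fun i => Sum.inl i.succ)

/-- The weight `br`: the number of blue elements that are marked when the red elements
`n, n - 1, …, 1` are inspected in this order. -/
def DoubleCallan.br {n k : ℕ} (c : DoubleCallan n k) : ℕ :=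
  markCount c.S₁ c.S₂ (redsDescending n k) ⊤

/-! ### Alternative tableaux -/

/-- The two kinds of arrows in a tableau. -/
inductive Arrow where
  | left
  | down
  deriving DecidableEq

instance : Fintype Arrow := ⟨{Arrow.left, Arrow.down}, by intro a; cases a <;> simp⟩

/-- A partial filling with arrows of a rectangle with `n` rows and `k` columns. Row `0` is the top
row and column `0` is the leftmost column. -/
abbrev Filling (n k : ℕ) : Type := Fin n → Fin k → Option Arrow

/-- All cells pointed by an arrow are empty: those to the left of a left arrow, and those below a
down arrow. -/
def IsAlternative {n k : ℕ} (T : Filling n k) : Prop :=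
  (∀ r c, T r c = some Arrow.left → ∀ c', c' < c → T r c' = none) ∧
  (∀ r c, T r c = some Arrow.down → ∀ r', r < r' → T r' c = none)

/-- Alternative tableaux of rectangular shape of size `n × k`. -/
abbrev AltTableau (n k : ℕ) : Type := {T : Filling n k // IsAlternative T}

noncomputable instance (n k : ℕ) : Fintype (AltTableau n k) := Fintype.ofFinite _

/-- The weight `st`: the number of left arrows such that their row and all the rows above it contain
a left arrow, and all left arrows in the upper rows are located further to the right. -/
def AltTableau.st {n k : ℕ} (T : AltTableau n k) : ℕ :=
  (Finset.univ.filter (fun p : Fin n × Fin k =>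
    T.1 p.1 p.2 = some Arrow.left ∧
    (∀ r, r ≤ p.1 → ∃ c, T.1 r c = some Arrow.left) ∧
    (∀ r, r < p.1 → ∀ c, T.1 r c = some Arrow.left → p.2 < c))).card

/-- The weight `←`: the number of columns that contain `←` but do not contain `↓`. -/
def AltTableau.wLeft {n k : ℕ} (T : AltTableau n k) : ℕ :=
  (Finset.univ.filter (fun c : Fin k =>
    (∃ r, T.1 r c = some Arrow.left) ∧ ¬ ∃ r, T.1 r c = some Arrow.down)).card

/-- A filling of a rectangle of size `(n + 1) × (k + 1)` is packed if every row except the bottom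
row contains exactly one left arrow, every column except the leftmost column contains exactly one
down arrow, the bottom row contains no left arrow and the leftmost column no down arrow. -/
def IsPacked {n k : ℕ} (T : Filling (n + 1) (k + 1)) : Prop :=
  (∀ r, r ≠ Fin.last n → ∃! c, T r c = some Arrow.left) ∧
  (∀ c, c ≠ 0 → ∃! r, T r c = some Arrow.down) ∧
  (∀ c, T (Fin.last n) c ≠ some Arrow.left) ∧
  (∀ r, T r 0 ≠ some Arrow.down)

/-- Packed alternative tableaux of rectangular shape of size `n × k`. -/
abbrev PackedTableau (n k : ℕ) : Type :=
  {T : Filling (n + 1) (k + 1) // IsAlternative T ∧ IsPacked T}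

noncomputable instance (n k : ℕ) : Fintype (PackedTableau n k) := Fintype.ofFinite _

/-- The weight `←`: the number of columns that contain `←`, and contain `↓` in the bottom row. -/
def PackedTableau.wLeft {n k : ℕ} (T : PackedTableau n k) : ℕ :=
  (Finset.univ.filter (fun c : Fin (k + 1) =>
    (∃ r, T.1 r c = some Arrow.left) ∧ T.1 (Fin.last n) c = some Arrow.down)).card

/-- The weight `↓`: the number of rows that contain `↓`, and contain `←` in the leftmost column. -/
def PackedTableau.wDown {n k : ℕ} (T : PackedTableau n k) : ℕ :=
  (Finset.univ.filter (fun r : Fin (n + 1) =>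
    (∃ c, T.1 r c = some Arrow.down) ∧ T.1 r 0 = some Arrow.left)).card

/-! ### Double alternative trees -/

/-- A rooted tree with vertices in `V`, given by its vertex set, its root, and the parent of each
vertex other than the root. Every vertex is connected to the root. -/
@[ext]
structure LabeledRootedTree (V : Type) where
  verts : Finset V
  root : V
  parent : V → Option V
  root_mem : root ∈ verts
  parent_eq_none_iff : ∀ v, parent v = none ↔ v ∉ verts ∨ v = root
  parent_mem : ∀ u v, parent v = some u → u ∈ verts
  connected : ∀ v ∈ verts, Relation.ReflTransGen (fun u w => parent w = some u) root v

/-- `T.IsChild u v` means that `v` is a child of `u`. -/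
def LabeledRootedTree.IsChild {V : Type} (T : LabeledRootedTree V) (u v : V) : Prop :=
  T.parent v = some u

/-- `T.IsDescendant u v` means that `v` is a (proper) descendant of `u`. -/
def LabeledRootedTree.IsDescendant {V : Type} (T : LabeledRootedTree V) (u v : V) : Prop :=
  Relation.TransGen T.IsChild u v

noncomputable instance (V : Type) [Fintype V] : Fintype (LabeledRootedTree V) :=
  letI := Classical.decEq V
  Fintype.ofInjective
    (fun T : LabeledRootedTree V => (T.verts, T.root, T.parent))
    (by
      intro T T' h
      simp only [Prod.mk.injEq] at h
      exact LabeledRootedTree.ext h.1 h.2.1 h.2.2)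

/-- All children of each red (resp. blue) vertex are blue (resp. red), and the descendants of each
vertex have a different color or are larger than the vertex. -/
def IsAlternatingTree {n k : ℕ} (T : LabeledRootedTree (Elt n k)) : Prop :=
  (∀ u v, T.IsChild u v → u.isRed ≠ v.isRed) ∧
  (∀ u v, T.IsDescendant u v → u.isRed ≠ v.isRed ∨ u.label < v.label)

/-- A double alternative tree of size `n × k`. -/
@[ext]
structure DoubleAltTree (n k : ℕ) where
  T₁ : LabeledRootedTree (Elt n k)
  T₂ : LabeledRootedTree (Elt n k)
  disjoint : Disjoint T₁.verts T₂.verts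
  union : T₁.verts ∪ T₂.verts = Finset.univ
  root₁ : T₁.root = redZero n k
  root₂ : T₂.root = blueZero n k
  alt₁ : IsAlternatingTree T₁
  alt₂ : IsAlternatingTree T₂

noncomputable instance (n k : ℕ) : Fintype (DoubleAltTree n k) :=
  Fintype.ofInjective (fun D : DoubleAltTree n k => (D.T₁, D.T₂))
    (by
      intro D D' h
      simp only [Prod.mk.injEq] at h
      exact DoubleAltTree.ext h.1 h.2)

/-- The weight `ch`: the number of children of the red vertex `0` which are not leaves. -/
noncomputable def DoubleAltTree.ch {n k : ℕ} (D : DoubleAltTree n k) : ℕ :=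
  {v : Elt n k | D.T₁.IsChild (redZero n k) v ∧ ∃ u, D.T₁.IsChild v u}.ncard

/-! ### Permutations with excedance set `[n]` -/

/-- The permutations `p` of a set of `n + k + 1` elements (indexed from `0`, so that `[n]` consists
of the `i` with `i < n`) whose excedance set `{i | p i > i}` is exactly `[n]`. -/
abbrev ExcPerm (n k : ℕ) : Type :=
  {p : Equiv.Perm (Fin (n + k + 1)) // {i : Fin (n + k + 1) | i < p i} = {i : Fin (n + k + 1) | (i : ℕ) < n}}

noncomputable instance (n k : ℕ) : Fintype (ExcPerm n k) := Fintype.ofFinite _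

/-- The weight `lr`: the number of positions `i` outside `[n]` such that `p i < p j` for all
positions `j < i` outside `[n]`, minus one. There is at least one such position, namely the first
position outside `[n]`. -/
def ExcPerm.lr {n k : ℕ} (p : ExcPerm n k) : ℕ :=
  (Finset.univ.filter (fun i : Fin (n + k + 1) =>
    n ≤ (i : ℕ) ∧ ∀ j : Fin (n + k + 1), n ≤ (j : ℕ) → j < i → p.1 i < p.1 j)).card - 1

end SymPolyBernoulli

open SymPolyBernoulli

namespace SymPolyBernoulli

open Polynomial Finset

/-- The polynomial `(x + 1)(x + 2)⋯(x + j)`. -/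
noncomputable def rising (j : ℕ) : ℤ[X] := (ascPochhammer ℤ j).comp (X + 1)

theorem rising_succ (j : ℕ) : rising (j + 1) = rising j * (X + (j + 1 : ℤ[X])) := by
  simp only [rising, ascPochhammer_succ_right, mul_comp, add_comp, X_comp, natCast_comp]
  ring

theorem X_mul_rising (j : ℕ) : X * rising j = ascPochhammer ℤ (j + 1) :=
  (ascPochhammer_succ_left ℤ j).symm

theorem symPolyBernoulli_eq_sum (n k N : ℕ) (h : min n k < N) :
    symPolyBernoulli n k = ∑ j ∈ range N, (j.factorial : ℤ[X]) *
      rising j * Nat.stirlingSecond (n + 1) (j + 1) * Nat.stirlingSecond (k + 1) (j + 1) := by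
  have h1 : symPolyBernoulli n k = ∑ j ∈ range (min n k + 1), (j.factorial : ℤ[X]) *
      rising j * Nat.stirlingSecond (n + 1) (j + 1) * Nat.stirlingSecond (k + 1) (j + 1) := by
    refine sum_congr rfl fun j _ => ?_
    simp only [rising, Nat.cast_mul, map_mul, map_natCast]
    ring
  rw [h1]
  refine sum_subset (range_subset_range.2 h) fun j _ hj => ?_
  rw [mem_range, not_lt] at hj
  rcases min_choice n k with h2 | h2 <;> rw [h2] at hj
  · rw [Nat.stirlingSecond_eq_zero_of_lt (n := n + 1) (by omega)]; simp
  · rw [Nat.stirlingSecond_eq_zero_of_lt (n := k + 1) (by omega)]; simp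

theorem symPolyBernoulli_comm (n k : ℕ) : symPolyBernoulli n k = symPolyBernoulli k n := by
  rw [symPolyBernoulli_eq_sum n k _ (Nat.lt_succ_self _),
    symPolyBernoulli_eq_sum k n (min n k + 1) (by rw [min_comm]; omega)]
  exact sum_congr rfl fun j _ => by ring

theorem symPolyBernoulli_zero_right (n : ℕ) : symPolyBernoulli n 0 = 1 := by
  simp [symPolyBernoulli, Nat.stirlingSecond_one_right]

theorem sum_choose_mul_stirlingSecond (n j : ℕ) :
    ∑ i ∈ range (n + 1), n.choose i * Nat.stirlingSecond i j =
      Nat.stirlingSecond (n + 1) (j + 1) := by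
  induction n generalizing j with
  | zero => cases j <;> simp [Nat.stirlingSecond]
  | succ n ih =>
    have key : ∑ i ∈ range (n + 1), n.choose i * Nat.stirlingSecond (i + 1) j =
        j * Nat.stirlingSecond (n + 1) (j + 1) + Nat.stirlingSecond (n + 1) j := by
      cases j with
      | zero => simp
      | succ j =>
        rw [← ih (j + 1), ← ih j, mul_sum, ← sum_add_distrib]
        refine sum_congr rfl fun i _ => ?_
        rw [Nat.stirlingSecond_succ_succ]
        ring
    rw [sum_range_succ' , Nat.stirlingSecond_succ_succ]
    simp only [Nat.choose_succ_succ, add_mul, sum_add_distrib, key]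
    have h2 := ih j
    rw [sum_range_succ'] at h2
    rw [sum_range_succ (fun i => n.choose (i+1) * Nat.stirlingSecond (i+1) j)]
    simp at h2 ⊢
    linarith

theorem sum_choose_mul_stirlingSecond_succ (n j : ℕ) :
    ∑ i ∈ range (n + 1), n.choose i * Nat.stirlingSecond (i + 1) (j + 1) =
      (j + 1) * Nat.stirlingSecond (n + 1) (j + 2) + Nat.stirlingSecond (n + 1) (j + 1) := by
  rw [← sum_choose_mul_stirlingSecond n (j + 1), ← sum_choose_mul_stirlingSecond n j, mul_sum,
    ← sum_add_distrib]
  refine sum_congr rfl fun i _ => ?_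
  rw [Nat.stirlingSecond_succ_succ]
  ring

theorem sum_choose_mul_stirlingSecond_sub (n j : ℕ) :
    ∑ d ∈ range (n + 1), n.choose d * Nat.stirlingSecond (n - d + 1) (j + 1) =
      (j + 1) * Nat.stirlingSecond (n + 1) (j + 2) + Nat.stirlingSecond (n + 1) (j + 1) := by
  rw [← sum_choose_mul_stirlingSecond_succ, ← sum_range_reflect]
  refine sum_congr rfl fun i hi => ?_
  rw [mem_range] at hi
  rw [show n + 1 - 1 - i = n - i by omega, show n - (n - i) = i by omega,
    Nat.choose_symm (by omega)]

theorem sum_choose_succ_mul_stirlingSecond_sub (n j : ℕ) :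
    ∑ d ∈ range (n + 1), n.choose (d + 1) * Nat.stirlingSecond (n - d + 1) (j + 1) +
        Nat.stirlingSecond (n + 1) (j + 1) =
      (j + 1) * ∑ d ∈ range (n + 1), n.choose d * Nat.stirlingSecond (n - d + 1) (j + 1) := by
  have h1 : ∑ d ∈ range (n + 1), n.choose (d + 1) * Nat.stirlingSecond (n - d + 1) (j + 1) +
      Nat.stirlingSecond (n + 2) (j + 1) =
      ∑ i ∈ range (n + 1), n.choose i * Nat.stirlingSecond (i + 2) (j + 1) := by
    rw [← sum_range_reflect (fun i => n.choose i * Nat.stirlingSecond (i + 2) (j + 1)),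
      sum_range_succ, sum_range_succ']
    simp only [Nat.choose_succ_self, zero_mul, add_zero]
    congr 1
    · refine sum_congr rfl fun i hi => ?_
      rw [mem_range] at hi
      rw [show n + 1 - 1 - (i + 1) = n - (i + 1) by omega, Nat.choose_symm (by omega),
        show n - (i + 1) + 2 = n - i + 1 by omega]
    · simp
  have h2 : ∑ i ∈ range (n + 1), n.choose i * Nat.stirlingSecond (i + 2) (j + 1) =
      (j + 1) * ∑ i ∈ range (n + 1), n.choose i * Nat.stirlingSecond (i + 1) (j + 1) +
        (j * Nat.stirlingSecond (n + 1) (j + 1) + Nat.stirlingSecond (n + 1) j) := by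
    have : ∑ i ∈ range (n + 1), n.choose i * Nat.stirlingSecond (i + 1) j =
        j * Nat.stirlingSecond (n + 1) (j + 1) + Nat.stirlingSecond (n + 1) j := by
      cases j with
      | zero => simp
      | succ j => exact sum_choose_mul_stirlingSecond_succ n j
    rw [← this, mul_sum, ← sum_add_distrib]
    refine sum_congr rfl fun i _ => ?_
    rw [Nat.stirlingSecond_succ_succ (i + 1)]
    ring
  rw [sum_choose_mul_stirlingSecond_succ] at h2
  rw [sum_choose_mul_stirlingSecond_sub]
  rw [h2, Nat.stirlingSecond_succ_succ (n + 1)] at h1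
  linarith

/-- The weighted number of ways to fill a column with `l` live rows and `d` left arrows. -/
noncomputable def columnCoeff (l d : ℕ) : ℤ[X] :=
  (l.choose (d + 1) : ℤ[X]) + X * (l.choose d : ℤ[X]) + if d = 0 then 1 - X else 0

theorem symPolyBernoulli_succ_right (n k : ℕ) :
    symPolyBernoulli n (k + 1) =
      ∑ d ∈ range (n + 1), columnCoeff n d * symPolyBernoulli (n - d) k := by
  set s : ℕ → ℤ[X] := fun j => (Nat.stirlingSecond (n + 1) j : ℤ[X]) with hs
  set u : ℕ → ℤ[X] := fun j => (Nat.stirlingSecond (k + 1) j : ℤ[X]) with hu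
  set r : ℕ → ℤ[X] := fun j => (j.factorial : ℤ[X]) * rising j with hr
  have hrs : ∀ j : ℕ, r (j + 1) = (j + 1 : ℤ[X]) * (X + (j + 1 : ℤ[X])) * r j := by
    intro j
    simp only [hr, rising_succ, Nat.factorial_succ]
    push_cast
    ring
  have hcoef : ∀ j : ℕ, ∑ d ∈ range (n + 1), columnCoeff n d *
      (Nat.stirlingSecond (n - d + 1) (j + 1) : ℤ[X]) =
      (j + 1 : ℤ[X]) * s (j + 1) + (j + 1 : ℤ[X]) * (X + (j + 1 : ℤ[X])) * s (j + 2) := by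
    intro j
    have hA := congrArg (Nat.cast : ℕ → ℤ[X]) (sum_choose_succ_mul_stirlingSecond_sub n j)
    rw [sum_choose_mul_stirlingSecond_sub] at hA
    have hB := congrArg (Nat.cast : ℕ → ℤ[X]) (sum_choose_mul_stirlingSecond_sub n j)
    push_cast at hA hB
    have hC : ∑ d ∈ range (n + 1), (if d = 0 then 1 - X else 0 : ℤ[X]) *
      (Nat.stirlingSecond (n - d + 1) (j + 1) : ℤ[X]) = (1 - X) * s (j + 1) := by
      rw [sum_eq_single 0] <;> simp +contextual [hs]
    simp only [columnCoeff, add_mul, sum_add_distrib, hC, mul_assoc X, ← mul_sum, hB]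
    linear_combination hA
  have hl : symPolyBernoulli n (k + 1) = ∑ j ∈ range (n + 2), r j * s (j + 1) *
      ((j + 1 : ℤ[X]) * u (j + 1) + u j) := by
    rw [symPolyBernoulli_eq_sum n (k + 1) (n + 2) (by omega)]
    refine sum_congr rfl fun j _ => ?_
    rw [Nat.stirlingSecond_succ_succ (k + 1)]
    push_cast
    ring
  have hR : ∑ d ∈ range (n + 1), columnCoeff n d * symPolyBernoulli (n - d) k =
      ∑ j ∈ range (n + 1), r j * u (j + 1) *
        ((j + 1 : ℤ[X]) * s (j + 1) + (j + 1 : ℤ[X]) * (X + (j + 1 : ℤ[X])) * s (j + 2)) := by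
    have : ∀ d ∈ range (n + 1), columnCoeff n d * symPolyBernoulli (n - d) k =
        ∑ j ∈ range (n + 1), columnCoeff n d * (r j * u (j + 1) *
          (Nat.stirlingSecond (n - d + 1) (j + 1) : ℤ[X])) := by
      intro d _
      rw [symPolyBernoulli_eq_sum (n - d) k (n + 1) (by omega), mul_sum]
      exact sum_congr rfl fun j _ => by ring
    rw [sum_congr rfl this, sum_comm]
    refine sum_congr rfl fun j _ => ?_
    rw [← hcoef, mul_sum]
    exact sum_congr rfl fun d _ => by ring
  have hs0 : s (n + 2) = 0 := by
    simp [hs, Nat.stirlingSecond_eq_zero_of_lt (show n + 1 < n + 2 by omega)]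
  have hu0 : u 0 = 0 := by simp [hu]
  rw [hl, hR]
  simp only [mul_add, sum_add_distrib]
  congr 1
  · rw [sum_range_succ]
    simp only [hs0]
    rw [mul_zero, zero_mul, add_zero]
    exact sum_congr rfl fun j _ => by ring
  · rw [sum_range_succ']
    simp only [hu0, mul_zero, add_zero]
    refine sum_congr rfl fun j _ => ?_
    rw [hrs]
    ring

theorem card_filter_univ_castSucc {a : ℕ} (p : Fin (a + 1) → Prop) [DecidablePred p] :
    #{b | p b} = #{b : Fin a | p b.castSucc} + if p (Fin.last a) then 1 else 0 := by
  simp only [card_filter]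
  exact Fin.sum_univ_castSucc _

theorem image_snoc {β : Type*} [DecidableEq β] {a : ℕ} (g : Fin a → β) (v : β) :
    univ.image (Fin.snoc g v : Fin (a + 1) → β) = insert v (univ.image g) := by
  ext u
  simp only [mem_image, mem_univ, true_and, mem_insert]
  constructor
  · rintro ⟨b, rfl⟩
    induction b using Fin.lastCases <;> simp
  · rintro (rfl | ⟨b, rfl⟩)
    · exact ⟨Fin.last a, by simp⟩
    · exact ⟨b.castSucc, by simp⟩

theorem insert_eq_iff {β : Type*} [DecidableEq β] {v : β} {s T : Finset β} (hv : v ∈ T) :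
    insert v s = T ↔ s = T ∨ s = T.erase v := by
  constructor
  · rintro rfl
    by_cases h : v ∈ s
    · left; simp [h]
    · right; simp [h]
  · rintro (rfl | rfl) <;> simp [hv]

section Words
variable {β γ : Type*} [DecidableEq β] [LinearOrder γ]

/-- The number of strict left-to-right minima of a word with respect to a ranking `φ` of its
letters. -/
def recordCount (φ : β → γ) {a : ℕ} (g : Fin a → β) : ℕ :=
  #{b : Fin a | ∀ b' < b, φ (g b) < φ (g b')}

open Classical in
/-- This is `1` if the letter `v` is ranked below all letters in `s`, and `0` otherwise. -/
noncomputable def belowAll (φ : β → γ) (s : Finset β) (v : β) : ℕ :=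
  if ∀ u ∈ s, φ v < φ u then 1 else 0

theorem recordCount_snoc (φ : β → γ) {a : ℕ} (g : Fin a → β) (v : β) :
    recordCount φ (Fin.snoc g v : Fin (a + 1) → β) =
      recordCount φ g + belowAll φ (univ.image g) v := by
  unfold recordCount belowAll
  rw [card_filter_univ_castSucc]
  congr 1
  · congr 1
    ext b
    simp only [mem_filter, mem_univ, true_and, Fin.snoc_castSucc]
    constructor
    · intro H b' hb'
      simpa using H b'.castSucc (by simpa using hb')
    · intro H b' hb'
      obtain ⟨b'', rfl⟩ : ∃ b'' : Fin a, Fin.castSucc b'' = b' :=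
        ⟨b'.castPred (Fin.ne_last_of_lt hb'), by simp⟩
      simpa using H b'' (by simpa using hb')
  · congr 1
    simp only [Fin.snoc_last, mem_image, mem_univ, true_and, forall_exists_index,
      forall_apply_eq_imp_iff, eq_iff_iff]
    constructor
    · intro H b
      simpa using H b.castSucc (Fin.castSucc_lt_last b)
    · intro H b' hb'
      obtain ⟨b'', rfl⟩ : ∃ b'' : Fin a, Fin.castSucc b'' = b' :=
        ⟨b'.castPred (Fin.ne_last_of_lt hb'), by simp⟩
      simpa using H b''

theorem sum_ite_lt_erase {φ : β → γ} (hφ : φ.Injective) {T : Finset β} (hT : T.Nonempty) :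
    ∑ v ∈ T, (X : ℤ[X]) ^ belowAll φ (T.erase v) v = X + ((#T - 1 : ℕ) : ℤ[X]) := by
  unfold belowAll
  obtain ⟨m, hm, hmin⟩ := T.exists_min_image φ hT
  rw [← add_sum_erase _ _ hm, if_pos, pow_one]
  · congr 1
    rw [← card_erase_of_mem hm, ← nsmul_one, ← sum_const]
    refine sum_congr rfl fun v hv => ?_
    rw [if_neg, pow_zero]
    rw [mem_erase] at hv
    intro H
    exact (hmin v hv.2).not_gt (H m (mem_erase.2 ⟨hv.1.symm, hm⟩))
  · intro u hu
    rw [mem_erase] at hu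
    exact lt_of_le_of_ne (hmin u hu.2) fun h => hu.1 (hφ h).symm

theorem sum_words_pow_recordCount [Fintype β] {φ : β → γ} (hφ : φ.Injective) (a : ℕ) (T : Finset β) :
    ∑ g : Fin a → β with univ.image g = T, (X : ℤ[X]) ^ recordCount φ g =
      ascPochhammer ℤ #T * Nat.stirlingSecond a #T := by
  induction a generalizing T with
  | zero =>
    rcases T.eq_empty_or_nonempty with rfl | hT
    · simp [recordCount]
    · obtain ⟨c, hc⟩ := Nat.exists_eq_succ_of_ne_zero (card_ne_zero.2 hT)
      rw [hc]
      simp [hT.ne_empty.symm]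
  | succ a ih =>
    rw [sum_filter, ← (Fin.snocEquiv (fun _ : Fin (a + 1) => β)).sum_comp, Fintype.sum_prod_type]
    simp only [Fin.snocEquiv, Equiv.coe_fn_mk, recordCount_snoc, image_snoc]
    rw [← sum_subset (subset_univ T)]
    swap
    · intro v _ hv
      refine sum_eq_zero fun g _ => if_neg fun h => hv ?_
      rw [← h]; simp
    have key : ∀ v ∈ T, (∑ g : Fin a → β, if insert v (univ.image g) = T then (X : ℤ[X]) ^
        (recordCount φ g + belowAll φ (univ.image g) v) else 0) =
        ascPochhammer ℤ #T * (Nat.stirlingSecond a #T : ℤ[X]) +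
        ascPochhammer ℤ (#T - 1) * (Nat.stirlingSecond a (#T - 1) : ℤ[X]) *
          X ^ belowAll φ (T.erase v) v := by
      intro v hv
      rw [← ih T, ← card_erase_of_mem hv, ← ih (T.erase v), sum_mul, sum_filter, sum_filter,
        ← sum_add_distrib]
      refine sum_congr rfl fun g _ => ?_
      simp only [insert_eq_iff hv]
      by_cases h1 : univ.image g = T
      · have h2 : univ.image g ≠ T.erase v := by
          rw [h1]; intro h; rw [h] at hv; simp at hv
        have h3 : belowAll φ (univ.image g) v = 0 := by
          rw [h1]; exact if_neg fun h => lt_irrefl _ (h v hv)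
        rw [if_pos (Or.inl h1), if_pos h1, if_neg h2, h3]
        simp
      · by_cases h2 : univ.image g = T.erase v
        · rw [if_pos (Or.inr h2), if_neg h1, if_pos h2, h2, pow_add, zero_add]
        · rw [if_neg (by tauto), if_neg h1, if_neg h2, zero_add]
    rw [sum_congr rfl key, sum_add_distrib, sum_const, ← mul_sum]
    rcases T.eq_empty_or_nonempty with rfl | hT
    · simp
    · rw [sum_ite_lt_erase hφ hT]
      obtain ⟨c, hc⟩ := Nat.exists_eq_succ_of_ne_zero (card_ne_zero.2 hT)
      rw [hc, Nat.succ_eq_add_one, Nat.stirlingSecond_succ_succ, Nat.add_sub_cancel,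
        ascPochhammer_succ_right]
      simp only [nsmul_eq_mul]
      push_cast
      ring

end Words

theorem recordCount_pos {β γ : Type*} [LinearOrder γ] (φ : β → γ) {a : ℕ} (g : Fin (a + 1) → β) :
    0 < recordCount φ g :=
  card_pos.2 ⟨0, by simp⟩

theorem image_eq_univ_iff {β : Type*} [Fintype β] [DecidableEq β] {a : ℕ} (g : Fin a → β) :
    univ.image g = univ ↔ g.Surjective := by
  simp [Finset.eq_univ_iff_forall, Function.Surjective]

open Classical in
theorem sum_surjective_pow_recordCount {γ : Type*} [LinearOrder γ] {k j : ℕ}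
    {φ : Fin (j + 1) → γ} (hφ : φ.Injective) :
    ∑ g : Fin (k + 1) → Fin (j + 1) with g.Surjective, (X : ℤ[X]) ^ (recordCount φ g - 1) =
      rising j * Nat.stirlingSecond (k + 1) (j + 1) := by
  refine mul_left_cancel₀ (X_ne_zero : (X : ℤ[X]) ≠ 0) ?_
  have h := sum_words_pow_recordCount hφ (k + 1) univ
  simp only [image_eq_univ_iff, card_univ, Fintype.card_fin] at h
  rw [← mul_assoc, X_mul_rising, ← h, mul_sum]
  refine sum_congr rfl fun g _ => ?_
  rw [← pow_succ', Nat.sub_add_cancel (recordCount_pos φ g)]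

open Classical in
theorem card_surjective_apply_eq {n j : ℕ} (a : Fin n) (c : Fin (j + 1)) :
    #{f : Fin n → Fin (j + 1) | f.Surjective ∧ f a = c} =
      j.factorial * Nat.stirlingSecond n (j + 1) := by
  have h1 : ∑ c : Fin (j + 1), #{f : Fin n → Fin (j + 1) | f.Surjective ∧ f a = c} =
      (j + 1).factorial * Nat.stirlingSecond n (j + 1) := by
    have h := congrArg (Polynomial.eval 1) (sum_words_pow_recordCount
      (φ := (id : Fin (j + 1) → Fin (j + 1))) Function.injective_id n univ)
    simp only [image_eq_univ_iff, card_univ, Fintype.card_fin, eval_finsetSum, eval_pow, eval_X,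
      one_pow, sum_const, nsmul_one, eval_mul, eval_natCast, ascPochhammer_eval_one] at h
    have h' := card_eq_sum_card_fiberwise (f := fun f : Fin n → Fin (j + 1) => f a)
      (s := {f | f.Surjective}) (t := univ) (by simp)
    simp only [filter_filter] at h'
    rw [← h']
    exact_mod_cast h
  have h2 : ∀ c' : Fin (j + 1), #{f : Fin n → Fin (j + 1) | f.Surjective ∧ f a = c'} =
      #{f : Fin n → Fin (j + 1) | f.Surjective ∧ f a = c} := by
    intro c'
    refine card_equiv (Equiv.arrowCongr (Equiv.refl _) (Equiv.swap c c')) fun f => ?_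
    simp only [mem_filter, mem_univ, true_and]
    change _ ↔ Function.Surjective (Equiv.swap c c' ∘ f) ∧ Equiv.swap c c' (f a) = c
    rw [Equiv.comp_surjective]
    refine and_congr_right fun _ => ?_
    rw [Equiv.swap_apply_eq_iff, Equiv.swap_apply_left]
  rw [sum_congr rfl fun c' _ => h2 c', sum_const, card_univ, Fintype.card_fin, smul_eq_mul,
    Nat.factorial_succ, mul_assoc] at h1
  exact Nat.eq_of_mul_eq_mul_left (Nat.succ_pos j) h1

set_option linter.unusedSectionVars false

section Columns
variable {R : Type*} [Fintype R] [LinearOrder R]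

/-- The rows of a column that contain a left arrow. -/
def leftRows (v : R → Option Arrow) : Finset R := {r | v r = some Arrow.left}

/-- A column is admissible for a set `A` of rows if it is empty outside `A` and below every down
arrow. -/
def IsColumn (A : Finset R) (v : R → Option Arrow) : Prop :=
  (∀ r, r ∉ A → v r = none) ∧ ∀ r, v r = some Arrow.down → ∀ r', r < r' → v r' = none

/-- The column with left arrows in the rows `D`. -/
def leftColumn (D : Finset R) : R → Option Arrow :=
  fun r => if r ∈ D then some Arrow.left else none

/-- The column with arrows in the rows `E`, the lowest of which is a down arrow. -/
def downColumn (E : Finset R) : R → Option Arrow :=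
  fun r => if r ∈ E then (if ∀ e ∈ E, e ≤ r then some Arrow.down else some Arrow.left) else none

/-- The rows of a column that contain an arrow. -/
def arrowRows (v : R → Option Arrow) : Finset R := {r | v r ≠ none}

theorem mem_leftRows {v : R → Option Arrow} {r : R} : r ∈ leftRows v ↔ v r = some Arrow.left := by
  simp [leftRows]

theorem mem_arrowRows {v : R → Option Arrow} {r : R} : r ∈ arrowRows v ↔ v r ≠ none := by
  simp [arrowRows]

theorem leftRows_leftColumn (D : Finset R) : leftRows (leftColumn D) = D := by
  ext r; simp [leftRows, leftColumn]

theorem leftRows_downColumn {E : Finset R} (hE : E.Nonempty) :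
    leftRows (downColumn E) = E.erase (E.max' hE) := by
  ext r
  simp only [mem_leftRows, downColumn, mem_erase]
  constructor
  · intro h
    split_ifs at h with h1 h2
    · simp at h
    · refine ⟨?_, h1⟩
      rintro rfl
      exact h2 fun e he => E.le_max' e he
  · rintro ⟨h1, h2⟩
    rw [if_pos h2, if_neg]
    intro h
    exact h1 (le_antisymm (E.le_max' r h2) (h _ (E.max'_mem hE)))

theorem exists_down_downColumn {E : Finset R} (hE : E.Nonempty) :
    ∃ r, downColumn E r = some Arrow.down :=
  ⟨E.max' hE, by
    rw [downColumn, if_pos (E.max'_mem hE), if_pos fun e he => E.le_max' e he]⟩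

theorem isColumn_leftColumn {A D : Finset R} (h : D ⊆ A) : IsColumn A (leftColumn D) := by
  refine ⟨fun r hr => if_neg fun h' => hr (h h'), fun r hr => ?_⟩
  simp [leftColumn] at hr

theorem isColumn_downColumn {A E : Finset R} (h : E ⊆ A) : IsColumn A (downColumn E) := by
  refine ⟨fun r hr => if_neg fun h' => hr (h h'), fun r hr r' hr' => ?_⟩
  unfold downColumn at hr ⊢
  split_ifs at hr with h1 h2
  · exact if_neg fun h' => (h2 r' h').not_gt hr'
  · simp at hr

theorem arrowRows_leftColumn (D : Finset R) : arrowRows (leftColumn D) = D := by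
  ext r; simp [arrowRows, leftColumn]

theorem arrowRows_downColumn (E : Finset R) : arrowRows (downColumn E) = E := by
  ext r
  simp only [mem_arrowRows, downColumn]
  split_ifs <;> simp_all

theorem arrowRows_subset {A : Finset R} {v : R → Option Arrow} (h : IsColumn A v) :
    arrowRows v ⊆ A := by
  intro r hr
  by_contra h'
  simp [arrowRows, h.1 r h'] at hr

theorem leftColumn_arrowRows {v : R → Option Arrow} (h : ¬ ∃ r, v r = some Arrow.down) :
    leftColumn (arrowRows v) = v := by
  ext1 r
  simp only [leftColumn, arrowRows, mem_filter, mem_univ, true_and]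
  rcases hv : v r with _ | (_ | _)
  · simp
  · simp
  · exact absurd ⟨r, hv⟩ h

theorem downColumn_arrowRows {A : Finset R} {v : R → Option Arrow} (hA : IsColumn A v)
    (h : ∃ r, v r = some Arrow.down) : downColumn (arrowRows v) = v := by
  obtain ⟨p, hp⟩ := h
  ext1 r
  simp only [downColumn, arrowRows, mem_filter, mem_univ, true_and]
  rcases hv : v r with _ | (_ | _)
  · simp
  · rw [if_pos (by simp), if_neg]
    intro h
    have h1 := h p (by simp [hp])
    rcases h1.lt_or_eq with h1 | rfl
    · rw [hA.2 p hp r h1] at hv; simp at hv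
    · rw [hv] at hp; simp at hp
  · rw [if_pos (by simp), if_pos]
    intro e he
    by_contra h1
    exact he (hA.2 r hv e (not_le.1 h1))

open Classical in
theorem sum_isColumn {M : Type*} [AddCommMonoid M] (A : Finset R) (h : (R → Option Arrow) → M) :
    ∑ v : R → Option Arrow with IsColumn A v, h v =
      ∑ D ∈ A.powerset, h (leftColumn D) + ∑ E ∈ A.powerset with E.Nonempty, h (downColumn E) := by
  rw [← sum_filter_not_add_sum_filter _ (fun v => ∃ r, v r = some Arrow.down)]
  congr 1
  · refine sum_nbij' arrowRows leftColumn ?_ ?_ ?_ ?_ ?_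
    · intro v hv
      simp only [mem_filter, mem_univ, true_and] at hv
      exact mem_powerset.2 (arrowRows_subset hv.1)
    · intro D hD
      simp only [mem_filter, mem_univ, true_and]
      refine ⟨isColumn_leftColumn (mem_powerset.1 hD), ?_⟩
      simp [leftColumn]
    · intro v hv
      simp only [mem_filter, mem_univ, true_and] at hv
      exact leftColumn_arrowRows hv.2
    · intro D _
      exact arrowRows_leftColumn D
    · intro v hv
      simp only [mem_filter, mem_univ, true_and] at hv
      rw [leftColumn_arrowRows hv.2]
  · refine sum_nbij' arrowRows downColumn ?_ ?_ ?_ ?_ ?_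
    · intro v hv
      simp only [mem_filter, mem_univ, true_and] at hv
      refine mem_filter.2 ⟨mem_powerset.2 (arrowRows_subset hv.1), ?_⟩
      obtain ⟨r, hr⟩ := hv.2
      exact ⟨r, by simp [arrowRows, hr]⟩
    · intro E hE
      rw [mem_filter, mem_powerset] at hE
      simp only [mem_filter, mem_univ, true_and]
      exact ⟨isColumn_downColumn hE.1, exists_down_downColumn hE.2⟩
    · intro v hv
      simp only [mem_filter, mem_univ, true_and] at hv
      exact downColumn_arrowRows hv.1 hv.2
    · intro E _
      exact arrowRows_downColumn E
    · intro v hv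
      simp only [mem_filter, mem_univ, true_and] at hv
      rw [downColumn_arrowRows hv.1 hv.2]

/-- The rows in `A` that contain no left arrow to the right of the column `c`. -/
def liveRows (A : Finset R) {k : ℕ} (T : Fin k → R → Option Arrow) (c : Fin k) : Finset R :=
  {r ∈ A | ∀ c', c < c' → T c' r ≠ some Arrow.left}

theorem liveRows_snoc_last (A : Finset R) {k : ℕ} (T : Fin k → R → Option Arrow)
    (v : R → Option Arrow) :
    liveRows A (Fin.snoc T v : Fin (k + 1) → R → Option Arrow) (Fin.last k) = A := by
  ext r
  simp only [liveRows, mem_filter, and_iff_left_iff_imp]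
  intro _ c' hc'
  exact absurd (Fin.le_last c') hc'.not_ge

theorem liveRows_snoc_castSucc (A : Finset R) {k : ℕ} (T : Fin k → R → Option Arrow)
    (v : R → Option Arrow) (c : Fin k) :
    liveRows A (Fin.snoc T v : Fin (k + 1) → R → Option Arrow) c.castSucc =
      liveRows (A \ leftRows v) T c := by
  ext r
  simp only [liveRows, mem_filter, mem_sdiff, leftRows, mem_univ, true_and, and_assoc]
  refine and_congr_right fun _ => ?_
  constructor
  · intro h
    refine ⟨by simpa using h (Fin.last k) (Fin.castSucc_lt_last c), fun c' hc' => ?_⟩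
    simpa using h c'.castSucc (by simpa using hc')
  · rintro ⟨h1, h2⟩ c' hc'
    induction c' using Fin.lastCases with
    | last => simpa using h1
    | cast c' => simpa using h2 c' (by simpa using hc')

/-- All columns are admissible for the live rows. -/
def IsTableau (A : Finset R) {k : ℕ} (T : Fin k → R → Option Arrow) : Prop :=
  ∀ c, IsColumn (liveRows A T c) (T c)

open Classical in
/-- The number of columns with property `χ` (relative to the live rows). -/
noncomputable def columnWeight (χ : Finset R → (R → Option Arrow) → Prop) (A : Finset R) {k : ℕ}
    (T : Fin k → R → Option Arrow) : ℕ :=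
  #{c | χ (liveRows A T c) (T c)}

theorem isTableau_snoc (A : Finset R) {k : ℕ} (T : Fin k → R → Option Arrow)
    (v : R → Option Arrow) :
    IsTableau A (Fin.snoc T v : Fin (k + 1) → R → Option Arrow) ↔
      IsTableau (A \ leftRows v) T ∧ IsColumn A v := by
  simp only [IsTableau, Fin.forall_fin_succ', liveRows_snoc_last, liveRows_snoc_castSucc,
    Fin.snoc_last, Fin.snoc_castSucc]

open Classical in
theorem columnWeight_snoc (χ : Finset R → (R → Option Arrow) → Prop) (A : Finset R) {k : ℕ}
    (T : Fin k → R → Option Arrow) (v : R → Option Arrow) :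
    columnWeight χ A (Fin.snoc T v : Fin (k + 1) → R → Option Arrow) =
      columnWeight χ (A \ leftRows v) T + if χ A v then 1 else 0 := by
  rw [columnWeight, card_filter_univ_castSucc]
  simp only [liveRows_snoc_last, liveRows_snoc_castSucc, Fin.snoc_last, Fin.snoc_castSucc,
    columnWeight]

open Classical in
/-- The generating polynomial of the alternative tableaux with `k` columns and arrows in the rows
`A` only, with respect to the number of columns with property `χ` (relative to the live rows). -/
noncomputable def columnGenPoly (χ : Finset R → (R → Option Arrow) → Prop) (A : Finset R) (k : ℕ) :
    ℤ[X] :=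
  ∑ T : Fin k → R → Option Arrow with IsTableau A T, X ^ columnWeight χ A T

theorem columnGenPoly_zero (χ : Finset R → (R → Option Arrow) → Prop) (A : Finset R) :
    columnGenPoly χ A 0 = 1 := by
  simp [columnGenPoly, IsTableau, columnWeight]

open Classical in
theorem columnGenPoly_succ (χ : Finset R → (R → Option Arrow) → Prop) (A : Finset R) (k : ℕ) :
    columnGenPoly χ A (k + 1) = ∑ v : R → Option Arrow with IsColumn A v,
      X ^ (if χ A v then 1 else 0) * columnGenPoly χ (A \ leftRows v) k := by
  rw [columnGenPoly, sum_filter,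
    ← (Fin.snocEquiv (fun _ : Fin (k + 1) => R → Option Arrow)).sum_comp,
    Fintype.sum_prod_type, sum_filter]
  refine sum_congr rfl fun v _ => ?_
  simp only [Fin.snocEquiv, Equiv.coe_fn_mk, isTableau_snoc, columnWeight_snoc, columnGenPoly,
    sum_filter, mul_sum]
  by_cases hv : IsColumn A v
  · simp only [hv, and_true, if_true]
    refine sum_congr rfl fun T _ => ?_
    rw [mul_ite, mul_zero, pow_add, mul_comm]
  · simp [hv]

open Classical in
theorem columnGenPoly_eq {χ : Finset R → (R → Option Arrow) → Prop}
    (hχ : ∀ (A : Finset R) (F : ℕ → ℤ[X]),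
      ∑ v : R → Option Arrow with IsColumn A v,
        X ^ (if χ A v then 1 else 0) * F (#A - #(leftRows v)) =
      ∑ d ∈ range (#A + 1), columnCoeff #A d * F (#A - d)) (A : Finset R) (k : ℕ) :
    columnGenPoly χ A k = symPolyBernoulli #A k := by
  induction k generalizing A with
  | zero => rw [columnGenPoly_zero, symPolyBernoulli_zero_right]
  | succ k ih =>
    rw [columnGenPoly_succ, symPolyBernoulli_succ_right, ← hχ A fun l => symPolyBernoulli l k]
    refine sum_congr rfl fun v hv => ?_
    simp only [mem_filter, mem_univ, true_and] at hv
    rw [ih, card_sdiff_of_subset]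
    intro r hr
    by_contra h
    simp [leftRows, hv.1 r h] at hr

theorem card_leftRows_downColumn (E : Finset R) : #(leftRows (downColumn E)) = #E - 1 := by
  rcases E.eq_empty_or_nonempty with rfl | hE
  · simp [leftRows, downColumn]
  · rw [leftRows_downColumn hE, card_erase_of_mem (E.max'_mem hE)]

theorem sum_powerset_nonempty (A : Finset R) (F : ℕ → ℤ[X]) :
    ∑ E ∈ A.powerset with E.Nonempty, F (#E - 1) =
      ∑ d ∈ range (#A + 1), (#A).choose (d + 1) * F d := by
  rw [sum_filter]
  have h : ∀ E ∈ A.powerset, (if E.Nonempty then F (#E - 1) else 0) =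
      (fun m => if m = 0 then 0 else F (m - 1)) #E := by
    intro E _
    rcases E.eq_empty_or_nonempty with rfl | hE
    · simp
    · simp [hE, hE.ne_empty]
  rw [sum_congr rfl h, sum_powerset_apply_card (fun m => if m = 0 then 0 else F (m - 1)),
    sum_range_succ', sum_range_succ]
  simp

theorem sum_powerset_card {R : Type*} (A : Finset R) (F : ℕ → ℤ[X]) :
    ∑ D ∈ A.powerset, F #D = ∑ d ∈ range (#A + 1), (#A).choose d * F d := by
  rw [sum_powerset_apply_card F]
  simp

/-- A column contains a left arrow but no down arrow. -/
def HasLeftNotDown (_A : Finset R) (v : R → Option Arrow) : Prop :=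
  (∃ r, v r = some Arrow.left) ∧ ¬ ∃ r, v r = some Arrow.down

/-- A column contains a left arrow in the highest row of `A`. -/
def HasTopLeft (A : Finset R) (v : R → Option Arrow) : Prop :=
  ∃ r ∈ A, (∀ a ∈ A, r ≤ a) ∧ v r = some Arrow.left

open Classical in
theorem sum_isColumn_hasLeftNotDown (A : Finset R) (F : ℕ → ℤ[X]) :
    ∑ v : R → Option Arrow with IsColumn A v,
        X ^ (if HasLeftNotDown A v then 1 else 0) * F (#A - #(leftRows v)) =
      ∑ d ∈ range (#A + 1), columnCoeff #A d * F (#A - d) := by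
  rw [sum_isColumn]
  have h1 : ∀ D ∈ A.powerset, X ^ (if HasLeftNotDown A (leftColumn D) then 1 else 0) *
          F (#A - #(leftRows (leftColumn D))) =
        (fun d => (if d = 0 then 1 else X) * F (#A - d)) #D := by
    intro D _
    have h : HasLeftNotDown A (leftColumn D) ↔ D.Nonempty := by
      simp [HasLeftNotDown, leftColumn, Finset.Nonempty]
    rw [leftRows_leftColumn]
    rcases D.eq_empty_or_nonempty with rfl | hD
    · simp [h]
    · simp [h, hD, hD.ne_empty]
  have h2 : ∀ E ∈ A.powerset.filter Finset.Nonempty,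
      X ^ (if HasLeftNotDown A (downColumn E) then 1 else 0) *
          F (#A - #(leftRows (downColumn E))) =
        (fun d => F (#A - d)) (#E - 1) := by
    intro E hE
    rw [mem_filter] at hE
    rw [card_leftRows_downColumn, if_neg fun h => h.2 (exists_down_downColumn hE.2), pow_zero,
      one_mul]
  rw [sum_congr rfl h1, sum_congr rfl h2, sum_powerset_card A
    (fun d => (if d = 0 then 1 else X) * F (#A - d)), sum_powerset_nonempty A (fun d => F (#A - d)),
    ← sum_add_distrib]
  refine sum_congr rfl fun d _ => ?_
  rw [columnCoeff]
  split_ifs with h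
  · subst h; simp; ring
  · ring

open Classical in
theorem sum_isColumn_hasTopLeft (A : Finset R) (F : ℕ → ℤ[X]) :
    ∑ v : R → Option Arrow with IsColumn A v,
        X ^ (if HasTopLeft A v then 1 else 0) * F (#A - #(leftRows v)) =
      ∑ d ∈ range (#A + 1), columnCoeff #A d * F (#A - d) := by
  rw [sum_isColumn]
  rcases A.eq_empty_or_nonempty with rfl | hA
  · simp [columnCoeff, HasTopLeft]
  set m := A.min' hA with hm
  have hmA : m ∈ A := A.min'_mem hA
  have htop : ∀ v : R → Option Arrow,
      HasTopLeft A v ↔ v m = some Arrow.left := by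
    intro v
    constructor
    · rintro ⟨r, hr, h1, h2⟩
      rwa [show m = r from le_antisymm (A.min'_le r hr) (h1 _ hmA)]
    · intro h
      exact ⟨m, hmA, fun a ha => A.min'_le a ha, h⟩
  simp only [htop, card_leftRows_downColumn, leftRows_leftColumn]
  have hB : insert m (A.erase m) = A := insert_erase hmA
  have hmB : m ∉ A.erase m := notMem_erase m A
  have hBA : #A = #(A.erase m) + 1 := by rw [card_erase_add_one hmA]
  set B := A.erase m with hBdef
  have hlt : ∀ b ∈ B, m < b := fun b hb =>
    lt_of_le_of_ne (A.min'_le b (mem_of_mem_erase hb)) (ne_of_mem_erase hb).symm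
  rw [hBA, sum_filter, ← hB, sum_powerset_insert hmB, sum_powerset_insert hmB]
  have e1 : ∀ D ∈ B.powerset, X ^ (if leftColumn D m = some Arrow.left then 1 else 0) *
      F (#B + 1 - #D) = (fun d => F (#B + 1 - d)) #D := by
    intro D hD
    have : m ∉ D := fun h => hmB (mem_powerset.1 hD h)
    simp [leftColumn, this]
  have e2 : ∀ D ∈ B.powerset, X ^ (if leftColumn (insert m D) m = some Arrow.left then 1 else 0) *
      F (#B + 1 - #(insert m D)) = (fun d => X * F (#B + 1 - (d + 1))) #D := by
    intro D hD
    have : m ∉ D := fun h => hmB (mem_powerset.1 hD h)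
    simp [leftColumn, this]
  have e3 : ∀ E ∈ B.powerset, (if E.Nonempty then
      X ^ (if downColumn E m = some Arrow.left then 1 else 0) * F (#B + 1 - (#E - 1)) else 0) =
      if E.Nonempty then (fun d => F (#B + 1 - d)) (#E - 1) else 0 := by
    intro E hE
    have : m ∉ E := fun h => hmB (mem_powerset.1 hE h)
    simp [downColumn, this]
  have e4 : ∀ E ∈ B.powerset, (if (insert m E).Nonempty then
      X ^ (if downColumn (insert m E) m = some Arrow.left then 1 else 0) *
        F (#B + 1 - (#(insert m E) - 1)) else 0) =
      (fun d => (if d = 0 then 1 else X) * F (#B + 1 - d)) #E := by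
    intro E hE
    have hmE : m ∉ E := fun h => hmB (mem_powerset.1 hE h)
    rw [if_pos (insert_nonempty m E), card_insert_of_notMem hmE, Nat.add_sub_cancel]
    rcases E.eq_empty_or_nonempty with rfl | ⟨e, he⟩
    · simp [downColumn]
    · have h1 : downColumn (insert m E) m = some Arrow.left := by
        unfold downColumn
        rw [if_pos (mem_insert_self m E), if_neg]
        intro h
        exact (h e (mem_insert_of_mem he)).not_gt (hlt e (mem_powerset.1 hE he))
      rw [if_pos h1]
      simp [ne_empty_of_mem he]
  rw [sum_congr rfl e1, sum_congr rfl e2, sum_congr rfl e3, sum_congr rfl e4, ← sum_filter,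
    sum_powerset_nonempty B (fun d => F (#B + 1 - d)), sum_powerset_card B (fun d => F (#B + 1 - d)),
    sum_powerset_card B (fun d => X * F (#B + 1 - (d + 1))),
    sum_powerset_card B (fun d => (if d = 0 then 1 else X) * F (#B + 1 - d))]
  have hA1 : ∑ d ∈ range (#B + 1 + 1), ((#B + 1).choose (d + 1) : ℤ[X]) * F (#B + 1 - d) =
      ∑ d ∈ range (#B + 1), ((#B).choose d : ℤ[X]) * F (#B + 1 - d) +
      ∑ d ∈ range (#B + 1), ((#B).choose (d + 1) : ℤ[X]) * F (#B + 1 - d) := by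
    rw [sum_range_succ, Nat.choose_succ_self, Nat.cast_zero, zero_mul, add_zero, ← sum_add_distrib]
    refine sum_congr rfl fun d _ => ?_
    rw [Nat.choose_succ_succ]; push_cast; ring
  have hA2 : ∑ d ∈ range (#B + 1 + 1), X * ((#B + 1).choose d : ℤ[X]) * F (#B + 1 - d) =
      ∑ d ∈ range (#B + 1), X * (((#B).choose d : ℤ[X]) * F (#B + 1 - d)) +
      ∑ d ∈ range (#B + 1), ((#B).choose d : ℤ[X]) * (X * F (#B + 1 - (d + 1))) := by
    rw [sum_range_succ', sum_range_succ' (fun d => X * (((#B).choose d : ℤ[X]) * F (#B + 1 - d)))]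
    have : ∑ d ∈ range (#B + 1), X * ((#B + 1).choose (d + 1) : ℤ[X]) * F (#B + 1 - (d + 1)) =
      ∑ d ∈ range (#B + 1), X * (((#B).choose (d + 1) : ℤ[X]) * F (#B + 1 - (d + 1))) +
      ∑ d ∈ range (#B + 1), ((#B).choose d : ℤ[X]) * (X * F (#B + 1 - (d + 1))) := by
      rw [← sum_add_distrib]
      refine sum_congr rfl fun d _ => ?_
      rw [Nat.choose_succ_succ]; push_cast; ring
    rw [this, sum_range_succ (fun d => X * (((#B).choose (d + 1) : ℤ[X]) * F (#B + 1 - (d + 1))))]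
    simp
    ring
  have hA3 : ∑ d ∈ range (#B + 1 + 1), (if d = 0 then 1 - X else 0 : ℤ[X]) * F (#B + 1 - d) =
      (1 - X) * F (#B + 1) := by
    rw [sum_eq_single 0] <;> simp +contextual
  have hA4 : ∑ d ∈ range (#B + 1), ((#B).choose d : ℤ[X]) *
      ((if d = 0 then 1 else X) * F (#B + 1 - d)) =
      ∑ d ∈ range (#B + 1), X * (((#B).choose d : ℤ[X]) * F (#B + 1 - d)) +
        (1 - X) * F (#B + 1) := by
    rw [sum_range_succ', sum_range_succ' (fun d => X * (((#B).choose d : ℤ[X]) * F (#B + 1 - d)))]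
    simp only [Nat.succ_ne_zero, if_false, if_true, Nat.choose_zero_right]
    have : ∀ d, ((#B).choose (d + 1) : ℤ[X]) * (X * F (#B + 1 - (d + 1))) =
      X * (((#B).choose (d + 1) : ℤ[X]) * F (#B + 1 - (d + 1))) := fun d => by ring
    simp only [this]
    simp
    ring
  simp only [columnCoeff, add_mul, sum_add_distrib, hA1, hA2, hA3, hA4]
  ring

end Columns

section AltTableau

theorem genPoly_subtype {α : Type} [Fintype α] {P : α → Prop} [DecidablePred P]
    [Fintype {x // P x}] (w : {x // P x} → ℕ) (w' : α → ℕ) (h : ∀ x, w x = w' x.1) :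
    genPoly {x // P x} w = ∑ x with P x, X ^ w' x := by
  simp only [genPoly, h]
  exact (Finset.sum_subtype (p := P) (univ.filter P) (by simp) fun x => X ^ w' x).symm

theorem isAlternative_iff {n k : ℕ} (T : Filling n k) :
    IsAlternative T ↔ IsTableau univ (fun c r => T r c) := by
  simp only [IsTableau, IsColumn, liveRows, mem_filter, mem_univ, true_and, not_forall, not_not]
  constructor
  · intro h c
    exact ⟨fun r ⟨c', hc', h'⟩ => h.1 r c' h' c hc', fun r hr r' => h.2 r c hr r'⟩
  · intro h
    exact ⟨fun r c hr c' hc' => (h c').1 r ⟨c, hc', hr⟩, fun r c hr r' => (h c).2 r hr r'⟩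

theorem genPoly_altTableau {n k : ℕ} (χ : Finset (Fin n) → (Fin n → Option Arrow) → Prop)
    (w : AltTableau n k → ℕ) (hw : ∀ T, w T = columnWeight χ univ (fun c r => T.1 r c)) :
    genPoly (AltTableau n k) w = columnGenPoly χ univ k := by
  classical
  rw [genPoly_subtype w (fun T => columnWeight χ univ (fun c r => T r c)) hw, columnGenPoly]
  refine sum_equiv (Equiv.piComm _) (fun T => ?_) (fun T _ => rfl)
  simp only [mem_filter, mem_univ, true_and]
  exact isAlternative_iff T

theorem genPoly_altTableau_wLeft (n k : ℕ) :
    genPoly (AltTableau n k) AltTableau.wLeft = symPolyBernoulli n k := by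
  rw [genPoly_altTableau HasLeftNotDown, columnGenPoly_eq sum_isColumn_hasLeftNotDown, card_univ,
    Fintype.card_fin]
  intro T
  unfold AltTableau.wLeft columnWeight
  refine congrArg card (Finset.ext fun c => ?_)
  simp only [mem_filter, mem_univ, true_and]
  exact Iff.rfl

theorem genPoly_altTableau_st (n k : ℕ) :
    genPoly (AltTableau n k) AltTableau.st = symPolyBernoulli n k := by
  rw [genPoly_altTableau HasTopLeft, columnGenPoly_eq sum_isColumn_hasTopLeft, card_univ,
    Fintype.card_fin]
  intro T
  obtain ⟨T, hT, hT'⟩ := T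
  have key : ∀ p : Fin n × Fin k, (T p.1 p.2 = some Arrow.left ∧
    (∀ r, r ≤ p.1 → ∃ c, T r c = some Arrow.left) ∧
    (∀ r, r < p.1 → ∀ c, T r c = some Arrow.left → p.2 < c)) ↔
      p.1 ∈ liveRows univ (fun c r => T r c) p.2 ∧
      (∀ a ∈ liveRows univ (fun c r => T r c) p.2, p.1 ≤ a) ∧ T p.1 p.2 = some Arrow.left := by
    rintro ⟨r, c⟩
    simp only [liveRows, mem_filter, mem_univ, true_and]
    constructor
    · rintro ⟨h1, h2, h3⟩
      refine ⟨fun c' hc' h => ?_, fun a ha => ?_, h1⟩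
      · rw [hT r c' h c hc'] at h1; simp at h1
      · by_contra h
        rw [not_le] at h
        obtain ⟨c', hc'⟩ := h2 a h.le
        exact ha c' (h3 a h c' hc') hc'
    · rintro ⟨h1, h2, h3⟩
      have h4 : ∀ r' < r, ∃ c', c < c' ∧ T r' c' = some Arrow.left := by
        intro r' hr'
        by_contra h
        push Not at h
        exact (h2 r' h).not_gt hr'
      refine ⟨h3, fun r' hr' => ?_, fun r' hr' c' hc' => ?_⟩
      · rcases hr'.lt_or_eq with hr' | rfl
        · obtain ⟨c', -, h⟩ := h4 r' hr'
          exact ⟨c', h⟩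
        · exact ⟨c, h3⟩
      · obtain ⟨c'', h5, h6⟩ := h4 r' hr'
        by_contra h
        rw [hT r' c'' h6 c' (lt_of_le_of_lt (not_lt.1 h) h5)] at hc'
        simp at hc'
  unfold AltTableau.st columnWeight
  refine card_bij (fun p _ => p.2) ?_ ?_ ?_
  · intro p hp
    rw [mem_filter, key] at hp
    simp only [mem_filter, mem_univ, true_and]
    exact ⟨p.1, hp.2⟩
  · rintro ⟨r, c⟩ hp ⟨r', c'⟩ hp' h
    rw [mem_filter, key] at hp hp'
    simp only at h
    subst h
    exact Prod.ext (le_antisymm (hp.2.2.1 _ hp'.2.1) (hp'.2.2.1 _ hp.2.1)) rfl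
  · intro c hc
    simp only [mem_filter, mem_univ, true_and] at hc
    obtain ⟨r, hr⟩ := hc
    exact ⟨(r, c), mem_filter.2 ⟨mem_univ _, (key (r, c)).2 hr⟩, rfl⟩

end AltTableau

theorem genPoly_congr {P Q : Type} [Fintype P] [Fintype Q] (e : P ≃ Q) {w : P → ℕ} {w' : Q → ℕ}
    (h : ∀ p, w p = w' (e p)) : genPoly P w = genPoly Q w' := by
  rw [genPoly, genPoly, ← e.sum_comp]
  simp only [h]

theorem eq_none_or_left_or_down (o : Option Arrow) :
    o = none ∨ o = some Arrow.left ∨ o = some Arrow.down := by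
  rcases o with _ | (_ | _) <;> simp

section Packed
variable {n k : ℕ}

open Classical in
/-- Add a leftmost column with a left arrow in every row without one, and a bottom row with a down
arrow in every column without one. -/
noncomputable def pack (T : Filling n k) : Filling (n + 1) (k + 1) :=
  Fin.snoc (α := fun _ => Fin (k + 1) → Option Arrow)
    (fun r => Fin.cons (if ∃ c, T r c = some Arrow.left then none else some Arrow.left) (T r))
    (Fin.cons none fun c => if ∃ r, T r c = some Arrow.down then none else some Arrow.down)

theorem pack_castSucc_succ (T : Filling n k) (r : Fin n) (c : Fin k) :
    pack T r.castSucc c.succ = T r c := by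
  simp [pack]

open Classical in
theorem pack_castSucc_zero (T : Filling n k) (r : Fin n) :
    pack T r.castSucc 0 = if ∃ c, T r c = some Arrow.left then none else some Arrow.left := by
  simp only [pack, Fin.snoc_castSucc, Fin.cons_zero]

open Classical in
theorem pack_last_succ (T : Filling n k) (c : Fin k) :
    pack T (Fin.last n) c.succ =
      if ∃ r, T r c = some Arrow.down then none else some Arrow.down := by
  simp only [pack, Fin.snoc_last, Fin.cons_succ]

theorem pack_last_zero (T : Filling n k) : pack T (Fin.last n) 0 = none := by
  simp [pack]

theorem pack_castSucc_zero_eq_left (T : Filling n k) (r : Fin n) :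
    pack T r.castSucc 0 = some Arrow.left ↔ ¬ ∃ c, T r c = some Arrow.left := by
  rw [pack_castSucc_zero]; split_ifs with h <;> simp [h]

theorem pack_castSucc_zero_ne_down (T : Filling n k) (r : Fin n) :
    pack T r.castSucc 0 ≠ some Arrow.down := by
  rw [pack_castSucc_zero]; split_ifs <;> simp

theorem pack_last_succ_eq_down (T : Filling n k) (c : Fin k) :
    pack T (Fin.last n) c.succ = some Arrow.down ↔ ¬ ∃ r, T r c = some Arrow.down := by
  rw [pack_last_succ]; split_ifs with h <;> simp [h]

theorem pack_last_succ_ne_left (T : Filling n k) (c : Fin k) :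
    pack T (Fin.last n) c.succ ≠ some Arrow.left := by
  rw [pack_last_succ]; split_ifs <;> simp

theorem isAlternative_pack {T : Filling n k} (hT : IsAlternative T) : IsAlternative (pack T) := by
  constructor
  · intro r c h c' hc'
    induction c using Fin.cases with
    | zero => exact absurd hc' (Fin.not_lt_zero c')
    | succ c =>
      induction r using Fin.lastCases with
      | last => exact absurd h (pack_last_succ_ne_left T c)
      | cast r =>
        rw [pack_castSucc_succ] at h
        induction c' using Fin.cases with
        | zero => rw [pack_castSucc_zero, if_pos ⟨c, h⟩]
        | succ c' =>
          rw [pack_castSucc_succ]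
          exact hT.1 r c h c' (Fin.succ_lt_succ_iff.1 hc')
  · intro r c h r' hr'
    induction r using Fin.lastCases with
    | last => exact absurd (Fin.le_last r') hr'.not_ge
    | cast r =>
      induction c using Fin.cases with
      | zero => exact absurd h (pack_castSucc_zero_ne_down T r)
      | succ c =>
        rw [pack_castSucc_succ] at h
        induction r' using Fin.lastCases with
        | last => rw [pack_last_succ, if_pos ⟨r, h⟩]
        | cast r' =>
          rw [pack_castSucc_succ]
          exact hT.2 r c h r' (Fin.castSucc_lt_castSucc_iff.1 hr')

theorem isPacked_pack {T : Filling n k} (hT : IsAlternative T) : IsPacked (pack T) := by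
  refine ⟨fun r hr => ?_, fun c hc => ?_, fun c => ?_, fun r => ?_⟩
  · induction r using Fin.lastCases with
    | last => exact absurd rfl hr
    | cast r =>
      by_cases h : ∃ c, T r c = some Arrow.left
      · obtain ⟨c, hc⟩ := h
        refine ⟨c.succ, by simp only [pack_castSucc_succ, hc], fun c' hc' => ?_⟩
        induction c' using Fin.cases with
        | zero => exact absurd ⟨c, hc⟩ ((pack_castSucc_zero_eq_left T r).1 hc')
        | succ c' =>
          simp only [pack_castSucc_succ] at hc'
          rcases lt_trichotomy c c' with h | rfl | h
          · rw [hT.1 r c' hc' c h] at hc; simp at hc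
          · rfl
          · rw [hT.1 r c hc c' h] at hc'; simp at hc'
      · refine ⟨0, (pack_castSucc_zero_eq_left T r).2 h, fun c' hc' => ?_⟩
        induction c' using Fin.cases with
        | zero => rfl
        | succ c' =>
          simp only [pack_castSucc_succ] at hc'
          exact absurd ⟨c', hc'⟩ h
  · induction c using Fin.cases with
    | zero => exact absurd rfl hc
    | succ c =>
      by_cases h : ∃ r, T r c = some Arrow.down
      · obtain ⟨r, hr⟩ := h
        refine ⟨r.castSucc, by simp only [pack_castSucc_succ, hr], fun r' hr' => ?_⟩
        induction r' using Fin.lastCases with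
        | last => exact absurd ⟨r, hr⟩ ((pack_last_succ_eq_down T c).1 hr')
        | cast r' =>
          simp only [pack_castSucc_succ] at hr'
          rcases lt_trichotomy r r' with h | rfl | h
          · rw [hT.2 r c hr r' h] at hr'; simp at hr'
          · rfl
          · rw [hT.2 r' c hr' r h] at hr; simp at hr
      · refine ⟨Fin.last n, (pack_last_succ_eq_down T c).2 h, fun r' hr' => ?_⟩
        induction r' using Fin.lastCases with
        | last => rfl
        | cast r' =>
          simp only [pack_castSucc_succ] at hr'
          exact absurd ⟨r', hr'⟩ h
  · induction c using Fin.cases with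
    | zero => simp [pack_last_zero]
    | succ c => exact pack_last_succ_ne_left T c
  · induction r using Fin.lastCases with
    | last => simp [pack_last_zero]
    | cast r => exact pack_castSucc_zero_ne_down T r

theorem pack_restrict {T : Filling (n + 1) (k + 1)} (hP : IsPacked T) :
    pack (fun r c => T r.castSucc c.succ) = T := by
  ext1 r
  ext1 c
  induction r using Fin.lastCases with
  | last =>
    induction c using Fin.cases with
    | zero =>
      rw [pack_last_zero]
      rcases eq_none_or_left_or_down (T (Fin.last n) 0) with h | h | h
      · exact h.symm
      · exact absurd h (hP.2.2.1 0)
      · exact absurd h (hP.2.2.2 _)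
    | succ c =>
      obtain ⟨r, hr, hu⟩ := hP.2.1 c.succ (Fin.succ_ne_zero c)
      rw [pack_last_succ]
      split_ifs with h
      · obtain ⟨r', hr'⟩ := h
        rcases eq_none_or_left_or_down (T (Fin.last n) c.succ) with h | h | h
        · exact h.symm
        · exact absurd h (hP.2.2.1 _)
        · exact absurd ((hu _ hr').trans (hu _ h).symm) (Fin.castSucc_ne_last r')
      · induction r using Fin.lastCases with
        | last => exact hr.symm
        | cast r => exact absurd ⟨r, hr⟩ h
  | cast r =>
    induction c using Fin.cases with
    | zero =>
      obtain ⟨c, hc, hu⟩ := hP.1 r.castSucc (Fin.castSucc_ne_last r)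
      rw [pack_castSucc_zero]
      split_ifs with h
      · obtain ⟨c', hc'⟩ := h
        rcases eq_none_or_left_or_down (T r.castSucc 0) with h | h | h
        · exact h.symm
        · exact absurd ((hu _ hc').trans (hu _ h).symm) (Fin.succ_ne_zero c')
        · exact absurd h (hP.2.2.2 _)
      · induction c using Fin.cases with
        | zero => exact hc.symm
        | succ c => exact absurd ⟨c, hc⟩ h
    | succ c => rw [pack_castSucc_succ]

/-- Alternative tableaux correspond to packed alternative tableaux. -/
noncomputable def packEquiv (n k : ℕ) : AltTableau n k ≃ PackedTableau n k where
  toFun T := ⟨pack T.1, isAlternative_pack T.2, isPacked_pack T.2⟩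
  invFun T := ⟨fun r c => T.1 r.castSucc c.succ,
    fun r c h c' hc' => T.2.1.1 _ _ h _ (Fin.succ_lt_succ_iff.2 hc'),
    fun r c h r' hr' => T.2.1.2 _ _ h _ (Fin.castSucc_lt_castSucc_iff.2 hr')⟩
  left_inv T := Subtype.ext (by ext1 r; ext1 c; exact pack_castSucc_succ _ _ _)
  right_inv T := Subtype.ext (pack_restrict T.2.2)

theorem packEquiv_wLeft (T : AltTableau n k) : T.wLeft = (packEquiv n k T).wLeft := by
  obtain ⟨T, hT⟩ := T
  change #{c : Fin k | (∃ r, T r c = some Arrow.left) ∧ ¬ ∃ r, T r c = some Arrow.down} =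
    #{c : Fin (k + 1) | (∃ r, pack T r c = some Arrow.left) ∧
      pack T (Fin.last n) c = some Arrow.down}
  rw [Fin.card_filter_univ_succ, if_neg (by simp [pack_last_zero])]
  congr 1
  ext c
  simp [Fin.exists_fin_succ', pack_castSucc_succ, pack_last_succ_eq_down, pack_last_succ_ne_left]

theorem genPoly_packedTableau_wLeft (n k : ℕ) :
    genPoly (PackedTableau n k) PackedTableau.wLeft = symPolyBernoulli n k := by
  rw [← genPoly_altTableau_wLeft, genPoly_congr (packEquiv n k) packEquiv_wLeft]

/-- Exchange left arrows and down arrows. -/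
def Arrow.flip : Arrow → Arrow
  | left => down
  | down => left

theorem map_flip_eq_left (o : Option Arrow) :
    o.map Arrow.flip = some Arrow.left ↔ o = some Arrow.down := by
  rcases o with _ | (_ | _) <;> simp [Arrow.flip]

theorem map_flip_eq_down (o : Option Arrow) :
    o.map Arrow.flip = some Arrow.down ↔ o = some Arrow.left := by
  rcases o with _ | (_ | _) <;> simp [Arrow.flip]

theorem map_flip_map_flip (o : Option Arrow) : (o.map Arrow.flip).map Arrow.flip = o := by
  rcases o with _ | (_ | _) <;> simp [Arrow.flip]

/-- The reflection of a filling in the antidiagonal. -/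
def reflect (T : Filling n k) : Filling k n := fun c r => (T r.rev c.rev).map Arrow.flip

theorem reflect_reflect (T : Filling n k) : reflect (reflect T) = T := by
  ext1 r; ext1 c
  simp only [reflect, map_flip_map_flip, Fin.rev_rev]

theorem isAlternative_reflect {T : Filling n k} (hT : IsAlternative T) :
    IsAlternative (reflect T) := by
  refine ⟨fun c r h r' hr' => ?_, fun c r h c' hc' => ?_⟩
  · rw [reflect, map_flip_eq_left] at h
    rw [reflect, hT.2 _ _ h _ (Fin.rev_lt_rev.2 hr'), Option.map_none]
  · rw [reflect, map_flip_eq_down] at h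
    rw [reflect, hT.1 _ _ h _ (Fin.rev_lt_rev.2 hc'), Option.map_none]

/-- The reflection of alternative tableaux in the antidiagonal. -/
def reflectEquiv (n k : ℕ) : AltTableau n k ≃ AltTableau k n where
  toFun T := ⟨reflect T.1, isAlternative_reflect T.2⟩
  invFun T := ⟨reflect T.1, isAlternative_reflect T.2⟩
  left_inv T := Subtype.ext (reflect_reflect T.1)
  right_inv T := Subtype.ext (reflect_reflect T.1)

theorem reflectEquiv_wLeft (T : AltTableau n k) :
    (packEquiv n k T).wDown = (reflectEquiv n k T).wLeft := by
  obtain ⟨T, hT⟩ := T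
  change #{r : Fin (n + 1) | (∃ c, pack T r c = some Arrow.down) ∧ pack T r 0 = some Arrow.left} =
    #{r : Fin n | (∃ c, reflect T c r = some Arrow.left) ∧ ¬ ∃ c, reflect T c r = some Arrow.down}
  rw [card_filter_univ_castSucc, if_neg (by
    rintro ⟨-, h⟩
    simp [pack_last_zero] at h), add_zero]
  refine card_equiv Fin.revPerm fun r => ?_
  simp only [mem_filter, mem_univ, true_and, Fin.exists_fin_succ, pack_castSucc_succ,
    pack_castSucc_zero_eq_left, pack_castSucc_zero_ne_down, false_or, reflect, Fin.revPerm_apply,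
    Fin.rev_rev, map_flip_eq_left, map_flip_eq_down]
  have h : ∀ P : Fin k → Prop, (∃ c : Fin k, P c.rev) ↔ ∃ c, P c := fun P =>
    Fin.revPerm.surjective.exists.symm
  rw [h fun c => T r c = some Arrow.down, h fun c => T r c = some Arrow.left]

theorem genPoly_packedTableau_wDown (n k : ℕ) :
    genPoly (PackedTableau n k) PackedTableau.wDown = symPolyBernoulli n k := by
  rw [symPolyBernoulli_comm, ← genPoly_altTableau_wLeft,
    ← genPoly_congr (reflectEquiv n k) reflectEquiv_wLeft]
  exact (genPoly_congr (packEquiv n k) fun _ => rfl).symm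

end Packed

section Trees
variable {n k : ℕ}

theorem label_inl (i : Fin (n + 1)) : Elt.label (Sum.inl i : Elt n k) = i := rfl

theorem label_inr (j : Fin (k + 1)) : Elt.label (Sum.inr j : Elt n k) = j := rfl

/-- The parent function of a double alternative tree: only the two zeros have no parent, each parent
has the opposite color, and each grandparent has a smaller label. -/
structure IsAltParent (par : Elt n k → Option (Elt n k)) : Prop where
  eq_none_iff : ∀ v, par v = none ↔ v = redZero n k ∨ v = blueZero n k
  color : ∀ u v, par v = some u → u.isRed ≠ v.isRed
  grandparent : ∀ u v w, par w = some v → par v = some u → u.label < w.label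

namespace IsAltParent
variable {par : Elt n k → Option (Elt n k)}

theorem exists_of_inl (h : IsAltParent par) {i : Fin (n + 1)} (hi : i ≠ 0) :
    ∃ c, par (Sum.inl i) = some (Sum.inr c) := by
  rcases hp : par (Sum.inl i) with _ | (u | u)
  · rw [h.eq_none_iff] at hp
    simp [redZero, blueZero, hi] at hp
  · exact (h.color _ _ hp rfl).elim
  · exact ⟨u, rfl⟩

theorem exists_of_inr (h : IsAltParent par) {c : Fin (k + 1)} (hc : c ≠ 0) :
    ∃ i, par (Sum.inr c) = some (Sum.inl i) := by
  rcases hp : par (Sum.inr c) with _ | (u | u)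
  · rw [h.eq_none_iff] at hp
    simp [redZero, blueZero, hc] at hp
  · exact ⟨u, rfl⟩
  · exact (h.color _ _ hp rfl).elim

theorem inl_zero (h : IsAltParent par) : par (Sum.inl 0) = none :=
  (h.eq_none_iff _).2 (Or.inl rfl)

theorem inr_zero (h : IsAltParent par) : par (Sum.inr 0) = none :=
  (h.eq_none_iff _).2 (Or.inr rfl)

end IsAltParent

/-- The tableau of a parent function: the red vertices are the rows, from bottom to top, and the
blue vertices are the columns. -/
def parentTableau (par : Elt n k → Option (Elt n k)) : Filling (n + 1) (k + 1) := fun r c =>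
  if par (Sum.inl r.rev) = some (Sum.inr c) then some Arrow.left
  else if par (Sum.inr c) = some (Sum.inl r.rev) then some Arrow.down else none

theorem parentTableau_eq_left (par : Elt n k → Option (Elt n k)) (r : Fin (n + 1))
    (c : Fin (k + 1)) :
    parentTableau par r c = some Arrow.left ↔ par (Sum.inl r.rev) = some (Sum.inr c) := by
  unfold parentTableau
  split_ifs <;> simp_all

theorem parentTableau_eq_down {par : Elt n k → Option (Elt n k)} (h : IsAltParent par)
    (r : Fin (n + 1)) (c : Fin (k + 1)) :
    parentTableau par r c = some Arrow.down ↔ par (Sum.inr c) = some (Sum.inl r.rev) := by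
  unfold parentTableau
  split_ifs with h1 h2
  · simp only [Option.some.injEq, reduceCtorEq, false_iff]
    intro h2
    exact lt_irrefl _ (h.grandparent _ _ _ h1 h2)
  · simp [h2]
  · simp [h2]

theorem isAlternative_parentTableau {par : Elt n k → Option (Elt n k)} (h : IsAltParent par) :
    IsAlternative (parentTableau par) := by
  refine ⟨fun r c hc c' hc' => ?_, fun r c hc r' hr' => ?_⟩
  · rw [parentTableau_eq_left] at hc
    rcases eq_none_or_left_or_down (parentTableau par r c') with h1 | h1 | h1
    · exact h1
    · rw [parentTableau_eq_left, hc] at h1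
      simp only [Option.some.injEq, Sum.inr.injEq] at h1
      exact absurd h1 hc'.ne'
    · rw [parentTableau_eq_down h] at h1
      exact absurd (h.grandparent _ _ _ h1 hc) (by simpa [label_inr] using hc'.le)
  · rw [parentTableau_eq_down h] at hc
    rcases eq_none_or_left_or_down (parentTableau par r' c) with h1 | h1 | h1
    · exact h1
    · rw [parentTableau_eq_left] at h1
      have := h.grandparent _ _ _ h1 hc
      rw [label_inl, label_inl, ← Fin.lt_def, Fin.rev_lt_rev] at this
      exact absurd this hr'.not_gt
    · rw [parentTableau_eq_down h, hc] at h1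
      simp only [Option.some.injEq, Sum.inl.injEq, Fin.rev_inj] at h1
      exact absurd h1 hr'.ne

theorem isPacked_parentTableau {par : Elt n k → Option (Elt n k)} (h : IsAltParent par) :
    IsPacked (parentTableau par) := by
  refine ⟨fun r hr => ?_, fun c hc => ?_, fun c => ?_, fun r => ?_⟩
  · obtain ⟨c, hc⟩ := h.exists_of_inl (i := r.rev) (by
      intro h; exact hr (by rw [← Fin.rev_rev r, h, Fin.rev_zero]))
    refine ⟨c, (parentTableau_eq_left _ _ _).2 hc, fun c' hc' => ?_⟩
    change parentTableau par r c' = _ at hc'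
    rw [parentTableau_eq_left, hc] at hc'
    simpa using hc'.symm
  · obtain ⟨i, hi⟩ := h.exists_of_inr hc
    refine ⟨i.rev, (parentTableau_eq_down h _ _).2 (by rw [Fin.rev_rev, hi]), fun r' hr' => ?_⟩
    change parentTableau par r' c = _ at hr'
    rw [parentTableau_eq_down h, hi] at hr'
    simp only [Option.some.injEq, Sum.inl.injEq] at hr'
    rw [hr', Fin.rev_rev]
  · rw [Ne, parentTableau_eq_left, Fin.rev_last, h.inl_zero]
    simp
  · rw [Ne, parentTableau_eq_down h, h.inr_zero]
    simp

open Classical in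
/-- The parent function of a packed tableau. -/
noncomputable def tableauParent (T : Filling (n + 1) (k + 1)) : Elt n k → Option (Elt n k)
  | Sum.inl i => if h : ∃ c, T i.rev c = some Arrow.left then some (Sum.inr h.choose) else none
  | Sum.inr c => if h : ∃ r, T r c = some Arrow.down then some (Sum.inl h.choose.rev) else none

theorem tableauParent_inl {T : Filling (n + 1) (k + 1)} (hP : IsPacked T) (i : Fin (n + 1))
    (u : Elt n k) :
    tableauParent T (Sum.inl i) = some u ↔ ∃ c, u = Sum.inr c ∧ T i.rev c = some Arrow.left := by
  unfold tableauParent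
  simp only
  split_ifs with h
  · rw [Option.some.injEq]
    constructor
    · rintro rfl
      exact ⟨_, rfl, h.choose_spec⟩
    · rintro ⟨c, rfl, hc⟩
      have hr : i.rev ≠ Fin.last n := by
        intro h'
        rw [h'] at hc
        exact hP.2.2.1 _ hc
      rw [(hP.1 _ hr).unique hc h.choose_spec]
  · simp only [false_iff]
    rintro ⟨c, rfl, hc⟩
    exact h ⟨c, hc⟩

theorem tableauParent_inr {T : Filling (n + 1) (k + 1)} (hP : IsPacked T) (c : Fin (k + 1))
    (u : Elt n k) :
    tableauParent T (Sum.inr c) = some u ↔ ∃ i, u = Sum.inl i ∧ T i.rev c = some Arrow.down := by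
  unfold tableauParent
  simp only
  split_ifs with h
  · rw [Option.some.injEq]
    constructor
    · rintro rfl
      exact ⟨_, rfl, by rw [Fin.rev_rev]; exact h.choose_spec⟩
    · rintro ⟨i, rfl, hi⟩
      have hc : c ≠ 0 := by
        rintro rfl
        exact hP.2.2.2 _ hi
      rw [← (hP.2.1 _ hc).unique hi h.choose_spec, Fin.rev_rev]
  · simp only [false_iff]
    rintro ⟨i, rfl, hi⟩
    exact h ⟨_, hi⟩

theorem isAltParent_tableauParent {T : Filling (n + 1) (k + 1)} (hT : IsAlternative T)
    (hP : IsPacked T) : IsAltParent (tableauParent T : Elt n k → Option (Elt n k)) where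
  eq_none_iff := by
    have h : ∀ o : Option (Elt n k), o = none ↔ ¬ ∃ u, o = some u := by
      intro o; cases o <;> simp
    rintro (i | c)
    · rw [h]
      simp only [tableauParent_inl hP, redZero, blueZero, Sum.inl.injEq, reduceCtorEq, or_false]
      constructor
      · intro h
        by_contra hi
        obtain ⟨c, hc, -⟩ := hP.1 i.rev (by
          intro h; exact hi (by rw [← Fin.rev_rev i, h, Fin.rev_last]))
        exact h ⟨_, c, rfl, hc⟩
      · rintro rfl ⟨_, c, rfl, hc⟩
        rw [Fin.rev_zero] at hc
        exact hP.2.2.1 c hc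
    · rw [h]
      simp only [tableauParent_inr hP, redZero, blueZero, Sum.inr.injEq, reduceCtorEq, false_or]
      constructor
      · intro h
        by_contra hc
        obtain ⟨r, hr, -⟩ := hP.2.1 c hc
        exact h ⟨_, r.rev, rfl, by rw [Fin.rev_rev]; exact hr⟩
      · rintro rfl ⟨_, i, rfl, hi⟩
        exact hP.2.2.2 _ hi
  color := by
    rintro u (i | c) h
    · obtain ⟨c, rfl, -⟩ := (tableauParent_inl hP _ _).1 h
      simp [Elt.isRed]
    · obtain ⟨i, rfl, -⟩ := (tableauParent_inr hP _ _).1 h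
      simp [Elt.isRed]
  grandparent := by
    rintro u v (i | c) h1 h2
    · obtain ⟨c, rfl, hc⟩ := (tableauParent_inl hP _ _).1 h1
      obtain ⟨j, rfl, hj⟩ := (tableauParent_inr hP _ _).1 h2
      rw [label_inl, label_inl, ← Fin.lt_def]
      rcases lt_trichotomy j i with h | rfl | h
      · exact h
      · rw [hc] at hj; simp at hj
      · rw [hT.2 _ _ hj i.rev (Fin.rev_lt_rev.2 h)] at hc
        simp at hc
    · obtain ⟨i, rfl, hi⟩ := (tableauParent_inr hP _ _).1 h1
      obtain ⟨d, rfl, hd⟩ := (tableauParent_inl hP _ _).1 h2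
      rw [label_inr, label_inr, ← Fin.lt_def]
      rcases lt_trichotomy d c with h | rfl | h
      · exact h
      · rw [hd] at hi; simp at hi
      · rw [hT.1 _ _ hd c h] at hi; simp at hi

theorem parentTableau_tableauParent {T : Filling (n + 1) (k + 1)} (hT : IsAlternative T)
    (hP : IsPacked T) : parentTableau (tableauParent T : Elt n k → Option (Elt n k)) = T := by
  ext1 r
  ext1 c
  have h := isAltParent_tableauParent hT hP
  have h1 : parentTableau (tableauParent T : Elt n k → Option (Elt n k)) r c = some Arrow.left ↔
      T r c = some Arrow.left := by
    rw [parentTableau_eq_left, tableauParent_inl hP]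
    simp
  have h2 : parentTableau (tableauParent T : Elt n k → Option (Elt n k)) r c = some Arrow.down ↔
      T r c = some Arrow.down := by
    rw [parentTableau_eq_down h, tableauParent_inr hP]
    simp
  rcases eq_none_or_left_or_down (T r c) with h3 | h3 | h3
  · rcases eq_none_or_left_or_down
      (parentTableau (tableauParent T : Elt n k → Option (Elt n k)) r c) with h4 | h4 | h4
    · rw [h3, h4]
    · rw [h1.1 h4] at h3; simp at h3
    · rw [h2.1 h4] at h3; simp at h3
  · rw [h3, h1.2 h3]
  · rw [h3, h2.2 h3]

theorem parentTableau_injective {p q : Elt n k → Option (Elt n k)} (hp : IsAltParent p)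
    (hq : IsAltParent q) (h : parentTableau p = parentTableau q) : p = q := by
  funext v
  rcases v with i | c
  · rcases eq_or_ne i 0 with rfl | hi
    · rw [hp.inl_zero, hq.inl_zero]
    · obtain ⟨c, hc⟩ := hp.exists_of_inl hi
      have := parentTableau_eq_left p i.rev c
      rw [Fin.rev_rev, h, parentTableau_eq_left, Fin.rev_rev] at this
      rw [hc, this.2 hc]
  · rcases eq_or_ne c 0 with rfl | hc
    · rw [hp.inr_zero, hq.inr_zero]
    · obtain ⟨i, hi⟩ := hp.exists_of_inr hc
      have := parentTableau_eq_down hp i.rev c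
      rw [Fin.rev_rev, h, parentTableau_eq_down hq, Fin.rev_rev] at this
      rw [hi, this.2 hi]

/-- Parent functions correspond to packed alternative tableaux. -/
noncomputable def parentEquiv (n k : ℕ) :
    {par : Elt n k → Option (Elt n k) // IsAltParent par} ≃ PackedTableau n k where
  toFun p := ⟨parentTableau p.1, isAlternative_parentTableau p.2, isPacked_parentTableau p.2⟩
  invFun T := ⟨tableauParent T.1, isAltParent_tableauParent T.2.1 T.2.2⟩
  left_inv p := Subtype.ext (parentTableau_injective
    (isAltParent_tableauParent (isAlternative_parentTableau p.2) (isPacked_parentTableau p.2)) p.2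
    (parentTableau_tableauParent (isAlternative_parentTableau p.2) (isPacked_parentTableau p.2)))
  right_inv T := Subtype.ext (parentTableau_tableauParent T.2.1 T.2.2)

/-- `v` is reached from `u` by passing to children. -/
def Reach (par : Elt n k → Option (Elt n k)) (u v : Elt n k) : Prop :=
  Relation.ReflTransGen (fun a b => par b = some a) u v

namespace IsAltParent
variable {par : Elt n k → Option (Elt n k)}

theorem reach_root (h : IsAltParent par) (v : Elt n k) :
    Reach par (redZero n k) v ∨ Reach par (blueZero n k) v := by
  induction hl : v.label using Nat.strong_induction_on generalizing v with
  | _ l ih =>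
    rcases hu : par v with _ | u
    · rcases (h.eq_none_iff v).1 hu with rfl | rfl
      · exact Or.inl Relation.ReflTransGen.refl
      · exact Or.inr Relation.ReflTransGen.refl
    · rcases hw : par u with _ | w
      · rcases (h.eq_none_iff u).1 hw with rfl | rfl
        · exact Or.inl (Relation.ReflTransGen.single hu)
        · exact Or.inr (Relation.ReflTransGen.single hu)
      · have := ih w.label (hl ▸ h.grandparent _ _ _ hu hw) w rfl
        exact this.imp (fun h => (h.tail hw).tail hu) (fun h => (h.tail hw).tail hu)

theorem not_reach_both (h : IsAltParent par) (v : Elt n k)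
    (h1 : Reach par (redZero n k) v) (h2 : Reach par (blueZero n k) v) : False := by
  have hU : Relator.RightUnique (fun a b : Elt n k => par a = some b) := by
    intro a b c hb hc
    rw [hb] at hc
    exact Option.some.inj hc
  have key : ∀ a b : Elt n k, par a = none →
      Relation.ReflTransGen (fun a b : Elt n k => par a = some b) a b → a = b := by
    intro a b ha hab
    rcases hab.cases_head with hab | ⟨c, hc, -⟩
    · exact hab
    · rw [ha] at hc; simp at hc
  have h1' := Relation.ReflTransGen.swap _ _ h1
  have h2' := Relation.ReflTransGen.swap _ _ h2
  rcases h1'.total_of_right_unique hU h2' with h3 | h3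
  · have := key _ _ h.inl_zero h3
    simp [blueZero] at this
  · have := key _ _ h.inr_zero h3
    simp [redZero] at this

theorem descendant (h : IsAltParent par) {u v : Elt n k}
    (huv : Relation.TransGen (fun a b => par b = some a) u v) :
    u.isRed ≠ v.isRed ∨ u.label < v.label := by
  have key : (u.isRed = v.isRed → u.label < v.label) ∧ (u.isRed ≠ v.isRed →
      ∃ p, par v = some p ∧ p.isRed = u.isRed ∧ u.label ≤ p.label) := by
    induction huv with
    | single h1 =>
      exact ⟨fun h2 => absurd h2 (h.color _ _ h1), fun _ => ⟨u, h1, rfl, le_rfl⟩⟩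
    | @tail v w _ h1 ih =>
      have hc := h.color _ _ h1
      constructor
      · intro h2
        obtain ⟨p, hp, -, hle⟩ := ih.2 (by rw [h2]; exact hc.symm)
        exact lt_of_le_of_lt hle (h.grandparent _ _ _ h1 hp)
      · intro h2
        have h3 : u.isRed = v.isRed := by
          revert hc h2
          cases u.isRed <;> cases v.isRed <;> cases w.isRed <;> simp
        exact ⟨v, h1, h3.symm, (ih.1 h3).le⟩
  by_cases h2 : u.isRed = v.isRed
  · exact Or.inr (key.1 h2)
  · exact Or.inl h2

open Classical in
/-- The tree formed by the vertices that are reached from a vertex without parent. -/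
noncomputable def tree (par : Elt n k → Option (Elt n k)) (r : Elt n k) (hr : par r = none)
    (h : ∀ v, par v = none → Reach par r v → v = r) : LabeledRootedTree (Elt n k) where
  verts := {v | Reach par r v}
  root := r
  parent v := if Reach par r v then par v else none
  root_mem := mem_filter.2 ⟨mem_univ _, Relation.ReflTransGen.refl⟩
  parent_eq_none_iff v := by
    simp only [mem_filter, mem_univ, true_and]
    split_ifs with h1
    · simp only [h1, not_true, false_or]
      exact ⟨fun h2 => h v h2 h1, fun h2 => h2 ▸ hr⟩
    · simp [h1]
  parent_mem u v huv := by
    simp only [mem_filter, mem_univ, true_and]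
    split_ifs at huv with h1
    rcases h1.cases_tail with h2 | ⟨w, h2, h3⟩
    · rw [h2, hr] at huv; simp at huv
    · rw [h3] at huv
      rwa [← Option.some.inj huv]
  connected v hv := by
    simp only [mem_filter, mem_univ, true_and] at hv
    induction hv with
    | refl => exact Relation.ReflTransGen.refl
    | tail h1 h2 ih => exact ih.tail (by rw [if_pos (show Reach par r _ from h1.tail h2)]; exact h2)

theorem isChild_tree {r : Elt n k} {hr : par r = none}
    {h : ∀ v, par v = none → Reach par r v → v = r} {u v : Elt n k}
    (huv : (tree par r hr h).IsChild u v) : par v = some u := by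
  unfold LabeledRootedTree.IsChild tree at huv
  simp only at huv
  split_ifs at huv
  exact huv

theorem isAlternatingTree_tree (hp : IsAltParent par) (r : Elt n k) (hr : par r = none)
    (h : ∀ v, par v = none → Reach par r v → v = r) : IsAlternatingTree (tree par r hr h) :=
  ⟨fun _ _ huv => hp.color _ _ (isChild_tree huv), fun _ _ huv =>
    hp.descendant (Relation.TransGen.mono (fun _ _ h => isChild_tree h) _ _ huv)⟩

theorem eq_redZero (hp : IsAltParent par) (v : Elt n k) (hv : par v = none)
    (h : Reach par (redZero n k) v) : v = redZero n k := by
  rcases (hp.eq_none_iff v).1 hv with rfl | rfl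
  · rfl
  · exact (hp.not_reach_both _ h Relation.ReflTransGen.refl).elim

theorem eq_blueZero (hp : IsAltParent par) (v : Elt n k) (hv : par v = none)
    (h : Reach par (blueZero n k) v) : v = blueZero n k := by
  rcases (hp.eq_none_iff v).1 hv with rfl | rfl
  · exact (hp.not_reach_both _ Relation.ReflTransGen.refl h).elim
  · rfl

/-- The double alternative tree with a given parent function. -/
noncomputable def doubleAltTree (hp : IsAltParent par) : DoubleAltTree n k where
  T₁ := tree par (redZero n k) hp.inl_zero hp.eq_redZero
  T₂ := tree par (blueZero n k) hp.inr_zero hp.eq_blueZero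
  disjoint := by
    rw [Finset.disjoint_left]
    intro v h1 h2
    simp only [tree, mem_filter, mem_univ, true_and] at h1 h2
    exact hp.not_reach_both v h1 h2
  union := by
    ext v
    simp only [tree, mem_union, mem_filter, mem_univ, true_and, iff_true]
    exact hp.reach_root v
  root₁ := rfl
  root₂ := rfl
  alt₁ := isAlternatingTree_tree hp _ _ _
  alt₂ := isAlternatingTree_tree hp _ _ _

end IsAltParent

namespace DoubleAltTree

/-- The parent function of a double alternative tree. -/
def par (D : DoubleAltTree n k) (v : Elt n k) : Option (Elt n k) :=
  (D.T₁.parent v).or (D.T₂.parent v)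

theorem mem_or (D : DoubleAltTree n k) (v : Elt n k) : v ∈ D.T₁.verts ∨ v ∈ D.T₂.verts := by
  rw [← mem_union, D.union]; exact mem_univ v

theorem par_of_mem₁ (D : DoubleAltTree n k) {v : Elt n k} (h : v ∈ D.T₁.verts) :
    D.par v = D.T₁.parent v := by
  rw [par, (D.T₂.parent_eq_none_iff v).2 (Or.inl (Finset.disjoint_left.1 D.disjoint h)),
    Option.or_none]

theorem par_of_mem₂ (D : DoubleAltTree n k) {v : Elt n k} (h : v ∈ D.T₂.verts) :
    D.par v = D.T₂.parent v := by
  rw [par, (D.T₁.parent_eq_none_iff v).2 (Or.inl (Finset.disjoint_right.1 D.disjoint h)),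
    Option.none_or]

theorem mem₁_of_parent (D : DoubleAltTree n k) {u v : Elt n k} (h : D.T₁.parent v = some u) :
    v ∈ D.T₁.verts := by
  by_contra h'
  rw [(D.T₁.parent_eq_none_iff v).2 (Or.inl h')] at h
  simp at h

theorem mem₂_of_parent (D : DoubleAltTree n k) {u v : Elt n k} (h : D.T₂.parent v = some u) :
    v ∈ D.T₂.verts := by
  by_contra h'
  rw [(D.T₂.parent_eq_none_iff v).2 (Or.inl h')] at h
  simp at h

theorem par_eq_some (D : DoubleAltTree n k) {u v : Elt n k} :
    D.par v = some u ↔ D.T₁.parent v = some u ∨ D.T₂.parent v = some u := by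
  constructor
  · intro h
    rcases D.mem_or v with hv | hv
    · rw [D.par_of_mem₁ hv] at h; exact Or.inl h
    · rw [D.par_of_mem₂ hv] at h; exact Or.inr h
  · rintro (h | h)
    · rwa [D.par_of_mem₁ (D.mem₁_of_parent h)]
    · rwa [D.par_of_mem₂ (D.mem₂_of_parent h)]

theorem isAltParent_par (D : DoubleAltTree n k) : IsAltParent D.par where
  eq_none_iff v := by
    have h1 : redZero n k ∈ D.T₁.verts := D.root₁ ▸ D.T₁.root_mem
    have h2 : blueZero n k ∈ D.T₂.verts := D.root₂ ▸ D.T₂.root_mem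
    rcases D.mem_or v with hv | hv
    · rw [D.par_of_mem₁ hv, D.T₁.parent_eq_none_iff, D.root₁]
      have : v ≠ blueZero n k := by
        rintro rfl
        exact Finset.disjoint_left.1 D.disjoint hv h2
      tauto
    · rw [D.par_of_mem₂ hv, D.T₂.parent_eq_none_iff, D.root₂]
      have : v ≠ redZero n k := by
        rintro rfl
        exact Finset.disjoint_left.1 D.disjoint h1 hv
      tauto
  color u v h := by
    rcases D.par_eq_some.1 h with h | h
    · exact D.alt₁.1 u v h
    · exact D.alt₂.1 u v h
  grandparent u v w h1 h2 := by
    have aux : ∀ T : LabeledRootedTree (Elt n k), IsAlternatingTree T → T.parent w = some v →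
        T.parent v = some u → u.label < w.label := by
      intro T hT h1 h2
      have h3 := hT.1 _ _ h1
      have h4 := hT.1 _ _ h2
      refine (hT.2 u w (Relation.TransGen.head (b := v) h2 (Relation.TransGen.single h1))).resolve_left ?_
      rw [not_not]
      revert h3 h4
      cases u.isRed <;> cases v.isRed <;> cases w.isRed <;> simp
    rcases D.par_eq_some.1 h1 with h3 | h3
    · rw [D.par_of_mem₁ (D.T₁.parent_mem _ _ h3)] at h2
      exact aux _ D.alt₁ h3 h2
    · rw [D.par_of_mem₂ (D.T₂.parent_mem _ _ h3)] at h2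
      exact aux _ D.alt₂ h3 h2

theorem reach_redZero (D : DoubleAltTree n k) (v : Elt n k) :
    Reach D.par (redZero n k) v ↔ v ∈ D.T₁.verts := by
  constructor
  · intro h
    induction h with
    | refl => exact D.root₁ ▸ D.T₁.root_mem
    | tail _ h ih =>
      rcases D.par_eq_some.1 h with h | h
      · exact D.mem₁_of_parent h
      · exact absurd (D.T₂.parent_mem _ _ h) (Finset.disjoint_left.1 D.disjoint ih)
  · intro h
    have := D.T₁.connected v h
    rw [D.root₁] at this
    exact Relation.ReflTransGen.mono (fun _ _ h => D.par_eq_some.2 (Or.inl h)) _ _ this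

theorem reach_blueZero (D : DoubleAltTree n k) (v : Elt n k) :
    Reach D.par (blueZero n k) v ↔ v ∈ D.T₂.verts := by
  constructor
  · intro h
    induction h with
    | refl => exact D.root₂ ▸ D.T₂.root_mem
    | tail _ h ih =>
      rcases D.par_eq_some.1 h with h | h
      · exact absurd ih (Finset.disjoint_left.1 D.disjoint (D.T₁.parent_mem _ _ h))
      · exact D.mem₂_of_parent h
  · intro h
    have := D.T₂.connected v h
    rw [D.root₂] at this
    exact Relation.ReflTransGen.mono (fun _ _ h => D.par_eq_some.2 (Or.inr h)) _ _ this

theorem doubleAltTree_par (D : DoubleAltTree n k) : D.isAltParent_par.doubleAltTree = D := by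
  refine DoubleAltTree.ext (LabeledRootedTree.ext ?_ D.root₁.symm ?_)
    (LabeledRootedTree.ext ?_ D.root₂.symm ?_)
  · ext v
    simp [IsAltParent.doubleAltTree, IsAltParent.tree, reach_redZero]
  · funext v
    simp only [IsAltParent.doubleAltTree, IsAltParent.tree, reach_redZero]
    split_ifs with h
    · exact D.par_of_mem₁ h
    · exact ((D.T₁.parent_eq_none_iff v).2 (Or.inl h)).symm
  · ext v
    simp [IsAltParent.doubleAltTree, IsAltParent.tree, reach_blueZero]
  · funext v
    simp only [IsAltParent.doubleAltTree, IsAltParent.tree, reach_blueZero]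
    split_ifs with h
    · exact D.par_of_mem₂ h
    · exact ((D.T₂.parent_eq_none_iff v).2 (Or.inl h)).symm

end DoubleAltTree

theorem IsAltParent.par_doubleAltTree {par : Elt n k → Option (Elt n k)} (hp : IsAltParent par) :
    hp.doubleAltTree.par = par := by
  funext v
  simp only [DoubleAltTree.par, doubleAltTree, tree]
  rcases hp.reach_root v with h | h
  · rw [if_pos h, if_neg fun h' => hp.not_reach_both v h h', Option.or_none]
  · rw [if_neg fun h' => hp.not_reach_both v h' h, if_pos h, Option.none_or]

/-- Double alternative trees correspond to parent functions. -/
noncomputable def doubleAltTreeEquiv (n k : ℕ) :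
    DoubleAltTree n k ≃ {par : Elt n k → Option (Elt n k) // IsAltParent par} where
  toFun D := ⟨D.par, D.isAltParent_par⟩
  invFun p := p.2.doubleAltTree
  left_inv D := D.doubleAltTree_par
  right_inv p := Subtype.ext p.2.par_doubleAltTree

theorem parentEquiv_wLeft (D : DoubleAltTree n k) :
    D.ch = (parentEquiv n k (doubleAltTreeEquiv n k D)).wLeft := by
  have hp := D.isAltParent_par
  have h1 : {v : Elt n k | D.T₁.IsChild (redZero n k) v ∧ ∃ u, D.T₁.IsChild v u} =
      Sum.inr '' {c : Fin (k + 1) | (∃ r, parentTableau D.par r c = some Arrow.left) ∧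
        parentTableau D.par (Fin.last n) c = some Arrow.down} := by
    ext v
    simp only [Set.mem_ofPred_eq, Set.mem_image, parentTableau_eq_left, parentTableau_eq_down hp,
      LabeledRootedTree.IsChild, Fin.rev_last]
    have h0 : redZero n k ∈ D.T₁.verts := D.root₁ ▸ D.T₁.root_mem
    constructor
    · rintro ⟨h2, u, h3⟩
      have h2' := D.par_eq_some.2 (Or.inl h2)
      have h3' := D.par_eq_some.2 (Or.inl h3)
      rcases v with i | c
      · exact (hp.color _ _ h2' rfl).elim
      rcases u with i | d
      · exact ⟨c, ⟨⟨i.rev, by rw [Fin.rev_rev]; exact h3'⟩, h2'⟩, rfl⟩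
      · exact (hp.color _ _ h3' rfl).elim
    · rintro ⟨c, ⟨⟨r, hr⟩, hc⟩, rfl⟩
      have h2 : D.T₁.parent (Sum.inr c) = some (redZero n k) :=
        (D.par_eq_some.1 hc).resolve_right fun h => Finset.disjoint_left.1 D.disjoint h0
          (D.T₂.parent_mem _ _ h)
      refine ⟨h2, Sum.inl r.rev, (D.par_eq_some.1 hr).resolve_right fun h =>
        Finset.disjoint_left.1 D.disjoint (D.mem₁_of_parent h2) (D.T₂.parent_mem _ _ h)⟩
  rw [DoubleAltTree.ch, h1, Set.ncard_image_of_injective _ Sum.inr_injective,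
    PackedTableau.wLeft, ← Set.ncard_coe_finset]
  congr 1
  ext c
  rw [Finset.mem_coe, mem_filter]
  simp only [mem_univ, true_and]
  exact Iff.rfl

theorem genPoly_doubleAltTree (n k : ℕ) :
    genPoly (DoubleAltTree n k) DoubleAltTree.ch = symPolyBernoulli n k := by
  rw [← genPoly_packedTableau_wLeft]
  exact genPoly_congr ((doubleAltTreeEquiv n k).trans (parentEquiv n k)) parentEquiv_wLeft

end Trees

theorem sum_piFinset_snoc {M : Type*} [AddCommMonoid M] {a : ℕ} (s : ℕ → Finset ℕ)
    (f : (Fin (a + 1) → ℕ) → M) :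
    ∑ g ∈ Fintype.piFinset (fun b : Fin (a + 1) => s b), f g =
      ∑ v ∈ s a, ∑ g ∈ Fintype.piFinset (fun b : Fin a => s b),
        f (Fin.snoc g v : Fin (a + 1) → ℕ) := by
  rw [← sum_product']
  refine (sum_nbij' (fun x => (Fin.snoc x.2 x.1 : Fin (a + 1) → ℕ))
    (fun g => (g (Fin.last a), Fin.init g)) ?_ ?_ ?_ ?_ ?_).symm
  · rintro ⟨v, g⟩ h
    simp only [mem_product, Fintype.mem_piFinset] at h ⊢
    intro b
    induction b using Fin.lastCases with
    | last => simpa using h.1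
    | cast b => simpa using h.2 b
  · intro g h
    simp only [mem_product, Fintype.mem_piFinset] at h ⊢
    exact ⟨by simpa using h (Fin.last a), fun b => by simpa [Fin.init] using h b.castSucc⟩
  · rintro ⟨v, g⟩ _
    simp
  · intro g _
    simp
  · intro x _
    rfl

theorem snoc_injective_iff {α : Type*} [DecidableEq α] {a : ℕ} (g : Fin a → α) (v : α) :
    Function.Injective (Fin.snoc g v : Fin (a + 1) → α) ↔ v ∉ univ.image g ∧ Function.Injective g := by
  rw [Fin.snoc_injective_iff]
  simp [and_comm]

section RedPositions

open Classical in
/-- The number of injective choices of values `h i > i` from `Z` for the positions `i < m`. -/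
theorem card_injective_gt (m : ℕ) (Z : Finset ℕ) :
    #{h ∈ Fintype.piFinset (fun i : Fin m => {z ∈ Z | (i : ℕ) < z}) | h.Injective} =
      ∏ i ∈ range m, (#{z ∈ Z | i < z} - (m - 1 - i)) := by
  induction m generalizing Z with
  | zero => simp [Function.injective_of_subsingleton]
  | succ m ih =>
    rw [card_filter, sum_piFinset_snoc (fun i => {z ∈ Z | i < z})]
    have h : ∀ v ∈ {z ∈ Z | m < z}, (∑ g ∈ Fintype.piFinset fun b : Fin m => {z ∈ Z | (b : ℕ) < z},
        if Function.Injective (Fin.snoc g v : Fin (m + 1) → ℕ) then 1 else 0) =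
        ∏ i ∈ range m, (#{z ∈ Z | i < z} - (m + 1 - 1 - i)) := by
      intro v hv
      rw [mem_filter] at hv
      have e : ∏ i ∈ range m, (#{z ∈ Z | i < z} - (m + 1 - 1 - i)) =
          ∏ i ∈ range m, (#{z ∈ Z.erase v | i < z} - (m - 1 - i)) := by
        refine prod_congr rfl fun i hi => ?_
        rw [mem_range] at hi
        rw [filter_erase, card_erase_of_mem (mem_filter.2 ⟨hv.1, by omega⟩)]
        omega
      rw [e, ← ih, ← card_filter]
      congr 1
      ext g
      simp only [mem_filter, Fintype.mem_piFinset, snoc_injective_iff, mem_image, mem_univ,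
        true_and, not_exists, mem_erase]
      constructor
      · rintro ⟨h1, h2, h3⟩
        exact ⟨fun i => ⟨⟨h2 i, (h1 i).1⟩, (h1 i).2⟩, h3⟩
      · rintro ⟨h1, h2⟩
        exact ⟨fun i => ⟨(h1 i).1.2, (h1 i).2⟩, fun i => (h1 i).1.1, h2⟩
    rw [sum_congr rfl h, sum_const, smul_eq_mul, prod_range_succ, mul_comm]
    congr 1
    omega

/-- The number of ways to choose values `> i` for the positions `i < n`, if the values `v < n` in
`R` are forbidden, and must be replaced by large values. -/
def redCount (n t : ℕ) (R : Finset ℕ) : ℕ :=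
  ∏ i ∈ range n, (#{v ∈ range n \ R | i < v} + t - (n - 1 - i))

theorem redCount_succ_of_subset {n t : ℕ} {R : Finset ℕ} (h : R ⊆ range n) :
    redCount (n + 1) t R = t * redCount n t R := by
  have hn : n ∉ R := fun h' => by simpa using h h'
  have h1 : range (n + 1) \ R = insert n (range n \ R) := by
    rw [range_add_one, insert_sdiff_of_notMem _ hn]
  rw [redCount, prod_range_succ, mul_comm, h1]
  congr 1
  · rw [filter_eq_empty_iff.2]
    · simp
    · intro v hv
      simp only [mem_insert, mem_sdiff, mem_range] at hv
      omega
  · refine prod_congr rfl fun i hi => ?_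
    rw [mem_range] at hi
    rw [filter_insert, if_pos hi, card_insert_of_notMem (by simp)]
    omega

theorem redCount_succ_insert {n t : ℕ} {R : Finset ℕ} :
    redCount (n + 1) (t + 1) (insert n R) = (t + 1) * redCount n t R := by
  have h1 : range (n + 1) \ insert n R = range n \ R := by
    ext v
    simp only [mem_sdiff, mem_range, mem_insert, not_or, ← and_assoc]
    exact and_congr_left fun _ => by omega
  rw [redCount, prod_range_succ, mul_comm, h1]
  congr 1
  · rw [filter_eq_empty_iff.2]
    · simp
    · intro v hv
      simp only [mem_sdiff, mem_range] at hv
      omega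
  · refine prod_congr rfl fun i hi => ?_
    rw [mem_range] at hi
    omega

theorem sum_redCount (n t : ℕ) :
    ∑ R ∈ powersetCard t (range n), redCount n t R = t.factorial * Nat.stirlingSecond n t := by
  induction n generalizing t with
  | zero => cases t <;> simp [redCount]
  | succ n ih =>
    cases t with
    | zero => simp [redCount_succ_of_subset]
    | succ t =>
      rw [range_add_one, powersetCard_succ_insert (by simp), sum_union, sum_image]
      · rw [sum_congr rfl fun R hR => redCount_succ_of_subset (mem_powersetCard.1 hR).1,
          sum_congr rfl fun R _ => redCount_succ_insert, ← mul_sum, ← mul_sum, ih, ih,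
          Nat.stirlingSecond_succ_succ, Nat.factorial_succ]
        ring
      · intro R hR R' hR' h
        have h1 : ∀ R ∈ powersetCard t (range n), n ∉ R := fun R hR h' => by
          simpa using (mem_powersetCard.1 hR).1 h'
        rw [← erase_insert (h1 R hR), ← erase_insert (h1 R' hR')]
        exact congrArg (fun s => erase s n) h
      · rw [Finset.disjoint_left]
        intro R hR hR'
        obtain ⟨R', -, rfl⟩ := mem_image.1 hR'
        simpa using (mem_powersetCard.1 hR).1 (mem_insert_self n R')

end RedPositions

section BluePositions

/-- The values `< n` of a word. -/
def smallValues (n : ℕ) {a : ℕ} (g : Fin a → ℕ) : Finset ℕ := {v ∈ univ.image g | v < n}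

open Classical in
/-- The injective words of length `a` whose letter at position `b` is at most `n + b`. -/
noncomputable def blueWords (n a : ℕ) : Finset (Fin a → ℕ) :=
  {g ∈ Fintype.piFinset (fun b : Fin a => range (n + b + 1)) | g.Injective}

theorem mem_blueWords {n a : ℕ} {g : Fin a → ℕ} :
    g ∈ blueWords n a ↔ (∀ b, g b ≤ n + b) ∧ g.Injective := by
  simp [blueWords]

theorem card_Ico_sdiff_image {n a : ℕ} {g : Fin a → ℕ} (hg : g ∈ blueWords n a) :
    #(Ico n (n + a) \ univ.image g) = #(smallValues n g) := by
  rw [mem_blueWords] at hg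
  have h1 : #(univ.image g) = a := by rw [card_image_of_injective _ hg.2, card_univ, Fintype.card_fin]
  have h2 := card_filter_add_card_filter_not (s := univ.image g) (fun v => v < n)
  have h3 : {v ∈ univ.image g | ¬ v < n} = Ico n (n + a) ∩ univ.image g := by
    ext v
    simp only [mem_filter, mem_inter, mem_image, mem_univ, true_and, mem_Ico, not_lt]
    constructor
    · rintro ⟨⟨b, rfl⟩, h⟩
      have := hg.1 b
      exact ⟨⟨h, by omega⟩, b, rfl⟩
    · rintro ⟨⟨h, -⟩, h'⟩
      exact ⟨h', h⟩
  have h4 := card_sdiff_add_card_inter (Ico n (n + a)) (univ.image g)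
  rw [Nat.card_Ico] at h4
  rw [h3] at h2
  unfold smallValues
  omega

/-- The generating polynomial of the words whose set of small values is `R`. -/
noncomputable def blueGenPoly (n : ℕ) (R : Finset ℕ) (a : ℕ) : ℤ[X] :=
  ∑ g ∈ blueWords n a with smallValues n g = R, X ^ recordCount id g

theorem smallValues_snoc_of_lt {n a : ℕ} (g : Fin a → ℕ) {v : ℕ} (hv : v < n) :
    smallValues n (Fin.snoc g v : Fin (a + 1) → ℕ) = insert v (smallValues n g) := by
  rw [smallValues, image_snoc, filter_insert, if_pos hv, smallValues]

theorem smallValues_snoc_of_le {n a : ℕ} (g : Fin a → ℕ) {v : ℕ} (hv : n ≤ v) :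
    smallValues n (Fin.snoc g v : Fin (a + 1) → ℕ) = smallValues n g := by
  rw [smallValues, image_snoc, filter_insert, if_neg hv.not_gt, smallValues]

theorem blueGenPoly_eq (n : ℕ) (R : Finset ℕ) (a : ℕ) [DecidablePred fun g : Fin a → ℕ =>
    g.Injective ∧ smallValues n g = R] :
    blueGenPoly n R a = ∑ g ∈ Fintype.piFinset (fun b : Fin a => range (n + b + 1)),
      if g.Injective ∧ smallValues n g = R then X ^ recordCount id g else 0 := by
  classical
  rw [blueGenPoly, blueWords, filter_filter, sum_filter]
  exact sum_congr rfl fun g _ => by congr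

open Classical in
theorem sum_snoc_of_mem {n a : ℕ} {R : Finset ℕ} (hR : R ⊆ range n) {v : ℕ} (hv : v ∈ R) :
    (∑ g ∈ Fintype.piFinset (fun b : Fin a => range (n + b + 1)),
      if (Fin.snoc g v : Fin (a + 1) → ℕ).Injective ∧
        smallValues n (Fin.snoc g v : Fin (a + 1) → ℕ) = R then
        (X : ℤ[X]) ^ recordCount id (Fin.snoc g v : Fin (a + 1) → ℕ) else 0) =
      X ^ belowAll id (R.erase v) v * blueGenPoly n (R.erase v) a := by
  have hvn : v < n := mem_range.1 (hR hv)
  rw [blueGenPoly_eq, mul_sum]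
  refine sum_congr rfl fun g _ => ?_
  have h1 : ((Fin.snoc g v : Fin (a + 1) → ℕ).Injective ∧
        smallValues n (Fin.snoc g v : Fin (a + 1) → ℕ) = R) ↔
      g.Injective ∧ smallValues n g = R.erase v := by
    rw [smallValues_snoc_of_lt g hvn, insert_eq_iff hv, snoc_injective_iff]
    have h2 : v ∈ univ.image g ↔ v ∈ smallValues n g := by simp [smallValues, hvn]
    rw [h2]
    constructor
    · rintro ⟨⟨h3, h4⟩, rfl | h5⟩
      · exact absurd hv h3
      · exact ⟨h4, h5⟩
    · rintro ⟨h4, h5⟩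
      exact ⟨⟨by rw [h5]; simp, h4⟩, Or.inr h5⟩
  by_cases h3 : g.Injective ∧ smallValues n g = R.erase v
  · rw [if_pos (h1.2 h3), if_pos h3, recordCount_snoc, pow_add, mul_comm]
    congr 2
    unfold belowAll
    refine if_congr ?_ rfl rfl
    rw [← h3.2]
    simp only [smallValues, mem_filter, and_imp]
    constructor
    · exact fun h u hu _ => h u hu
    · intro h u hu
      rcases lt_or_ge u n with h4 | h4
      · exact h u hu h4
      · exact hvn.trans_le h4
  · rw [if_neg fun h => h3 (h1.1 h), if_neg h3, mul_zero]

open Classical in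
theorem sum_snoc_of_le {n a : ℕ} {R : Finset ℕ} :
    (∑ v ∈ Ico n (n + a + 1), ∑ g ∈ Fintype.piFinset (fun b : Fin a => range (n + b + 1)),
      if (Fin.snoc g v : Fin (a + 1) → ℕ).Injective ∧
        smallValues n (Fin.snoc g v : Fin (a + 1) → ℕ) = R then
        (X : ℤ[X]) ^ recordCount id (Fin.snoc g v : Fin (a + 1) → ℕ) else 0) =
      X ^ (if a = 0 then 1 else 0) * (#R + 1 : ℤ[X]) * blueGenPoly n R a := by
  rw [sum_comm, blueGenPoly_eq, mul_sum]
  refine sum_congr rfl fun g hg => ?_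
  by_cases h3 : g.Injective ∧ smallValues n g = R
  · have hb : g ∈ blueWords n a := mem_filter.2 ⟨hg, h3.1⟩
    have h4 : ∀ v ∈ Ico n (n + a + 1),
        (if (Fin.snoc g v : Fin (a + 1) → ℕ).Injective ∧
          smallValues n (Fin.snoc g v : Fin (a + 1) → ℕ) = R then
          (X : ℤ[X]) ^ recordCount id (Fin.snoc g v : Fin (a + 1) → ℕ) else 0) =
        if v ∉ univ.image g then X ^ (recordCount id g + if a = 0 then 1 else 0) else 0 := by
      intro v hv
      rw [mem_Ico] at hv
      have e : ((Fin.snoc g v : Fin (a + 1) → ℕ).Injective ∧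
          smallValues n (Fin.snoc g v : Fin (a + 1) → ℕ) = R) ↔ v ∉ univ.image g := by
        rw [smallValues_snoc_of_le g hv.1, snoc_injective_iff]
        simp only [h3, and_true]
      rw [recordCount_snoc]
      refine if_congr e ?_ rfl
      congr 2
      unfold belowAll
      refine if_congr ?_ rfl rfl
      constructor
      · intro h
        by_contra ha
        have h0 := h (g ⟨0, Nat.pos_of_ne_zero ha⟩) (by simp)
        have h5 := (mem_blueWords.1 hb).1 ⟨0, Nat.pos_of_ne_zero ha⟩
        simp only [id] at h0
        simp only [add_zero] at h5
        omega
      · rintro rfl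
        simp
    rw [sum_congr rfl h4, if_pos h3, ← sum_filter, sum_const, nsmul_eq_mul, pow_add]
    have h5 : #{v ∈ Ico n (n + a + 1) | v ∉ univ.image g} = #R + 1 := by
      rw [← h3.2, ← card_Ico_sdiff_image hb, ← sdiff_eq_filter, ← Finset.insert_Ico_right_eq_Ico_add_one (by omega),
        insert_sdiff_of_notMem, card_insert_of_notMem]
      · simp
      · rw [mem_image]
        rintro ⟨b, -, h⟩
        have := (mem_blueWords.1 hb).1 b
        omega
    rw [h5]
    push_cast
    ring
  · rw [if_neg h3, mul_zero]
    refine sum_eq_zero fun v hv => if_neg fun h => h3 ?_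
    rw [mem_Ico] at hv
    rw [smallValues_snoc_of_le g hv.1, snoc_injective_iff] at h
    exact ⟨h.1.2, h.2⟩

theorem blueGenPoly_succ {n a : ℕ} {R : Finset ℕ} (hR : R ⊆ range n) :
    blueGenPoly n R (a + 1) =
      X ^ (if a = 0 then 1 else 0) * (#R + 1 : ℤ[X]) * blueGenPoly n R a +
      ∑ v ∈ R, X ^ belowAll id (R.erase v) v * blueGenPoly n (R.erase v) a := by
  classical
  rw [blueGenPoly_eq, sum_piFinset_snoc (fun b => range (n + b + 1)), range_eq_Ico,
    ← sum_Ico_consecutive _ (Nat.zero_le n) (show n ≤ n + a + 1 by omega), ← range_eq_Ico]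
  rw [sum_snoc_of_le, add_comm, ← sum_subset hR]
  · rw [sum_congr rfl fun v hv => sum_snoc_of_mem hR hv]
  · intro v hv hvR
    refine sum_eq_zero fun g _ => if_neg fun h => hvR ?_
    rw [smallValues_snoc_of_lt g (mem_range.1 hv)] at h
    rw [← h.2]
    exact mem_insert_self _ _

theorem blueGenPoly_formula {n : ℕ} (a : ℕ) {R : Finset ℕ} (hR : R ⊆ range n) :
    blueGenPoly n R a = ascPochhammer ℤ #R *
      ((X - 1) * (Nat.stirlingSecond a (#R + 1) : ℤ[X]) + (Nat.stirlingSecond (a + 1) (#R + 1) : ℤ[X])) := by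
  induction a generalizing R with
  | zero =>
    rcases R.eq_empty_or_nonempty with rfl | hne
    · simp [blueGenPoly, blueWords, smallValues, recordCount, Function.injective_of_subsingleton,
        filter_true_of_mem, show Nat.stirlingSecond 1 1 = 1 from rfl]
    · obtain ⟨c, hc⟩ := Nat.exists_eq_succ_of_ne_zero (card_ne_zero.2 hne)
      simp [blueGenPoly, smallValues, hc, Nat.stirlingSecond_succ_succ, hne.ne_empty.symm]
  | succ a ih =>
    have h1 : ∀ v ∈ R, X ^ belowAll id (R.erase v) v * blueGenPoly n (R.erase v) a =
        X ^ belowAll id (R.erase v) v * (ascPochhammer ℤ (#R - 1) *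
          ((X - 1) * (Nat.stirlingSecond a (#R - 1 + 1) : ℤ[X]) +
            (Nat.stirlingSecond (a + 1) (#R - 1 + 1) : ℤ[X]))) := by
      intro v hv
      rw [ih ((erase_subset v R).trans hR), card_erase_of_mem hv]
    rw [blueGenPoly_succ hR, sum_congr rfl h1, ← sum_mul, ih hR]
    rcases R.eq_empty_or_nonempty with rfl | hne
    · cases a <;> simp [Nat.stirlingSecond_one_right]
    · rw [sum_ite_lt_erase Function.injective_id hne]
      obtain ⟨c, hc⟩ := Nat.exists_eq_succ_of_ne_zero (card_ne_zero.2 hne)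
      rw [hc]
      simp only [Nat.succ_eq_add_one, Nat.add_sub_cancel]
      cases a with
      | zero =>
        rw [ascPochhammer_succ_right]
        simp [Nat.stirlingSecond_succ_succ]
        ring
      | succ a =>
        rw [Nat.stirlingSecond_succ_succ (a + 1 + 1) (c + 1),
          Nat.stirlingSecond_succ_succ (a + 1) (c + 1), ascPochhammer_succ_right]
        simp
        ring

end BluePositions

theorem X_mul_symPolyBernoulli (n k : ℕ) :
    X * symPolyBernoulli n k = ∑ t ∈ range (n + 1),
      (t.factorial : ℤ[X]) * (Nat.stirlingSecond n t : ℤ[X]) * (ascPochhammer ℤ t *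
        ((X - 1) * (Nat.stirlingSecond (k + 1) (t + 1) : ℤ[X]) + (Nat.stirlingSecond (k + 2) (t + 1) : ℤ[X]))) := by
  have h1 : ∀ t ∈ range (n + 1), (t.factorial : ℤ[X]) * (Nat.stirlingSecond n t : ℤ[X]) *
      (ascPochhammer ℤ t * ((X - 1) * (Nat.stirlingSecond (k + 1) (t + 1) : ℤ[X]) +
        (Nat.stirlingSecond (k + 2) (t + 1) : ℤ[X]))) =
      X * ((t.factorial : ℤ[X]) * rising t * (Nat.stirlingSecond n t : ℤ[X]) *
        (Nat.stirlingSecond (k + 1) (t + 1) : ℤ[X])) +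
      (t.factorial : ℤ[X]) * ascPochhammer ℤ t * (Nat.stirlingSecond n t : ℤ[X]) *
        (Nat.stirlingSecond (k + 1) t : ℤ[X]) := by
    intro t _
    have h2 := X_mul_rising t
    rw [ascPochhammer_succ_right] at h2
    rw [Nat.stirlingSecond_succ_succ (k + 1)]
    push_cast
    linear_combination (-(t.factorial : ℤ[X]) * (Nat.stirlingSecond n t : ℤ[X]) *
      (Nat.stirlingSecond (k + 1) (t + 1) : ℤ[X])) * h2
  have h3 : ∑ t ∈ range (n + 1), (t.factorial : ℤ[X]) * ascPochhammer ℤ t *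
      (Nat.stirlingSecond n t : ℤ[X]) * Nat.stirlingSecond (k + 1) t =
      ∑ t ∈ range (n + 1), X * (((t + 1).factorial : ℤ[X]) * rising t *
        (Nat.stirlingSecond n (t + 1) : ℤ[X]) * (Nat.stirlingSecond (k + 1) (t + 1) : ℤ[X])) := by
    rw [sum_range_succ', sum_range_succ _ n,
      Nat.stirlingSecond_eq_zero_of_lt (Nat.lt_succ_self n)]
    simp only [Nat.stirlingSecond_succ_zero, Nat.cast_zero, mul_zero, zero_mul]
    congr 1
    refine sum_congr rfl fun t _ => ?_
    rw [← X_mul_rising]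
    ring
  rw [sum_congr rfl h1, sum_add_distrib, h3, ← sum_add_distrib,
    symPolyBernoulli_eq_sum n k (n + 1) (by omega), mul_sum]
  refine sum_congr rfl fun t _ => ?_
  rw [Nat.stirlingSecond_succ_succ n, Nat.factorial_succ]
  push_cast
  ring

section ExcPerm
variable {n k : ℕ}

open Classical in
/-- The injective choices of values `h i > i` for the red positions that avoid the values of `g`. -/
noncomputable def redWords (n k : ℕ) (g : Fin (k + 1) → ℕ) : Finset (Fin n → ℕ) :=
  {h ∈ Fintype.piFinset (fun i : Fin n => {z ∈ range (n + k + 1) \ univ.image g | (i : ℕ) < z}) |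
    h.Injective}

theorem mem_redWords {g : Fin (k + 1) → ℕ} {h : Fin n → ℕ} :
    h ∈ redWords n k g ↔
      (∀ i, h i < n + k + 1 ∧ (∀ b, g b ≠ h i) ∧ (i : ℕ) < h i) ∧ h.Injective := by
  simp [redWords, and_assoc]

theorem card_redWords {g : Fin (k + 1) → ℕ} (hg : g ∈ blueWords n (k + 1)) :
    #(redWords n k g) = redCount n #(smallValues n g) (smallValues n g) := by
  rw [redWords, card_injective_gt, redCount]
  refine prod_congr rfl fun i hi => ?_
  rw [mem_range] at hi
  congr 1
  rw [← card_Ico_sdiff_image hg, ← card_union_of_disjoint]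
  · congr 1
    ext v
    simp only [smallValues, mem_filter, mem_union, mem_sdiff, mem_range, mem_Ico]
    by_cases hv : v ∈ univ.image g
    · simp [hv]
    · simp [hv]; omega
  · rw [Finset.disjoint_left]
    intro v hv hv'
    simp only [mem_filter, mem_sdiff, mem_range, mem_Ico] at hv hv'
    omega

/-- The values of a permutation at the positions outside `[n]`. -/
def bluePart (p : Equiv.Perm (Fin (n + k + 1))) (b : Fin (k + 1)) : ℕ := p ⟨n + b, by omega⟩

/-- The values of a permutation at the positions in `[n]`. -/
def redPart (p : Equiv.Perm (Fin (n + k + 1))) (i : Fin n) : ℕ := p ⟨i, by omega⟩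

theorem ExcPerm.lt_iff (p : ExcPerm n k) (i : Fin (n + k + 1)) : i < p.1 i ↔ (i : ℕ) < n :=
  Set.ext_iff.1 p.2 i

theorem ExcPerm.lr_eq (p : ExcPerm n k) : p.lr = recordCount id (bluePart p.1) - 1 := by
  unfold ExcPerm.lr recordCount
  congr 1
  symm
  refine card_bij (fun b _ => ⟨n + b, by omega⟩) ?_ ?_ ?_
  · intro b hb
    simp only [mem_filter, mem_univ, true_and] at hb ⊢
    refine ⟨by simp, fun j hj hjb => ?_⟩
    rw [Fin.lt_def] at hjb
    simp only at hjb
    have h := hb ⟨(j : ℕ) - n, by omega⟩ (by rw [Fin.lt_def]; simp only; omega)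
    simp only [id, bluePart, Nat.add_sub_cancel' hj] at h
    exact h
  · intro b _ b' _ h
    simp only [Fin.mk.injEq] at h
    exact Fin.ext (by omega)
  · intro i hi
    simp only [mem_filter, mem_univ, true_and] at hi
    refine ⟨⟨(i : ℕ) - n, by omega⟩, ?_, Fin.ext (by simp only; omega)⟩
    simp only [mem_filter, mem_univ, true_and]
    intro b hb
    rw [Fin.lt_def] at hb
    simp only at hb
    have h := hi.2 ⟨n + b, by omega⟩ (by simp) (by rw [Fin.lt_def]; simp only; omega)
    simp only [id, bluePart, Nat.add_sub_cancel' hi.1]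
    exact h

/-- The function on `Fin (n + k + 1)` with given values inside and outside `[n]`. -/
def joinParts {g : Fin (k + 1) → ℕ} {h : Fin n → ℕ} (hg : ∀ b, g b < n + k + 1)
    (hh : ∀ i, h i < n + k + 1) (x : Fin (n + k + 1)) : Fin (n + k + 1) :=
  if hx : (x : ℕ) < n then ⟨h ⟨x, hx⟩, hh _⟩ else ⟨g ⟨x - n, by omega⟩, hg _⟩

theorem joinParts_red {g : Fin (k + 1) → ℕ} {h : Fin n → ℕ} (hg : ∀ b, g b < n + k + 1)
    (hh : ∀ i, h i < n + k + 1) (i : Fin n) :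
    (joinParts hg hh ⟨i, by omega⟩ : ℕ) = h i := by
  simp [joinParts]

theorem joinParts_blue {g : Fin (k + 1) → ℕ} {h : Fin n → ℕ} (hg : ∀ b, g b < n + k + 1)
    (hh : ∀ i, h i < n + k + 1) (b : Fin (k + 1)) :
    (joinParts hg hh ⟨n + b, by omega⟩ : ℕ) = g b := by
  simp [joinParts]

theorem fin_red_or_blue (x : Fin (n + k + 1)) :
    (∃ i : Fin n, x = ⟨i, by omega⟩) ∨ ∃ b : Fin (k + 1), x = ⟨n + b, by omega⟩ := by
  by_cases hx : (x : ℕ) < n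
  · exact Or.inl ⟨⟨x, hx⟩, rfl⟩
  · exact Or.inr ⟨⟨x - n, by omega⟩, Fin.ext (by simp only; omega)⟩

theorem joinParts_injective {g : Fin (k + 1) → ℕ} {h : Fin n → ℕ} (hg : ∀ b, g b < n + k + 1)
    (hh : ∀ i, h i < n + k + 1) (hgi : g.Injective) (hhi : h.Injective)
    (hgh : ∀ i b, g b ≠ h i) : (joinParts hg hh).Injective := by
  intro x y hxy
  rw [Fin.ext_iff] at hxy
  rcases fin_red_or_blue x with ⟨i, rfl⟩ | ⟨b, rfl⟩ <;>
    rcases fin_red_or_blue y with ⟨i', rfl⟩ | ⟨b', rfl⟩ <;>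
    simp only [joinParts_red, joinParts_blue] at hxy
  · rw [hhi hxy]
  · exact absurd hxy.symm (hgh _ _)
  · exact absurd hxy (hgh _ _)
  · rw [hgi hxy]

theorem sum_excPerm {M : Type*} [AddCommMonoid M] (f : (Fin (k + 1) → ℕ) → M) :
    ∑ p : ExcPerm n k, f (bluePart p.1) =
      ∑ g ∈ blueWords n (k + 1), ∑ _h ∈ redWords n k g, f g := by
  rw [sum_sigma']
  refine sum_bij (fun p _ => ⟨bluePart p.1, redPart p.1⟩) ?_ ?_ ?_ (fun _ _ => rfl)
  · intro p _
    rw [mem_sigma, mem_blueWords, mem_redWords]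
    refine ⟨⟨fun b => ?_, fun b b' h => ?_⟩, fun i => ⟨Fin.is_lt _, fun b h => ?_, ?_⟩,
      fun i i' h => ?_⟩
    · have := (p.lt_iff ⟨n + b, by omega⟩).not.2 (by simp)
      rw [Fin.lt_def, not_lt] at this
      exact this
    · have := p.1.injective (Fin.ext h)
      simp only [Fin.mk.injEq] at this
      exact Fin.ext (by omega)
    · have := p.1.injective (Fin.ext h)
      simp only [Fin.mk.injEq] at this
      omega
    · exact (p.lt_iff ⟨i, by omega⟩).2 i.2
    · have := p.1.injective (Fin.ext h)
      simp only [Fin.mk.injEq] at this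
      exact Fin.ext this
  · intro p _ q _ h
    simp only [Sigma.mk.injEq, heq_eq_eq] at h
    refine Subtype.ext (Equiv.ext fun x => Fin.ext ?_)
    rcases fin_red_or_blue x with ⟨i, rfl⟩ | ⟨b, rfl⟩
    · exact congrFun h.2 i
    · exact congrFun h.1 b
  · rintro ⟨g, h⟩ hgh
    rw [mem_sigma, mem_blueWords, mem_redWords] at hgh
    obtain ⟨⟨hg1, hg2⟩, hh1, hh2⟩ := hgh
    simp only at hg1 hg2 hh1 hh2
    have hg : ∀ b, g b < n + k + 1 := fun b => by have := hg1 b; omega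
    have hh : ∀ i, h i < n + k + 1 := fun i => (hh1 i).1
    have hinj := joinParts_injective hg hh hg2 hh2 fun i b => (hh1 i).2.1 b
    refine ⟨⟨Equiv.ofBijective _ (Finite.injective_iff_bijective.1 hinj), ?_⟩, mem_univ _, ?_⟩
    · ext x
      simp only [Set.mem_ofPred_eq, Equiv.ofBijective_apply]
      rw [Fin.lt_def]
      rcases fin_red_or_blue x with ⟨i, rfl⟩ | ⟨b, rfl⟩
      · rw [joinParts_red]
        simp [(hh1 i).2.2]
      · rw [joinParts_blue]
        simp [hg1 b]
    · simp only [Sigma.mk.injEq, heq_eq_eq]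
      exact ⟨funext fun b => joinParts_blue hg hh b, funext fun i => joinParts_red hg hh i⟩

theorem genPoly_excPerm (n k : ℕ) :
    genPoly (ExcPerm n k) ExcPerm.lr = symPolyBernoulli n k := by
  refine mul_left_cancel₀ (X_ne_zero : (X : ℤ[X]) ≠ 0) ?_
  have h1 : X * genPoly (ExcPerm n k) ExcPerm.lr =
      ∑ g ∈ blueWords n (k + 1), (redCount n #(smallValues n g) (smallValues n g) : ℤ[X]) *
        X ^ recordCount id g := by
    have h2 : X * genPoly (ExcPerm n k) ExcPerm.lr =
        ∑ p : ExcPerm n k, X ^ recordCount id (bluePart p.1) := by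
      rw [genPoly, mul_sum]
      refine sum_congr rfl fun p _ => ?_
      rw [p.lr_eq, ← pow_succ', Nat.sub_add_cancel (recordCount_pos id _)]
    rw [h2, sum_excPerm fun g => (X : ℤ[X]) ^ recordCount id g]
    refine sum_congr rfl fun g hg => ?_
    rw [sum_const, card_redWords hg, nsmul_eq_mul]
  have h3 : ∀ g ∈ blueWords n (k + 1), smallValues n g ∈ (range n).powerset := by
    intro g _
    rw [mem_powerset]
    intro v hv
    exact mem_range.2 (mem_filter.1 hv).2
  rw [h1, ← sum_fiberwise_of_maps_to h3, X_mul_symPolyBernoulli, sum_powerset, card_range]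
  refine sum_congr rfl fun t _ => ?_
  rw [← Nat.cast_mul, ← sum_redCount, Nat.cast_sum, sum_mul]
  refine sum_congr rfl fun R hR => ?_
  rw [mem_powersetCard] at hR
  have h4 := blueGenPoly_formula (k + 1) hR.1
  rw [hR.2] at h4
  rw [← h4, blueGenPoly, mul_sum]
  refine sum_congr rfl fun g hg => ?_
  rw [(mem_filter.1 hg).2, hR.2]

end ExcPerm

section FiberList
variable {β : Type*} [DecidableEq β] {a : ℕ}

/-- The elements of a fiber, in decreasing order. -/
def fiberList (h : Fin a → β) (i : β) : List (Fin a) :=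
  (List.finRange a).reverse.filter (fun x => h x = i)

theorem mem_fiberList {h : Fin a → β} {i : β} {x : Fin a} : x ∈ fiberList h i ↔ h x = i := by
  simp [fiberList]

theorem pairwise_fiberList (h : Fin a → β) (i : β) : (fiberList h i).Pairwise (fun x y => y < x) :=
  List.Pairwise.filter _ (List.pairwise_reverse.2 (List.pairwise_lt_finRange a))

theorem fiberList_ne_nil {h : Fin a → β} (hs : h.Surjective) (i : β) : fiberList h i ≠ [] := by
  obtain ⟨x, hx⟩ := hs i
  exact List.ne_nil_of_mem (mem_fiberList.2 hx)

theorem exists_eq_append_of_forall_le {h : Fin a → β} {x : Fin a} (hx : ∀ y, h y = h x → x ≤ y) :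
    ∃ p, fiberList h (h x) = p ++ [x] := by
  obtain ⟨p, q, hpq⟩ := List.append_of_mem (mem_fiberList.2 (rfl : h x = h x))
  have hp := pairwise_fiberList h (h x)
  rcases q with _ | ⟨y, q⟩
  · exact ⟨p, hpq⟩
  · rw [hpq, List.pairwise_append] at hp
    have h1 := List.rel_of_pairwise_cons hp.2.1 (List.mem_cons_self (a := y) (l := q))
    have h2 := hx y (mem_fiberList.1 (by rw [hpq]; simp))
    exact absurd h1 h2.not_gt

theorem exists_eq_cons_of_forall_le {h : Fin a → β} {x : Fin a} (hx : ∀ y, h y = h x → y ≤ x) :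
    ∃ q, fiberList h (h x) = x :: q := by
  obtain ⟨p, q, hpq⟩ := List.append_of_mem (mem_fiberList.2 (rfl : h x = h x))
  have hp := pairwise_fiberList h (h x)
  rcases p with _ | ⟨y, p⟩
  · exact ⟨q, hpq⟩
  · rw [hpq, List.pairwise_append] at hp
    have h1 := hp.2.2 y (by simp) x (by simp)
    have h2 := hx y (mem_fiberList.1 (by rw [hpq]; simp))
    exact absurd h1 h2.not_gt

end FiberList

section Callan
variable {n k : ℕ}

theorem isBlue_eq_not_isRed (v : Elt n k) : v.isBlue = !v.isRed := by
  cases v <;> rfl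

/-- Consecutive elements of a block are decreasing. -/
def BlockRel (u v : Elt n k) : Prop := u.isRed = v.isRed → v.label < u.label

/-- A list of elements of one color with decreasing labels. -/
structure IsBlock (red : Bool) (B : List (Elt n k)) : Prop where
  ne_nil : B ≠ []
  color : ∀ v ∈ B, v.isRed = red
  decr : B.Pairwise (fun u v => v.label < u.label)

theorem IsBlock.isChain {red : Bool} {B : List (Elt n k)} (h : IsBlock red B) :
    B.IsChain BlockRel :=
  h.decr.isChain.imp fun _ _ huv _ => huv

/-- The concatenation of blue and red blocks. -/
def alternate {ι : Type*} (I : List ι) (B R : ι → List (Elt n k)) : List (Elt n k) :=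
  I.flatMap fun i => B i ++ R i

section Alternate
variable {ι : Type*} {B R : ι → List (Elt n k)}

theorem alternate_cons (i : ι) (I : List ι) :
    alternate (i :: I) B R = B i ++ (R i ++ alternate I B R) := by
  simp [alternate]

theorem alternate_append (I J : List ι) :
    alternate (I ++ J) B R = alternate I B R ++ alternate J B R := by
  simp [alternate]

theorem head?_isBlue_append {B₀ : List (Elt n k)} (hB : IsBlock false B₀) (T : List (Elt n k)) :
    ∀ v ∈ (B₀ ++ T).head?, v.isRed = false := by
  intro v hv
  obtain ⟨u, B', rfl⟩ := List.exists_cons_of_ne_nil hB.ne_nil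
  simp only [List.cons_append, List.head?_cons, Option.mem_some] at hv
  exact hv ▸ hB.color _ (List.mem_cons_self ..)

theorem head?_alternate_append (hB : ∀ i, IsBlock false (B i)) (I : List ι) (E : List (Elt n k))
    (hE : ∀ v ∈ E, v.isRed = false) :
    ∀ v ∈ (alternate I B R ++ E).head?, v.isRed = false := by
  rcases I with _ | ⟨i, I⟩
  · intro v hv
    exact hE v (List.mem_of_mem_head? (by simpa [alternate] using hv))
  · rw [alternate_cons, List.append_assoc]
    exact head?_isBlue_append (hB i) _

theorem isChain_alternate (hB : ∀ i, IsBlock false (B i)) (hR : ∀ i, IsBlock true (R i))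
    (I : List ι) : (alternate I B R).IsChain BlockRel := by
  induction I with
  | nil => simp [alternate]
  | cons i I ih =>
    rw [alternate_cons, List.isChain_append, List.isChain_append]
    refine ⟨(hB i).isChain, ⟨(hR i).isChain, ih, fun x hx y hy h => ?_⟩, fun x hx y hy h => ?_⟩
    · rw [(hR i).color x (List.mem_of_getLast? hx),
        head?_alternate_append (R := R) hB I [] (by simp) y (by simpa using hy)] at h
      simp at h
    · obtain ⟨u, R', hu⟩ := List.exists_cons_of_ne_nil (hR i).ne_nil
      rw [hu] at hy
      simp only [List.cons_append, List.head?_cons, Option.mem_some] at hy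
      subst hy
      rw [(hB i).color x (List.mem_of_getLast? hx), (hR i).color _ (by rw [hu]; simp)] at h
      simp at h

theorem blocks_append_of_isBlock {red : Bool} {B₀ : List (Elt n k)} (hB : IsBlock red B₀)
    (T : List (Elt n k)) (hT : ∀ v ∈ T.head?, v.isRed = !red) :
    blocks (B₀ ++ T) = B₀ :: blocks T := by
  unfold blocks
  rw [List.splitBy_append, List.splitBy_of_isChain hB.ne_nil, List.singleton_append]
  · refine List.Pairwise.isChain (hB.decr.imp_of_mem fun hu hv _ => ?_)
    rw [hB.color _ hu, hB.color _ hv]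
    simp
  · intro x hx y hy
    rw [hB.color x (List.mem_of_getLast? hx), hT y hy]
    cases red <;> rfl

theorem blocks_alternate_append (hB : ∀ i, IsBlock false (B i)) (hR : ∀ i, IsBlock true (R i))
    (I : List ι) (E : List (Elt n k)) (hE : ∀ v ∈ E, v.isRed = false) :
    blocks (alternate I B R ++ E) = (I.flatMap fun i => [B i, R i]) ++ blocks E := by
  induction I with
  | nil => simp [alternate]
  | cons i I ih =>
    rw [alternate_cons, List.append_assoc, List.append_assoc, blocks_append_of_isBlock (hB i),
      blocks_append_of_isBlock (hR i), ih]
    · simp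
    · exact head?_alternate_append hB I E hE
    · intro v hv
      obtain ⟨u, R', hu⟩ := List.exists_cons_of_ne_nil (hR i).ne_nil
      rw [hu] at hv
      simp only [List.cons_append, List.head?_cons, Option.mem_some] at hv
      subst hv
      exact (hR i).color _ (by rw [hu]; simp)

theorem blocks_alternate (hB : ∀ i, IsBlock false (B i)) (hR : ∀ i, IsBlock true (R i))
    (I : List ι) : blocks (alternate I B R) = I.flatMap fun i => [B i, R i] := by
  have h := blocks_alternate_append hB hR I [] (by simp)
  simpa [blocks] using h

theorem blueOnes_flatMap (hB : ∀ i, IsBlock false (B i)) (hR : ∀ i, IsBlock true (R i))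
    (I : List ι) : blueOnes (I.flatMap fun i => [B i, R i]) = I.map B := by
  induction I with
  | nil => rfl
  | cons i I ih =>
    have h1 : (B i).all Elt.isBlue = true := by
      rw [List.all_eq_true]
      intro v hv
      rw [isBlue_eq_not_isRed, (hB i).color v hv]; rfl
    have h2 : (R i).all Elt.isBlue = false := by
      rw [List.all_eq_false]
      obtain ⟨u, hu⟩ := List.exists_mem_of_ne_nil _ (hR i).ne_nil
      exact ⟨u, hu, by rw [isBlue_eq_not_isRed, (hR i).color u hu]; simp⟩
    unfold blueOnes at ih ⊢
    simp [h1, h2, ih]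

theorem redOnes_flatMap (hB : ∀ i, IsBlock false (B i)) (hR : ∀ i, IsBlock true (R i))
    (I : List ι) :
    (I.flatMap fun i => [B i, R i]).filter (fun B => B.all Elt.isRed) = I.map R := by
  induction I with
  | nil => rfl
  | cons i I ih =>
    have h1 : (R i).all Elt.isRed = true := by
      rw [List.all_eq_true]
      exact (hR i).color
    have h2 : (B i).all Elt.isRed = false := by
      rw [List.all_eq_false]
      obtain ⟨u, hu⟩ := List.exists_mem_of_ne_nil _ (hB i).ne_nil
      exact ⟨u, hu, by rw [(hB i).color u hu]; simp⟩
    simp [h1, h2, ih]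

end Alternate

/-- The string `S₁ 0 S₂ 0` of a double Callan permutation is characterized by these properties. -/
structure IsCallanWord (W : List (Elt n k)) : Prop where
  nodup : W.Nodup
  mem : ∀ v, v ∈ W
  chain : W.IsChain BlockRel
  head : ∀ v ∈ W.head?, v.isRed = false
  last : W.getLast? = some (redZero n k)

namespace DoubleCallan

/-- The string `S₁ 0 S₂ 0` with a blue and a red `0`. -/
def word (c : DoubleCallan n k) : List (Elt n k) :=
  c.S₁ ++ [blueZero n k] ++ c.S₂ ++ [redZero n k]

theorem word_eq (c : DoubleCallan n k) :
    c.word = c.S₁ ++ blueZero n k :: (c.S₂ ++ [redZero n k]) := by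
  simp [word]

theorem label_ne_zero₁ (c : DoubleCallan n k) {v : Elt n k} (h : v ∈ c.S₁) : v.label ≠ 0 :=
  (c.mem_iff v).1 (List.mem_append_left _ h)

theorem label_ne_zero₂ (c : DoubleCallan n k) {v : Elt n k} (h : v ∈ c.S₂) : v.label ≠ 0 :=
  (c.mem_iff v).1 (List.mem_append_right _ h)

theorem blueZero_notMem₁ (c : DoubleCallan n k) : blueZero n k ∉ c.S₁ :=
  fun h => c.label_ne_zero₁ h rfl

theorem blueZero_notMem₂ (c : DoubleCallan n k) : blueZero n k ∉ c.S₂ :=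
  fun h => c.label_ne_zero₂ h rfl

theorem redZero_notMem₁ (c : DoubleCallan n k) : redZero n k ∉ c.S₁ :=
  fun h => c.label_ne_zero₁ h rfl

theorem redZero_notMem₂ (c : DoubleCallan n k) : redZero n k ∉ c.S₂ :=
  fun h => c.label_ne_zero₂ h rfl

theorem label_eq_zero_iff (v : Elt n k) : v.label = 0 ↔ v = redZero n k ∨ v = blueZero n k := by
  rcases v with i | i <;> simp [Elt.label, redZero, blueZero]

theorem isCallanWord_word (c : DoubleCallan n k) : IsCallanWord c.word where
  nodup := by
    have h := c.nodup
    have h1 := c.blueZero_notMem₁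
    have h2 := c.blueZero_notMem₂
    have h3 := c.redZero_notMem₁
    have h4 := c.redZero_notMem₂
    rw [word_eq]
    rw [List.nodup_append'] at h
    rw [List.nodup_append', List.nodup_cons, List.nodup_append']
    refine ⟨h.1, ⟨?_, h.2.1, by simp, ?_⟩, ?_⟩
    · rw [List.mem_append, List.mem_singleton]
      rintro (h | h)
      · exact h2 h
      · simp [blueZero, redZero] at h
    · simp [h4]
    · intro v hv hv'
      simp only [List.mem_cons, List.mem_append, List.not_mem_nil, or_false] at hv'
      rcases hv' with rfl | hv' | rfl
      · exact h1 hv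
      · exact h.2.2 hv hv'
      · exact h3 hv
  mem v := by
    have h := c.mem_iff v
    have h' := label_eq_zero_iff v
    rw [word_eq]
    simp only [List.mem_append, List.mem_cons, List.not_mem_nil, or_false] at h ⊢
    tauto
  chain := by
    rw [word_eq]
    have h1 : (c.S₂ ++ [redZero n k]).IsChain BlockRel := by
      rw [List.isChain_append]
      refine ⟨c.decr₂, List.isChain_singleton _, fun x hx y hy _ => ?_⟩
      simp only [List.head?_cons, Option.mem_some] at hy
      subst hy
      exact Nat.pos_of_ne_zero (c.label_ne_zero₂ (List.mem_of_getLast? hx))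
    have h2 : (blueZero n k :: (c.S₂ ++ [redZero n k])).IsChain BlockRel := by
      rw [List.isChain_cons]
      refine ⟨fun y hy h => ?_, h1⟩
      have : y.isRed = true := by
        rcases hS : c.S₂ with _ | ⟨u, S⟩
        · rw [hS] at hy
          simp only [List.nil_append, List.head?_cons, Option.mem_some] at hy
          subst hy; rfl
        · rw [hS] at hy
          simp only [List.cons_append, List.head?_cons, Option.mem_some] at hy
          subst hy
          exact c.head₂ u (by rw [hS]; simp)
      rw [this] at h
      simp [blueZero, Elt.isRed] at h
    rw [List.isChain_append]
    refine ⟨c.decr₁, h2, fun x hx y hy _ => ?_⟩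
    simp only [List.head?_cons, Option.mem_some] at hy
    subst hy
    exact Nat.pos_of_ne_zero (c.label_ne_zero₁ (List.mem_of_getLast? hx))
  head v hv := by
    rw [word_eq] at hv
    rcases hS : c.S₁ with _ | ⟨u, S⟩
    · rw [hS] at hv
      simp only [List.nil_append, List.head?_cons, Option.mem_some] at hv
      subst hv; rfl
    · rw [hS] at hv
      simp only [List.cons_append, List.head?_cons, Option.mem_some] at hv
      subst hv
      have := c.head₁ u (by rw [hS]; simp)
      rw [isBlue_eq_not_isRed] at this
      simpa using this
  last := by rw [word, List.getLast?_concat]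

theorem word_injective : Function.Injective (word : DoubleCallan n k → List (Elt n k)) := by
  intro c d h
  rw [word_eq, word_eq, List.append_cons_inj_of_notMem c.blueZero_notMem₁] at h
  · exact DoubleCallan.ext h.1 (List.append_left_injective _ h.2.2)
  · rw [List.mem_append, List.mem_singleton]
    rintro (h | h)
    · exact c.blueZero_notMem₂ h
    · simp [blueZero, redZero] at h

theorem exists_word_eq {W : List (Elt n k)} (h : IsCallanWord W) :
    ∃ c : DoubleCallan n k, c.word = W := by
  obtain ⟨S₁, T, rfl⟩ := List.append_of_mem (h.mem (blueZero n k))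
  obtain ⟨S₂, rfl⟩ : ∃ S₂, T = S₂ ++ [redZero n k] := by
    have h1 := h.last
    rcases List.eq_nil_or_concat T with rfl | ⟨S₂, v, rfl⟩
    · simp [blueZero, redZero] at h1
    · refine ⟨S₂, ?_⟩
      rw [List.concat_eq_append, ← List.cons_append, ← List.append_assoc,
        List.getLast?_append] at h1
      simp only [List.getLast?_singleton, Option.some_or, Option.some.injEq] at h1
      rw [List.concat_eq_append, h1]
  have hn := h.nodup
  have hc := h.chain
  rw [List.isChain_append, List.isChain_cons, List.isChain_append] at hc
  rw [List.nodup_append', List.nodup_cons, List.nodup_append'] at hn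
  refine ⟨⟨S₁, S₂, ?_, ?_, ?_, ?_, hc.1, hc.2.1.2.1⟩, by simp [word]⟩
  · rw [List.nodup_append']
    refine ⟨hn.1, hn.2.1.2.1, fun v hv hv' => hn.2.2 hv (by simp [hv'])⟩
  · intro v
    rw [Ne, label_eq_zero_iff]
    have h1 := h.mem v
    simp only [List.mem_append, List.mem_cons, List.not_mem_nil, or_false] at h1 ⊢
    constructor
    · rintro h2 (rfl | rfl)
      · rcases h2 with h2 | h2
        · exact hn.2.2 h2 (by simp)
        · exact hn.2.1.2.2.2 h2 (by simp)
      · rcases h2 with h2 | h2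
        · exact hn.2.2 h2 (by simp)
        · exact hn.2.1.1 (by simp [h2])
    · tauto
  · intro v hv
    rw [isBlue_eq_not_isRed, h.head v (by rw [List.head?_append]; rw [Option.mem_def] at hv ⊢; simp [hv])]
    rfl
  · intro v hv
    have h2 := hc.2.1.1 v (by rw [List.head?_append]; rw [Option.mem_def] at hv ⊢; simp [hv])
    by_contra h3
    have h4 : (blueZero n k).isRed = v.isRed := by
      rw [Bool.not_eq_true] at h3
      rw [h3]; rfl
    exact absurd (h2 h4) (Nat.not_lt_zero _)

end DoubleCallan

/-- The pairs of surjections describing double Callan permutations: the red and blue elements are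
mapped to the positions of their blocks. -/
abbrev BlockData (n k j : ℕ) : Type :=
  {f : Fin (n + 1) → Fin (j + 1) // f.Surjective ∧ f 0 = Fin.last j} ×
    {g : Fin (k + 1) → Fin (j + 1) // g.Surjective}

/-- The blue elements with a given position. -/
def blueBlock {j : ℕ} (g : Fin (k + 1) → Fin (j + 1)) (i : Fin (j + 1)) : List (Elt n k) :=
  (fiberList g i).map Sum.inr

/-- The red elements with a given position. -/
def redBlock {j : ℕ} (f : Fin (n + 1) → Fin (j + 1)) (i : Fin (j + 1)) : List (Elt n k) :=
  (fiberList f i).map Sum.inl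

theorem isBlock_blueBlock {j : ℕ} {g : Fin (k + 1) → Fin (j + 1)} (hg : g.Surjective)
    (i : Fin (j + 1)) : IsBlock false (blueBlock g i : List (Elt n k)) where
  ne_nil := by simp [blueBlock, fiberList_ne_nil hg i]
  color v hv := by
    obtain ⟨b, -, rfl⟩ := List.mem_map.1 hv
    rfl
  decr := List.pairwise_map.2 (pairwise_fiberList g i)

theorem isBlock_redBlock {j : ℕ} {f : Fin (n + 1) → Fin (j + 1)} (hf : f.Surjective)
    (i : Fin (j + 1)) : IsBlock true (redBlock f i : List (Elt n k)) where
  ne_nil := by simp [redBlock, fiberList_ne_nil hf i]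
  color v hv := by
    obtain ⟨b, -, rfl⟩ := List.mem_map.1 hv
    rfl
  decr := List.pairwise_map.2 (pairwise_fiberList f i)

theorem inr_mem_blueBlock {j : ℕ} {g : Fin (k + 1) → Fin (j + 1)} {i : Fin (j + 1)}
    {b : Fin (k + 1)} : (Sum.inr b : Elt n k) ∈ blueBlock g i ↔ g b = i := by
  simp [blueBlock, mem_fiberList]

theorem inl_mem_redBlock {j : ℕ} {f : Fin (n + 1) → Fin (j + 1)} {i : Fin (j + 1)}
    {r : Fin (n + 1)} : (Sum.inl r : Elt n k) ∈ redBlock f i ↔ f r = i := by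
  simp [redBlock, mem_fiberList]

namespace BlockData
variable {j : ℕ}

/-- The string with given positions of the blocks. -/
def word (d : BlockData n k j) : List (Elt n k) :=
  alternate (List.finRange (j + 1)) (blueBlock d.2.1) (redBlock d.1.1)

theorem isBlock_blue (d : BlockData n k j) (i : Fin (j + 1)) :
    IsBlock false (blueBlock d.2.1 i : List (Elt n k)) := isBlock_blueBlock d.2.2 i

theorem isBlock_red (d : BlockData n k j) (i : Fin (j + 1)) :
    IsBlock true (redBlock d.1.1 i : List (Elt n k)) := isBlock_redBlock d.1.2.1 i

theorem mem_block (d : BlockData n k j) (v : Elt n k) (i : Fin (j + 1)) :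
    v ∈ blueBlock d.2.1 i ++ redBlock d.1.1 i ↔ Sum.elim d.1.1 d.2.1 v = i := by
  rcases v with r | b
  · rw [List.mem_append, inl_mem_redBlock, Sum.elim_inl, or_iff_right]
    intro h
    simpa [Elt.isRed] using (d.isBlock_blue i).color _ h
  · rw [List.mem_append, inr_mem_blueBlock, Sum.elim_inr, or_iff_left]
    intro h
    simpa [Elt.isRed] using (d.isBlock_red i).color _ h

theorem isCallanWord_word (d : BlockData n k j) : IsCallanWord d.word where
  nodup := by
    rw [word, alternate, List.nodup_flatMap]
    constructor
    · intro i _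
      rw [List.nodup_append']
      refine ⟨(d.isBlock_blue i).decr.imp fun h h' => ?_,
        (d.isBlock_red i).decr.imp fun h h' => ?_, fun v hv hv' => ?_⟩
      · exact absurd h (by rw [h']; exact lt_irrefl _)
      · exact absurd h (by rw [h']; exact lt_irrefl _)
      · have := (d.isBlock_blue i).color v hv
        rw [(d.isBlock_red i).color v hv'] at this
        simp at this
    · refine (List.pairwise_lt_finRange _).imp fun {i i'} h v hv hv' => ?_
      rw [mem_block] at hv hv'
      exact h.ne (hv.symm.trans hv')
  mem v := by
    rw [word, alternate, List.mem_flatMap]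
    exact ⟨_, List.mem_finRange _, (d.mem_block v _).2 rfl⟩
  chain := isChain_alternate d.isBlock_blue d.isBlock_red _
  head v hv := head?_alternate_append d.isBlock_blue _ [] (by simp) v
    (by rw [List.append_nil]; exact hv)
  last := by
    obtain ⟨p, hp⟩ := exists_eq_append_of_forall_le (h := d.1.1) (x := 0) fun _ _ => Fin.zero_le _
    rw [word, List.finRange_succ_last, alternate_append, alternate_cons]
    simp only [alternate, List.flatMap_nil, List.append_nil, redBlock]
    rw [d.1.2.2] at hp
    rw [hp]
    simp [redZero]

theorem blocks_word (d : BlockData n k j) :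
    blocks d.word = (List.finRange (j + 1)).flatMap
      fun i => [blueBlock d.2.1 i, redBlock d.1.1 i] :=
  blocks_alternate d.isBlock_blue d.isBlock_red _

theorem sigma_word_injective : Function.Injective
    (fun d : Σ j : ℕ, BlockData n k j => (d.2.word : List (Elt n k))) := by
  rintro ⟨j, d⟩ ⟨j', d'⟩ h
  simp only at h
  have h1 := congrArg (fun W => blueOnes (blocks W)) h
  have h2 := congrArg (fun W => (blocks W).filter (fun B => B.all Elt.isRed)) h
  simp only [blocks_word, blueOnes_flatMap d.isBlock_blue d.isBlock_red,
    blueOnes_flatMap d'.isBlock_blue d'.isBlock_red, redOnes_flatMap d.isBlock_blue d.isBlock_red,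
    redOnes_flatMap d'.isBlock_blue d'.isBlock_red] at h1 h2
  have h3 := congrArg List.length h1
  simp only [List.length_map, List.length_finRange, Nat.add_right_cancel_iff] at h3
  subst h3
  rw [List.map_inj_left] at h1 h2
  congr 1
  refine Prod.ext (Subtype.ext (funext fun r => ?_)) (Subtype.ext (funext fun b => ?_))
  · have h4 := h2 (d.1.1 r) (List.mem_finRange _)
    have h5 : (Sum.inl r : Elt n k) ∈ redBlock d.1.1 (d.1.1 r) := inl_mem_redBlock.2 rfl
    rw [h4] at h5
    exact (inl_mem_redBlock.1 h5).symm
  · have h4 := h1 (d.2.1 b) (List.mem_finRange _)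
    have h5 : (Sum.inr b : Elt n k) ∈ blueBlock d.2.1 (d.2.1 b) := inr_mem_blueBlock.2 rfl
    rw [h4] at h5
    exact (inr_mem_blueBlock.1 h5).symm

end BlockData

theorem isBlock_of_isChain {red : Bool} {B : List (Elt n k)} (hne : B ≠ [])
    (hc : ∀ v ∈ B, v.isRed = red) (h : B.IsChain BlockRel) : IsBlock red B where
  ne_nil := hne
  color := hc
  decr := by
    have h1 : B.IsChain (fun u v : Elt n k => v.label < u.label) :=
      h.imp_of_mem_imp fun u v hu hv huv => huv ((hc u hu).trans (hc v hv).symm)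
    have : Trans (fun u v : Elt n k => v.label < u.label) (fun u v : Elt n k => v.label < u.label)
      (fun u v : Elt n k => v.label < u.label) := ⟨fun h1 h2 => h2.trans h1⟩
    exact h1.pairwise

/-- A string that ends with a red element consists of red elements, followed by pairs of blue and
red blocks. -/
theorem exists_pairs (W : List (Elt n k)) (hne : W ≠ []) (hc : W.IsChain BlockRel)
    (hl : ∀ v ∈ W.getLast?, v.isRed = true) :
    ∃ (R₀ : List (Elt n k)) (L : List (List (Elt n k) × List (Elt n k))),
      W = R₀ ++ alternate L Prod.fst Prod.snd ∧ (∀ v ∈ R₀, v.isRed = true) ∧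
      ∀ p ∈ L, IsBlock false p.1 ∧ IsBlock true p.2 := by
  have key : ∃ (R₀ : List (Elt n k)) (L : List (List (Elt n k) × List (Elt n k))),
      W = R₀ ++ alternate L Prod.fst Prod.snd ∧ (∀ v ∈ R₀, v.isRed = true) ∧
      ∀ p ∈ L, (p.1 ≠ [] ∧ ∀ v ∈ p.1, v.isRed = false) ∧ p.2 ≠ [] ∧ ∀ v ∈ p.2, v.isRed = true := by
    clear hc
    induction W with
    | nil => exact absurd rfl hne
    | cons v W ih =>
      rcases W with _ | ⟨w, W⟩
      · exact ⟨[v], [], by simp [alternate], by simpa using hl, by simp⟩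
      · obtain ⟨R₀, L, h1, h2, h3⟩ := ih (by simp) (by simpa [List.getLast?_cons_cons] using hl)
        by_cases hv : v.isRed = true
        · exact ⟨v :: R₀, L, by rw [h1, List.cons_append], by simpa [hv] using h2, h3⟩
        · rw [Bool.not_eq_true] at hv
          rcases R₀ with _ | ⟨r, R₀⟩
          · rcases L with _ | ⟨p, L⟩
            · simp [alternate] at h1
            · refine ⟨[], (v :: p.1, p.2) :: L, ?_, by simp, ?_⟩
              · rw [h1]; simp [alternate_cons]
              · intro q hq
                rcases List.mem_cons.1 hq with rfl | hq
                · have := h3 p (by simp)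
                  exact ⟨⟨by simp, by simpa [hv] using this.1.2⟩, this.2⟩
                · exact h3 q (List.mem_cons_of_mem _ hq)
          · refine ⟨[], ([v], r :: R₀) :: L, ?_, by simp, ?_⟩
            · rw [h1]; simp [alternate_cons]
            · intro q hq
              rcases List.mem_cons.1 hq with rfl | hq
              · exact ⟨⟨by simp, by simpa using hv⟩, by simp, h2⟩
              · exact h3 q hq
  obtain ⟨R₀, L, h1, h2, h3⟩ := key
  refine ⟨R₀, L, h1, h2, fun p hp => ?_⟩
  have h4 := h3 p hp
  obtain ⟨L₁, L₂, rfl⟩ := List.append_of_mem hp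
  rw [alternate_append, alternate_cons] at h1
  refine ⟨isBlock_of_isChain h4.1.1 h4.1.2 (hc.infix ?_),
    isBlock_of_isChain h4.2.1 h4.2.2 (hc.infix ?_)⟩
  · exact ⟨R₀ ++ alternate L₁ Prod.fst Prod.snd, p.2 ++ alternate L₂ Prod.fst Prod.snd, by
      rw [h1]; simp⟩
  · exact ⟨R₀ ++ alternate L₁ Prod.fst Prod.snd ++ p.1, alternate L₂ Prod.fst Prod.snd, by
      rw [h1]; simp⟩

theorem isBlock_eq_of_mem_iff {red red' : Bool} {B B' : List (Elt n k)} (h : IsBlock red B)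
    (h' : IsBlock red' B') (hm : ∀ v, v ∈ B ↔ v ∈ B') : B = B' := by
  refine List.Perm.eq_of_pairwise (fun a b _ _ h1 h2 => absurd h1 h2.not_gt) h.decr h'.decr ?_
  have hn : ∀ {red : Bool} {B : List (Elt n k)}, IsBlock red B → B.Nodup := fun h =>
    h.decr.imp fun h1 h2 => absurd h1 (by rw [h2]; exact lt_irrefl _)
  exact (List.perm_ext_iff_of_nodup (hn h) (hn h')).2 hm

theorem exists_blockData_word_eq {W : List (Elt n k)} (h : IsCallanWord W) :
    ∃ (j : ℕ) (d : BlockData n k j), d.word = W := by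
  have hne : W ≠ [] := List.ne_nil_of_mem (h.mem (redZero n k))
  obtain ⟨R₀, L, hW, hR₀, hL⟩ := exists_pairs W hne h.chain (by
    rw [h.last]
    intro v hv
    rw [Option.mem_some] at hv
    subst hv; rfl)
  have hR : R₀ = [] := by
    rcases R₀ with _ | ⟨r, R₀⟩
    · rfl
    · have h1 := h.head r (by rw [hW]; simp)
      rw [hR₀ r (by simp)] at h1
      simp at h1
  rw [hR, List.nil_append] at hW
  obtain ⟨m, P, rfl⟩ : ∃ (m : ℕ) (P : Fin m → List (Elt n k) × List (Elt n k)), L = List.ofFn P :=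
    ⟨L.length, L.get, (List.ofFn_get L).symm⟩
  rcases m with _ | j
  · rw [hW] at hne
    simp [alternate] at hne
  have hP : ∀ i, IsBlock false (P i).1 ∧ IsBlock true (P i).2 := fun i =>
    hL _ ((List.mem_ofFn' P _).2 ⟨i, rfl⟩)
  have hW' : W = alternate (List.finRange (j + 1)) (fun i => (P i).1) (fun i => (P i).2) := by
    rw [hW, List.ofFn_eq_map, alternate, List.flatMap_map]
    rfl
  have hn := h.nodup
  rw [hW', alternate, List.nodup_flatMap] at hn
  have hdisj : ∀ v i i', v ∈ (P i).1 ++ (P i).2 → v ∈ (P i').1 ++ (P i').2 → i = i' := by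
    intro v i i' hi hi'
    have h1 : ∀ i i', i < i' → v ∈ (P i).1 ++ (P i).2 → v ∈ (P i').1 ++ (P i').2 → False := by
      intro i i' hlt hi hi'
      have := List.pairwise_iff_getElem.1 hn.2 i i' (by rw [List.length_finRange]; exact i.2)
        (by rw [List.length_finRange]; exact i'.2) hlt
      simp only [List.getElem_finRange, Fin.cast_mk, Fin.eta] at this
      exact this hi hi'
    rcases lt_trichotomy i i' with hlt | rfl | hlt
    · exact (h1 _ _ hlt hi hi').elim
    · rfl
    · exact (h1 _ _ hlt hi' hi).elim
  have hex : ∀ v : Elt n k, ∃ i, v ∈ (P i).1 ++ (P i).2 := by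
    intro v
    have := h.mem v
    rw [hW', alternate, List.mem_flatMap] at this
    obtain ⟨i, -, hi⟩ := this
    exact ⟨i, hi⟩
  have hg : ∀ b : Fin (k + 1), ∃ i, (Sum.inr b : Elt n k) ∈ (P i).1 := by
    intro b
    obtain ⟨i, hi⟩ := hex (Sum.inr b)
    rcases List.mem_append.1 hi with hi | hi
    · exact ⟨i, hi⟩
    · simpa [Elt.isRed] using (hP i).2.color _ hi
  have hf : ∀ r : Fin (n + 1), ∃ i, (Sum.inl r : Elt n k) ∈ (P i).2 := by
    intro r
    obtain ⟨i, hi⟩ := hex (Sum.inl r)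
    rcases List.mem_append.1 hi with hi | hi
    · simpa [Elt.isRed] using (hP i).1.color _ hi
    · exact ⟨i, hi⟩
  choose g hg using hg
  choose f hf using hf
  have hg' : ∀ b i, (Sum.inr b : Elt n k) ∈ (P i).1 ↔ g b = i := by
    intro b i
    constructor
    · intro hi
      exact hdisj _ _ _ (List.mem_append_left _ (hg b)) (List.mem_append_left _ hi)
    · rintro rfl
      exact hg b
  have hf' : ∀ r i, (Sum.inl r : Elt n k) ∈ (P i).2 ↔ f r = i := by
    intro b i
    constructor
    · intro hi
      exact hdisj _ _ _ (List.mem_append_right _ (hf b)) (List.mem_append_right _ hi)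
    · rintro rfl
      exact hf b
  have hgs : g.Surjective := by
    intro i
    obtain ⟨v, hv⟩ := List.exists_mem_of_ne_nil _ (hP i).1.ne_nil
    rcases v with r | b
    · simpa [Elt.isRed] using (hP i).1.color _ hv
    · exact ⟨b, (hg' b i).1 hv⟩
  have hfs : f.Surjective := by
    intro i
    obtain ⟨v, hv⟩ := List.exists_mem_of_ne_nil _ (hP i).2.ne_nil
    rcases v with r | b
    · exact ⟨r, (hf' r i).1 hv⟩
    · simpa [Elt.isRed] using (hP i).2.color _ hv
  have hf0 : f 0 = Fin.last j := by
    rw [← hf']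
    have h1 := h.last
    rw [hW', List.finRange_succ_last, alternate_append, alternate_cons] at h1
    simp only [alternate, List.flatMap_nil, List.append_nil] at h1
    rw [List.getLast?_append, List.getLast?_append] at h1
    have h2 := List.getLast?_eq_some_getLast (hP (Fin.last j)).2.ne_nil
    rw [h2] at h1
    simp only [Option.some_or, Option.some.injEq] at h1
    change redZero n k ∈ _
    rw [← h1]
    exact List.getLast_mem _
  refine ⟨j, ⟨⟨f, hfs, hf0⟩, ⟨g, hgs⟩⟩, ?_⟩
  rw [hW', BlockData.word]
  have e1 : (blueBlock g : Fin (j + 1) → List (Elt n k)) = fun i => (P i).1 := by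
    funext i
    refine isBlock_eq_of_mem_iff (isBlock_blueBlock hgs i) (hP i).1 fun v => ?_
    rcases v with r | b
    · constructor
      · intro hv
        simpa [Elt.isRed] using (isBlock_blueBlock hgs i).color _ hv
      · intro hv
        simpa [Elt.isRed] using (hP i).1.color _ hv
    · rw [inr_mem_blueBlock, hg']
  have e2 : (redBlock f : Fin (j + 1) → List (Elt n k)) = fun i => (P i).2 := by
    funext i
    refine isBlock_eq_of_mem_iff (isBlock_redBlock hfs i) (hP i).2 fun v => ?_
    rcases v with r | b
    · rw [inl_mem_redBlock, hf']
    · constructor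
      · intro hv
        simpa [Elt.isRed] using (isBlock_redBlock hfs i).color _ hv
      · intro hv
        simpa [Elt.isRed] using (hP i).2.color _ hv
  simp only [e1, e2]

end Callan

section Fiber
variable {β γ : Type*} {a : ℕ}

/-- `m i` is the smallest element of the fiber of `g` over `i`. -/
structure IsFiberMin (g : Fin a → β) (m : β → Fin a) : Prop where
  apply_eq : ∀ i, g (m i) = i
  le : ∀ y, m (g y) ≤ y

/-- `m i` is the largest element of the fiber of `g` over `i`. -/
structure IsFiberMax (g : Fin a → β) (m : β → Fin a) : Prop where
  apply_eq : ∀ i, g (m i) = i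
  le : ∀ y, y ≤ m (g y)

theorem exists_isFiberMax [DecidableEq β] {g : Fin a → β} (hg : g.Surjective) :
    ∃ m, IsFiberMax g m := by
  have h : ∀ i, ∃ x, g x = i ∧ ∀ y, g y = i → y ≤ x := by
    intro i
    obtain ⟨x₀, hx₀⟩ := hg i
    obtain ⟨x, hx, hx'⟩ := exists_max_image (univ.filter fun y => g y = i) id ⟨x₀, by simp [hx₀]⟩
    exact ⟨x, (mem_filter.1 hx).2, fun y hy => hx' y (by simp [hy])⟩
  choose m hm using h
  exact ⟨m, fun i => (hm i).1, fun y => (hm (g y)).2 y rfl⟩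

theorem IsFiberMax.isFiberMin_rev {g : Fin a → β} {m : β → Fin a} (h : IsFiberMax g m) :
    IsFiberMin (g ∘ Fin.rev) (Fin.rev ∘ m) where
  apply_eq i := by simp [h.apply_eq]
  le y := by
    have := h.le (Fin.rev y)
    rwa [← Fin.rev_le_rev, Fin.rev_rev] at this

theorem exists_isFiberMin [DecidableEq β] {g : Fin a → β} (hg : g.Surjective) :
    ∃ m, IsFiberMin g m := by
  obtain ⟨m, hm⟩ := exists_isFiberMax (g := g ∘ Fin.rev) (hg.comp Fin.rev_surjective)
  refine ⟨Fin.rev ∘ m, ?_⟩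
  have := hm.isFiberMin_rev
  rwa [Function.comp_assoc, Fin.rev_involutive.comp_self, Function.comp_id] at this

theorem IsFiberMin.injective {g : Fin a → β} {m : β → Fin a} (h : IsFiberMin g m) :
    m.Injective := Function.LeftInverse.injective h.apply_eq

theorem IsFiberMax.injective {g : Fin a → β} {m : β → Fin a} (h : IsFiberMax g m) :
    m.Injective := Function.LeftInverse.injective h.apply_eq

theorem IsFiberMin.fiberList_eq [DecidableEq β] {g : Fin a → β} {m : β → Fin a}
    (h : IsFiberMin g m) (i : β) : ∃ p, fiberList g i = p ++ [m i] := by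
  have := exists_eq_append_of_forall_le (h := g) (x := m i) fun y hy => by
    have := h.le y
    rwa [hy, h.apply_eq] at this
  rwa [h.apply_eq] at this

theorem IsFiberMax.fiberList_eq [DecidableEq β] {g : Fin a → β} {m : β → Fin a}
    (h : IsFiberMax g m) (i : β) : ∃ q, fiberList g i = m i :: q := by
  have := exists_eq_cons_of_forall_le (h := g) (x := m i) fun y hy => by
    have := h.le y
    rwa [hy, h.apply_eq] at this
  rwa [h.apply_eq] at this

theorem recordCount_eq_card [Fintype β] [LinearOrder γ] {φ : β → γ} (hφ : φ.Injective)
    {g : Fin a → β} {m : β → Fin a} (h : IsFiberMin g m) :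
    recordCount φ g = #{i : β | ∀ i', φ i' < φ i → m i < m i'} := by
  symm
  unfold recordCount
  refine card_bij (fun i _ => m i) ?_ (fun i _ i' _ hi => h.injective hi) ?_
  · intro i hi
    rw [mem_filter] at hi ⊢
    refine ⟨mem_univ _, fun b' hb' => ?_⟩
    rw [h.apply_eq]
    refine lt_of_le_of_ne (le_of_not_gt fun h1 => ?_) fun h1 => ?_
    · exact absurd ((hi.2 _ h1).trans_le (h.le b')) hb'.not_gt
    · have h2 := h.le b'
      rw [← hφ h1] at h2
      exact absurd hb' h2.not_gt
  · intro b hb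
    rw [mem_filter] at hb
    have h1 : m (g b) = b := by
      refine (h.le b).eq_of_not_lt fun h1 => ?_
      have := hb.2 _ h1
      rw [h.apply_eq] at this
      exact lt_irrefl _ this
    refine ⟨g b, ?_, h1⟩
    rw [mem_filter]
    refine ⟨mem_univ _, fun i' hi' => ?_⟩
    rw [h1]
    refine lt_of_le_of_ne (le_of_not_gt fun h2 => ?_) fun h2 => ?_
    · have := hb.2 _ h2
      rw [h.apply_eq] at this
      exact absurd hi' this.not_gt
    · rw [h2, h.apply_eq] at hi'
      exact lt_irrefl _ hi'

theorem recordCount_sub_one_eq_card [Fintype β] [LinearOrder γ] {φ : β → γ} (hφ : φ.Injective)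
    {g : Fin (a + 1) → β} {m : β → Fin (a + 1)} (h : IsFiberMin g m) :
    recordCount φ g - 1 = #{i : β | φ i < φ (g 0) ∧ ∀ i', φ i' < φ i → m i < m i'} := by
  have h0 : m (g 0) = 0 := le_antisymm (h.le 0) (Fin.zero_le _)
  classical
  have h1 : (univ.filter fun i : β => ∀ i', φ i' < φ i → m i < m i') =
      insert (g 0) (univ.filter fun i : β => φ i < φ (g 0) ∧ ∀ i', φ i' < φ i → m i < m i') := by
    ext i
    rw [mem_insert, mem_filter, mem_filter]
    constructor
    · rintro ⟨-, hi⟩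
      rcases lt_trichotomy (φ i) (φ (g 0)) with h2 | h2 | h2
      · exact Or.inr ⟨mem_univ _, h2, hi⟩
      · exact Or.inl (hφ h2)
      · have := hi _ h2
        rw [h0] at this
        exact absurd this (Fin.not_lt_zero _)
    · rintro (rfl | hi)
      · refine ⟨mem_univ _, fun i' hi' => ?_⟩
        rw [h0]
        refine Fin.pos_of_ne_zero fun h2 => ?_
        have h3 := h.apply_eq i'
        rw [h2] at h3
        rw [h3] at hi'
        exact lt_irrefl _ hi'
      · exact ⟨mem_univ _, hi.2.2⟩
  rw [recordCount_eq_card hφ h, h1, card_insert_of_notMem, Nat.add_sub_cancel]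
  rw [mem_filter]
  exact fun h2 => lt_irrefl _ h2.2.1

end Fiber

section Callan
variable {n k j : ℕ}

theorem BlockData.lt_of_nonempty (d : BlockData n k j) : j < min n k + 1 := by
  have h1 := Fintype.card_le_of_surjective _ d.1.2.1
  have h2 := Fintype.card_le_of_surjective _ d.2.2
  simp only [Fintype.card_fin] at h1 h2
  omega

open Classical in
/-- To determine the generating polynomial of double Callan permutations, it is enough to sum over
the positions of the blue elements. -/
theorem genPoly_doubleCallan_of_sum (w : DoubleCallan n k → ℕ)
    (h : ∀ (j : ℕ) (f : {f : Fin (n + 1) → Fin (j + 1) // f.Surjective ∧ f 0 = Fin.last j})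
      (e : {g : Fin (k + 1) → Fin (j + 1) // g.Surjective} → DoubleCallan n k),
      (∀ g, (e g).word = BlockData.word (f, g)) →
      ∑ g, (X : ℤ[X]) ^ w (e g) = rising j * Nat.stirlingSecond (k + 1) (j + 1)) :
    genPoly (DoubleCallan n k) w = symPolyBernoulli n k := by
  choose e he using fun d : Σ j : ℕ, BlockData n k j =>
    DoubleCallan.exists_word_eq d.2.isCallanWord_word
  let emb : (Σ j : Fin (min n k + 1), BlockData n k j) → Σ j : ℕ, BlockData n k j :=
    fun d => ⟨d.1, d.2⟩
  have hemb : emb.Injective := by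
    rintro ⟨i, d⟩ ⟨i', d'⟩ h1
    obtain rfl : i = i' := Fin.ext (congrArg Sigma.fst h1)
    exact congrArg _ (eq_of_heq (Sigma.mk.inj h1).2)
  have hbij : Function.Bijective (e ∘ emb) := by
    constructor
    · intro d d' h1
      refine hemb (BlockData.sigma_word_injective ?_)
      exact (he _).symm.trans ((congrArg DoubleCallan.word h1).trans (he _))
    · intro c
      obtain ⟨j, d, hd⟩ := exists_blockData_word_eq c.isCallanWord_word
      exact ⟨⟨⟨j, d.lt_of_nonempty⟩, d⟩, DoubleCallan.word_injective ((he _).trans hd)⟩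
  unfold genPoly
  rw [← Fintype.sum_bijective (e ∘ emb) hbij (fun d => (X : ℤ[X]) ^ w (e (emb d))) _
    fun _ => rfl, Fintype.sum_sigma, symPolyBernoulli_eq_sum n k (min n k + 1) (Nat.lt_succ_self _),
    ← Fin.sum_univ_eq_sum_range (fun j => (j.factorial : ℤ[X]) *
      rising j * Nat.stirlingSecond (n + 1) (j + 1) * Nat.stirlingSecond (k + 1) (j + 1))]
  refine Fintype.sum_congr _ _ fun i => ?_
  rw [Fintype.sum_prod_type]
  have h1 : ∀ f : {f : Fin (n + 1) → Fin ((i : ℕ) + 1) // f.Surjective ∧ f 0 = Fin.last i},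
      ∑ g : {g : Fin (k + 1) → Fin ((i : ℕ) + 1) // g.Surjective},
        (X : ℤ[X]) ^ w (e (emb ⟨i, (f, g)⟩)) =
      rising i * Nat.stirlingSecond (k + 1) (i + 1) := by
    exact fun f => h i f (fun g => e (emb ⟨i, (f, g)⟩)) fun g => he _
  rw [Fintype.sum_congr _ _ h1, sum_const, card_univ, Fintype.card_subtype,
    card_surjective_apply_eq, nsmul_eq_mul]
  push_cast
  ring

open Classical in
theorem sum_subtype_surjective_pow_recordCount {γ : Type*} [LinearOrder γ] {φ : Fin (j + 1) → γ}
    (hφ : φ.Injective) :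
    ∑ g : {g : Fin (k + 1) → Fin (j + 1) // g.Surjective}, (X : ℤ[X]) ^ (recordCount φ g.1 - 1) =
      rising j * Nat.stirlingSecond (k + 1) (j + 1) := by
  rw [← sum_surjective_pow_recordCount hφ]
  exact (Finset.sum_subtype (p := fun g => g.Surjective) _ (fun g => mem_filter_univ g)
    fun g => (X : ℤ[X]) ^ (recordCount φ g - 1)).symm

end Callan

section Callan
variable {n k j : ℕ}

theorem blockMin_blueBlock {g : Fin (k + 1) → Fin (j + 1)} {m : Fin (j + 1) → Fin (k + 1)}
    (h : IsFiberMin g m) (i : Fin (j + 1)) : blockMin (blueBlock g i : List (Elt n k)) = m i := by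
  have h1 : ((blueBlock g i : List (Elt n k)).map Elt.label).min? = some (m i : ℕ) := by
    rw [List.min?_eq_some_iff, blueBlock, List.map_map]
    refine ⟨List.mem_map.2 ⟨m i, mem_fiberList.2 (h.apply_eq i), rfl⟩, fun b hb => ?_⟩
    obtain ⟨x, hx, rfl⟩ := List.mem_map.1 hb
    rw [← mem_fiberList.1 hx]
    exact h.le x
  rw [blockMin, h1]
  rfl

theorem blockMax_blueBlock {g : Fin (k + 1) → Fin (j + 1)} {m : Fin (j + 1) → Fin (k + 1)}
    (h : IsFiberMax g m) (i : Fin (j + 1)) : blockMax (blueBlock g i : List (Elt n k)) = m i := by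
  have h1 : ((blueBlock g i : List (Elt n k)).map Elt.label).max? = some (m i : ℕ) := by
    rw [List.max?_eq_some_iff, blueBlock, List.map_map]
    refine ⟨List.mem_map.2 ⟨m i, mem_fiberList.2 (h.apply_eq i), rfl⟩, fun b hb => ?_⟩
    obtain ⟨x, hx, rfl⟩ := List.mem_map.1 hb
    rw [← mem_fiberList.1 hx]
    exact h.le x
  rw [blockMax, h1]
  rfl

theorem lrMinCount_map {a : ℕ} {l : List (Fin a)} (hl : l.Pairwise (· < ·)) (F : Fin a → ℕ) :
    lrMinCount (l.map F) = #{x : Fin a | x ∈ l ∧ ∀ y ∈ l, y < x → F x < F y} := by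
  have hlen : (l.map F).length = l.length := List.length_map _
  have hlt : ∀ p q (hp : p < l.length) (hq : q < l.length), l[p] < l[q] ↔ p < q := by
    intro p q hp hq
    rw [List.pairwise_iff_getElem] at hl
    refine ⟨fun h => lt_of_not_ge fun h' => ?_, hl p q hp hq⟩
    rcases h'.eq_or_lt with rfl | h'
    · exact lt_irrefl _ h
    · exact absurd h (hl q p hq hp h').not_gt
  unfold lrMinCount
  refine card_bij (fun p _ => l[(p : ℕ)]'(hlen ▸ p.2)) ?_ ?_ ?_
  · intro p hp
    rw [mem_filter] at hp ⊢
    refine ⟨mem_univ _, List.getElem_mem _, fun y hy hlt' => ?_⟩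
    obtain ⟨q, hq, rfl⟩ := List.getElem_of_mem hy
    simpa using hp.2 ⟨q, hlen ▸ hq⟩ ((hlt _ _ _ _).1 hlt')
  · intro p _ q _ h
    refine Fin.ext (le_antisymm (le_of_not_gt fun h' => ?_) (le_of_not_gt fun h' => ?_))
    · exact ((hlt _ _ _ _).2 h').ne h.symm
    · exact ((hlt _ _ _ _).2 h').ne h
  · intro x hx
    rw [mem_filter] at hx
    obtain ⟨q, hq, rfl⟩ := List.getElem_of_mem hx.2.1
    refine ⟨⟨q, hlen ▸ hq⟩, ?_, rfl⟩
    rw [mem_filter]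
    refine ⟨mem_univ _, fun p hp => ?_⟩
    simpa using hx.2.2 _ (List.getElem_mem (hlen ▸ p.2)) ((hlt _ _ _ _).2 hp)

theorem rlMaxCount_map_finRange {a : ℕ} (F : Fin a → ℕ) :
    rlMaxCount ((List.finRange a).map F) = #{x : Fin a | ∀ y, x < y → F y < F x} := by
  have hlen : ((List.finRange a).map F).length = a := by simp
  unfold rlMaxCount
  refine card_bij (fun p _ => p.cast hlen) ?_ (fun p _ q _ h => Fin.cast_injective _ h) ?_
  · intro p hp
    rw [mem_filter] at hp ⊢
    refine ⟨mem_univ _, fun y hy => ?_⟩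
    have h1 := hp.2 (y.cast hlen.symm) hy
    simp only [List.get_eq_getElem, List.getElem_map, List.getElem_finRange] at h1
    exact h1
  · intro x hx
    rw [mem_filter] at hx
    refine ⟨x.cast hlen.symm, ?_, rfl⟩
    rw [mem_filter]
    refine ⟨mem_univ _, fun p hp => ?_⟩
    simp only [List.get_eq_getElem, List.getElem_map, List.getElem_finRange]
    exact hx.2 (p.cast hlen) hp

theorem DoubleCallan.RL_eq {c : DoubleCallan n k} {d : BlockData n k j} (h : c.word = d.word) :
    c.RL = recordCount OrderDual.toDual (d.2.1 ∘ Fin.rev) - 1 := by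
  obtain ⟨m, hm⟩ := exists_isFiberMax d.2.2
  unfold DoubleCallan.RL
  change rlMaxCount ((blueOnes (blocks c.word)).map blockMax) - 1 = _
  rw [h, d.blocks_word, blueOnes_flatMap d.isBlock_blue d.isBlock_red, List.map_map,
    rlMaxCount_map_finRange, recordCount_eq_card OrderDual.toDual.injective hm.isFiberMin_rev]
  simp only [Function.comp_apply, blockMax_blueBlock hm, Fin.val_fin_lt, OrderDual.toDual_lt_toDual,
    Fin.rev_lt_rev]

theorem genPoly_doubleCallan_RL :
    genPoly (DoubleCallan n k) DoubleCallan.RL = symPolyBernoulli n k := by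
  classical
  refine genPoly_doubleCallan_of_sum _ fun j f e he => ?_
  simp only [DoubleCallan.RL_eq (he _)]
  rw [← sum_subtype_surjective_pow_recordCount
    (φ := (OrderDual.toDual : Fin (j + 1) → (Fin (j + 1))ᵒᵈ)) OrderDual.toDual.injective]
  refine Finset.sum_nbij' (fun g => ⟨g.1 ∘ Fin.rev, g.2.comp Fin.rev_surjective⟩)
    (fun g => ⟨g.1 ∘ Fin.rev, g.2.comp Fin.rev_surjective⟩) (by simp) (by simp) ?_ ?_ ?_
  · intro g _; ext; simp
  · intro g _; ext; simp
  · intro g _; rfl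

/-- The decomposition of a double Callan permutation into its blocks. -/
theorem exists_decomposition {c : DoubleCallan n k} {d : BlockData n k j} (h : c.word = d.word) :
    ∃ (I₁ I₂ : List (Fin (j + 1))) (E : List (Elt n k)),
      List.finRange (j + 1) = I₁ ++ d.2.1 0 :: I₂ ∧
      blueBlock d.2.1 (d.2.1 0) = E ++ [blueZero n k] ∧
      c.S₁ = alternate I₁ (blueBlock d.2.1) (redBlock d.1.1) ++ E ∧
      c.S₂ ++ [redZero n k] = redBlock d.1.1 (d.2.1 0) ++
        alternate I₂ (blueBlock d.2.1) (redBlock d.1.1) := by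
  obtain ⟨I₁, I₂, hI⟩ := List.append_of_mem (List.mem_finRange (d.2.1 0))
  obtain ⟨p, hp⟩ := exists_eq_append_of_forall_le (h := d.2.1) (x := 0) fun _ _ => Fin.zero_le _
  have hE : (blueBlock d.2.1 (d.2.1 0) : List (Elt n k)) = p.map Sum.inr ++ [blueZero n k] := by
    rw [blueBlock, hp, List.map_append]
    rfl
  refine ⟨I₁, I₂, p.map Sum.inr, hI, hE, ?_⟩
  have h1 := h
  rw [DoubleCallan.word_eq, BlockData.word, hI, alternate_append, alternate_cons, hE,
    List.append_assoc, List.singleton_append, ← List.append_assoc,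
    List.append_cons_inj_of_notMem c.blueZero_notMem₁] at h1
  · exact ⟨h1.1, h1.2.2⟩
  · rw [List.mem_append, List.mem_singleton]
    rintro (h | h)
    · exact c.blueZero_notMem₂ h
    · simp [blueZero, redZero] at h

theorem ordinaryMins_alternate_append {B R : Fin (j + 1) → List (Elt n k)}
    (hB : ∀ i, IsBlock false (B i)) (hR : ∀ i, IsBlock true (R i)) (I : List (Fin (j + 1)))
    {E : List (Elt n k)} (hE : E = [] ∨ IsBlock false E) :
    ordinaryMins (alternate I B R ++ E) = I.map (fun i => blockMin (B i)) := by
  have h1 := blueOnes_flatMap hB hR I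
  rw [ordinaryMins]
  rcases hE with rfl | hE
  · rw [List.append_nil, blocks_alternate hB hR]
    rcases List.eq_nil_or_concat I with rfl | ⟨I, i, rfl⟩
    · rfl
    · have h2 : ([R i] : List (List (Elt n k))).filter (fun B => B.all Elt.isBlue) = [] := by
        have : (R i).all Elt.isBlue = false := by
          rw [List.all_eq_false]
          obtain ⟨u, hu⟩ := List.exists_mem_of_ne_nil _ (hR i).ne_nil
          exact ⟨u, hu, by rw [isBlue_eq_not_isRed, (hR i).color u hu]; simp⟩
        simp [this]
      have h3 : ((I.concat i).flatMap fun i => [B i, R i]) =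
          ((I.flatMap fun i => [B i, R i]) ++ [B i]) ++ [R i] := by simp
      rw [h3] at h1 ⊢
      rw [List.dropLast_concat]
      unfold blueOnes at h1 ⊢
      rw [List.filter_append, h2, List.append_nil] at h1
      rw [h1, List.map_map]
      rfl
  · rw [blocks_alternate_append hB hR I E hE.color]
    have h2 : blocks E = [E] := by
      have := blocks_append_of_isBlock hE [] (by simp)
      simpa [blocks] using this
    rw [h2, List.dropLast_concat, h1, List.map_map]
    rfl

theorem DoubleCallan.lr_eq {c : DoubleCallan n k} {d : BlockData n k j} (h : c.word = d.word) :
    c.lr = recordCount id d.2.1 - 1 := by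
  obtain ⟨m, hm⟩ := exists_isFiberMin d.2.2
  obtain ⟨I₁, I₂, E, hI, hE, hS, -⟩ := exists_decomposition h
  have hE' : E = [] ∨ IsBlock false E := by
    rcases eq_or_ne E [] with h1 | h1
    · exact Or.inl h1
    · have h2 := d.isBlock_blue (d.2.1 0)
      rw [hE] at h2
      exact Or.inr ⟨h1, fun v hv => h2.color v (List.mem_append_left _ hv),
        (List.pairwise_append.1 h2.decr).1⟩
  have hp := List.pairwise_lt_finRange (j + 1)
  have hmem : ∀ i, i ∈ I₁ ↔ i < d.2.1 0 := by
    intro i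
    have h1 := List.mem_finRange i
    rw [hI] at hp h1
    rw [List.pairwise_append, List.pairwise_cons] at hp
    refine ⟨fun hi => hp.2.2 i hi _ (by simp), fun hi => ?_⟩
    rw [List.mem_append, List.mem_cons] at h1
    rcases h1 with h1 | rfl | h1
    · exact h1
    · exact absurd hi (lt_irrefl _)
    · exact absurd hi (hp.2.1.1 i h1).not_gt
  have hI₁ : I₁.Pairwise (· < ·) := by
    rw [hI, List.pairwise_append] at hp
    exact hp.1
  rw [DoubleCallan.lr, hS, ordinaryMins_alternate_append d.isBlock_blue d.isBlock_red I₁ hE',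
    lrMinCount_map hI₁, recordCount_sub_one_eq_card Function.injective_id hm]
  refine congrArg card (Finset.ext fun i => ?_)
  simp only [mem_filter, mem_univ, true_and, blockMin_blueBlock hm, hmem, id, Fin.val_fin_lt]
  exact ⟨fun h => ⟨h.1, fun i' hi' => h.2 i' (hi'.trans h.1) hi'⟩,
    fun h => ⟨h.1, fun i' _ hi' => h.2 i' hi'⟩⟩

theorem genPoly_doubleCallan_lr :
    genPoly (DoubleCallan n k) DoubleCallan.lr = symPolyBernoulli n k := by
  classical
  refine genPoly_doubleCallan_of_sum _ fun j f e he => ?_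
  simp only [DoubleCallan.lr_eq (he _)]
  exact sum_subtype_surjective_pow_recordCount Function.injective_id

end Callan

section Callan
variable {n k j : ℕ}

theorem before?_append (r v : Elt n k) (S T : List (Elt n k)) :
    before? r (S ++ v :: T) =
      ((before? r S).or (if v = r then S.getLast? else none)).or (before? r (v :: T)) := by
  induction S with
  | nil => simp [before?]
  | cons u S ih =>
    rcases S with _ | ⟨u', S⟩
    · by_cases hv : v = r <;> simp [before?, hv]
    · rw [List.cons_append, List.cons_append, before?, before?]
      by_cases hu : u' = r
      · simp [hu]
      · rw [if_neg hu, if_neg hu, List.getLast?_cons_cons]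
        exact ih

theorem before?_eq_none {r : Elt n k} {S : List (Elt n k)} (h : r ∉ S) : before? r S = none := by
  induction S with
  | nil => rfl
  | cons u S ih =>
    rcases S with _ | ⟨u', S⟩
    · rfl
    · rw [List.mem_cons, not_or] at h
      rw [before?, if_neg fun h' => h.2 (by simp [h'])]
      exact ih h.2

theorem before?_append_cons {r : Elt n k} {S : List (Elt n k)} (h : r ∉ S) (hS : S ≠ [])
    (T : List (Elt n k)) : before? r (S ++ r :: T) = S.getLast? := by
  rw [before?_append, before?_eq_none h, if_pos rfl, List.getLast?_eq_some_getLast hS]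
  rfl

theorem DoubleCallan.before?_word (c : DoubleCallan n k) {x : Fin (n + 1)} (hx : x ≠ 0)
    (h : c.S₂.head? ≠ some (Sum.inl x)) :
    before? (Sum.inl x) c.word = (before? (Sum.inl x) c.S₁).or (before? (Sum.inl x) c.S₂) := by
  have hr : redZero n k ≠ Sum.inl x := fun h => hx (Sum.inl.inj h).symm
  rw [c.word_eq, before?_append, if_neg (by simp [blueZero]), Option.or_none]
  congr 1
  rcases hS : c.S₂ with _ | ⟨u, S⟩
  · simp [before?, hr]
  · rw [hS, List.head?_cons, ne_eq, Option.some_inj] at h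
    rw [List.cons_append, before?, if_neg h, ← List.cons_append, before?_append, if_neg hr]
    simp [before?]

theorem BlockData.before?_word (d : BlockData n k j) {m : Fin (j + 1) → Fin (k + 1)}
    {M : Fin (j + 1) → Fin (n + 1)} (hm : IsFiberMin d.2.1 m) (hM : IsFiberMax d.1.1 M)
    (x : Fin (n + 1)) :
    (M (d.1.1 x) = x → before? (Sum.inl x) d.word = some (Sum.inr (m (d.1.1 x)))) ∧
    (M (d.1.1 x) ≠ x → ∃ y, before? (Sum.inl x) d.word = some (Sum.inl y)) := by
  obtain ⟨I₁, I₂, hI⟩ := List.append_of_mem (List.mem_finRange (d.1.1 x))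
  obtain ⟨R₁, R₂, hR⟩ := List.append_of_mem (mem_fiberList.2 (rfl : d.1.1 x = d.1.1 x))
  obtain ⟨p, hp⟩ := hm.fiberList_eq (d.1.1 x)
  obtain ⟨q, hq⟩ := hM.fiberList_eq (d.1.1 x)
  have hW : (d.word : List (Elt n k)) = (alternate I₁ (blueBlock d.2.1) (redBlock d.1.1) ++
      p.map Sum.inr ++ [Sum.inr (m (d.1.1 x))] ++ R₁.map Sum.inl) ++ Sum.inl x ::
        (R₂.map Sum.inl ++ alternate I₂ (blueBlock d.2.1) (redBlock d.1.1)) := by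
    rw [BlockData.word, hI, alternate_append, alternate_cons, blueBlock, redBlock, hp, hR]
    simp
  have hn := d.isCallanWord_word.nodup
  rw [hW, List.nodup_append'] at hn
  have hx := fun h => hn.2.2 h (List.mem_cons_self ..)
  rw [hW, before?_append_cons hx (by simp)]
  rw [hq] at hR
  constructor
  · intro h
    rcases R₁ with _ | ⟨y, R₁⟩
    · rw [List.map_nil, List.append_nil, List.getLast?_concat]
    · rw [h, List.cons_append, List.cons.injEq] at hR
      exact (hx (by simp [hR.1])).elim
  · intro h
    rcases List.eq_nil_or_concat R₁ with rfl | ⟨R₁, y, rfl⟩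
    · rw [List.nil_append, List.cons.injEq] at hR
      exact absurd hR.1 h
    · refine ⟨y, ?_⟩
      rw [List.concat_eq_append, List.map_append, List.map_singleton, ← List.append_assoc,
        List.getLast?_concat]

theorem head?_S₂ {c : DoubleCallan n k} {d : BlockData n k j} (h : c.word = d.word)
    {M : Fin (j + 1) → Fin (n + 1)} (hM : IsFiberMax d.1.1 M) {x : Fin (n + 1)} (hx : x ≠ 0) :
    c.S₂.head? = some (Sum.inl x) ↔ x = M (d.2.1 0) := by
  obtain ⟨I₁, I₂, E, -, -, -, hS⟩ := exists_decomposition h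
  obtain ⟨q, hq⟩ := hM.fiberList_eq (d.2.1 0)
  rw [redBlock, hq, List.map_cons, List.cons_append] at hS
  rcases hS' : c.S₂ with _ | ⟨u, S⟩
  · rw [hS', List.nil_append, List.cons.injEq] at hS
    have h0 : 0 = M (d.2.1 0) := Sum.inl.inj hS.1
    rw [← h0]
    simp [hx]
  · rw [hS', List.cons_append, List.cons.injEq] at hS
    rw [hS.1, List.head?_cons, Option.some_inj, Sum.inl.injEq, eq_comm]

theorem redsDescending_eq : redsDescending n k =
    (List.range n).reverse.map (fun x => Sum.inl (Fin.ofNat (n + 1) (x + 1))) := by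
  rw [redsDescending, ← List.map_coe_finRange_eq_range, ← List.map_reverse, List.map_map]
  refine List.map_congr_left fun i _ => ?_
  simp only [Function.comp_apply]
  congr 1
  apply Fin.ext
  simp [Fin.ofNat, Nat.mod_eq_of_lt]

theorem markCount_eq {c : DoubleCallan n k} {d : BlockData n k j} (h : c.word = d.word)
    {m : Fin (j + 1) → Fin (k + 1)} {M : Fin (j + 1) → Fin (n + 1)} (hm : IsFiberMin d.2.1 m)
    (hM : IsFiberMax d.1.1 M) (t : ℕ) (ht : t ≤ n) (hs : M (d.2.1 0) ≤ t) (b : WithTop ℕ) :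
    markCount c.S₁ c.S₂ ((List.range t).reverse.map
      (fun x => Sum.inl (Fin.ofNat (n + 1) (x + 1)))) b =
    Set.ncard {i | M (d.2.1 0) < M i ∧ (M i : ℕ) ≤ t ∧ ((m i : ℕ) : WithTop ℕ) < b ∧
      ∀ i', M i < M i' → (M i' : ℕ) ≤ t → m i < m i'} := by
  induction t generalizing b with
  | zero =>
    rw [eq_comm, List.range_zero, List.reverse_nil, List.map_nil, markCount, Set.ncard_eq_zero,
      Set.eq_empty_iff_forall_notMem]
    rintro i ⟨h1, h2, -⟩
    rw [Fin.lt_def] at h1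
    omega
  | succ t ih =>
    obtain ⟨x, hx⟩ : ∃ x : Fin (n + 1), (x : ℕ) = t + 1 := ⟨⟨t + 1, by omega⟩, rfl⟩
    have hx' : Fin.ofNat (n + 1) (t + 1) = x := Fin.ext (by
      rw [hx]; exact Nat.mod_eq_of_lt (by omega))
    have hx0 : x ≠ 0 := by
      rintro rfl
      simp at hx
    rw [List.range_succ, List.reverse_append, List.reverse_singleton, List.singleton_append,
      List.map_cons, hx', markCount]
    by_cases hxs : x = M (d.2.1 0)
    · rw [if_pos ((head?_S₂ h hM hx0).2 hxs), eq_comm, Set.ncard_eq_zero,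
        Set.eq_empty_iff_forall_notMem]
      rintro i ⟨h1, h2, -⟩
      rw [Fin.lt_def, ← hxs] at h1
      omega
    have hhead : c.S₂.head? ≠ some (Sum.inl x) := fun h1 => hxs ((head?_S₂ h hM hx0).1 h1)
    have hs' : (M (d.2.1 0) : ℕ) ≤ t := by
      have : (M (d.2.1 0) : ℕ) ≠ x := fun h1 => hxs (Fin.ext h1.symm)
      omega
    have hb := d.before?_word hm hM x
    rw [← h, c.before?_word hx0 hhead] at hb
    rw [if_neg hhead]
    by_cases hMx : M (d.1.1 x) = x
    · rw [hb.1 hMx]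
      generalize d.1.1 x = i₀ at hMx
      have hle : ∀ i, (M i : ℕ) ≤ t + 1 ↔ (M i : ℕ) ≤ t ∨ i = i₀ := by
        intro i
        constructor
        · intro h1
          rcases h1.eq_or_lt with h1 | h1
          · exact Or.inr (hM.injective (Fin.ext (by rw [hMx, hx, h1])))
          · exact Or.inl (Nat.lt_succ_iff.1 h1)
        · rintro (h1 | rfl)
          · omega
          · rw [hMx, hx]
      have hlt : ∀ i, (M i : ℕ) ≤ t → M i < M i₀ := by
        intro i hi
        rw [hMx, Fin.lt_def]
        omega
      have hnot : ∀ i', M i₀ < M i' → ¬ ((M i' : ℕ) ≤ t + 1) := by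
        intro i' hi' h1
        rw [hMx, Fin.lt_def] at hi'
        omega
      have hs₀ := hlt _ hs'
      change (if (true = true) ∧ ((m i₀ : ℕ) : WithTop ℕ) < b then
        1 + markCount c.S₁ c.S₂ _ ((m i₀ : ℕ) : WithTop ℕ) else markCount c.S₁ c.S₂ _ b) = _
      split_ifs with hb₀
      · rw [ih (by omega) hs', add_comm, ← Set.ncard_insert_of_notMem]
        · congr 1
          ext i
          rw [Set.mem_insert_iff]
          constructor
          · rintro (rfl | ⟨h1, h2, h3, h4⟩)
            · exact ⟨hs₀, by omega, hb₀.2, fun i' h1 h2 => absurd h2 (hnot i' h1)⟩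
            · refine ⟨h1, by omega, h3.trans hb₀.2, fun i' h5 h6 => ?_⟩
              rcases (hle i').1 h6 with h6 | rfl
              · exact h4 i' h5 h6
              · exact_mod_cast h3
          · rintro ⟨h1, h2, h3, h4⟩
            rcases (hle i).1 h2 with h2 | rfl
            · refine Or.inr ⟨h1, h2, ?_, fun i' h5 h6 => h4 i' h5 (by omega)⟩
              exact_mod_cast h4 i₀ (hlt i h2) ((hle _).2 (Or.inr rfl))
            · exact Or.inl rfl
        · rintro ⟨-, h2, -⟩
          exact lt_irrefl _ (hlt _ h2)
      · rw [ih (by omega) hs']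
        congr 1
        ext i
        constructor
        · rintro ⟨h1, h2, h3, h4⟩
          refine ⟨h1, by omega, h3, fun i' h5 h6 => ?_⟩
          rcases (hle i').1 h6 with h6 | rfl
          · exact h4 i' h5 h6
          · have h7 := h3.trans_le (le_of_not_gt fun h8 => hb₀ ⟨rfl, h8⟩)
            exact_mod_cast h7
        · rintro ⟨h1, h2, h3, h4⟩
          rcases (hle i).1 h2 with h2 | rfl
          · exact ⟨h1, h2, h3, fun i' h5 h6 => h4 i' h5 (by omega)⟩
          · exact absurd ⟨rfl, h3⟩ hb₀
    · obtain ⟨y, hy⟩ := hb.2 hMx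
      have hle : ∀ i, (M i : ℕ) ≤ t + 1 ↔ (M i : ℕ) ≤ t := by
        intro i
        refine ⟨fun h1 => ?_, fun h1 => by omega⟩
        have : (M i : ℕ) ≠ x := fun h2 => hMx (by rw [← Fin.ext h2, hM.apply_eq])
        omega
      rw [hy]
      simp only [hle]
      exact (if_neg fun h1 => Bool.false_ne_true h1.1).trans (ih (by omega) hs' b)

theorem DoubleCallan.br_eq {c : DoubleCallan n k} {d : BlockData n k j} (h : c.word = d.word)
    {M : Fin (j + 1) → Fin (n + 1)} (hM : IsFiberMax d.1.1 M) :
    c.br = recordCount (OrderDual.toDual ∘ M) d.2.1 - 1 := by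
  obtain ⟨m, hm⟩ := exists_isFiberMin d.2.2
  rw [DoubleCallan.br, redsDescending_eq,
    markCount_eq h hm hM n le_rfl (Nat.lt_succ_iff.1 (M _).2) ⊤,
    recordCount_sub_one_eq_card (OrderDual.toDual.injective.comp hM.injective) hm,
    ← Set.ncard_coe_finset]
  congr 1
  ext i
  simp only [mem_coe, mem_filter, mem_univ, true_and]
  have hle : ∀ i, (M i : ℕ) ≤ n := fun i => Nat.lt_succ_iff.1 (M i).2
  exact ⟨fun h1 => ⟨h1.1, fun i' h2 => h1.2.2.2 i' h2 (hle i')⟩,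
    fun h1 => ⟨h1.1, hle i, WithTop.coe_lt_top _, fun i' h2 _ => h1.2 i' h2⟩⟩

theorem genPoly_doubleCallan_br :
    genPoly (DoubleCallan n k) DoubleCallan.br = symPolyBernoulli n k := by
  classical
  refine genPoly_doubleCallan_of_sum _ fun j f e he => ?_
  obtain ⟨M, hM⟩ := exists_isFiberMax f.2.1
  rw [← sum_subtype_surjective_pow_recordCount (k := k)
    (OrderDual.toDual.injective.comp hM.injective)]
  exact Fintype.sum_congr _ _ fun g => by rw [DoubleCallan.br_eq (he g) hM]

end Callan

end SymPolyBernoulli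

theorem mainTheorem1 (n k : ℕ) :
    genPoly (DoubleCallan n k) DoubleCallan.lr = symPolyBernoulli n k ∧
    genPoly (AltTableau n k) AltTableau.st = symPolyBernoulli n k ∧
    genPoly (AltTableau n k) AltTableau.wLeft = symPolyBernoulli n k ∧
    genPoly (PackedTableau n k) PackedTableau.wLeft = symPolyBernoulli n k ∧
    genPoly (DoubleAltTree n k) DoubleAltTree.ch = symPolyBernoulli n k ∧
    genPoly (DoubleCallan n k) DoubleCallan.br = symPolyBernoulli n k ∧
    genPoly (ExcPerm n k) ExcPerm.lr = symPolyBernoulli n k ∧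
    genPoly (DoubleCallan n k) DoubleCallan.RL = symPolyBernoulli n k ∧
    genPoly (PackedTableau n k) PackedTableau.wDown = symPolyBernoulli n k :=
  ⟨genPoly_doubleCallan_lr, genPoly_altTableau_st _ _, genPoly_altTableau_wLeft _ _,
    genPoly_packedTableau_wLeft _ _, genPoly_doubleAltTree _ _, genPoly_doubleCallan_br,
    genPoly_excPerm _ _, genPoly_doubleCallan_RL, genPoly_packedTableau_wDown _ _⟩
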